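/- Let $(X,\omega)$ be a compact complex manifold of dimension $n$ with a smooth Hermitian metric (fundamental form $\omega$), let $1\le q\le n$, and put $\omega_s=\omega^s/s!$. There is a constant $c\ge 0$, depending only on $(X,\omega)$ and $q$, with $c=0$ if $\overline\partial\omega_{q-1}=\overline\partial\omega_q=0$ (in particular if $\omega$ is Kähler, i.e. $d\omega=0$), such that the following holds for every holomorphic vector bundle $E$ of rank $r$ and holomorphic line bundle $L$ over $X$ with smooth Hermitian metrics $h_E$, $h_L$, and every smooth $E\otimes L$-valued $(n,q)$-form $u$. Notation: in local holomorphic frames $(e_\alpha)$ of $E$ and $\ell$ of $L$ put $H_{\alpha\bar\beta}=h_E(e_\alpha,e_\beta)\,h_L(\ell,\ell)$ and write $u=\sum_\alpha u^\alpha\otimes e_\alpha\otimes\ell$. Let $*$ be the complex-linear Hodge operator, $\xi\wedge\overline{*\eta}=\langle\xi,\eta\rangle\omega_n$, for the inner product on forms induced by $\omega$; let $\Lambda$ be the adjoint of $\omega\wedge\cdot$, let $\gamma_u=*u$ with components $\gamma^\alpha$, and $$T_u=i^{(n-q)^2}\sum_{\alpha,\beta}H_{\alpha\bar\beta}\,\gamma^\alpha\wedge\overline{\gamma^\beta},$$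 an $(n-q,n-q)$-form. Let $D'$ be the $(1,0)$-part of the Chern connection of $E\otimes L$, let $\Theta_{E\otimes L}=i(D'\overline\partial+\overline\partial D')$ be its curvature form, $\overline\partial^*=-*D'*$, and $\Box=\overline\partial\,\overline\partial^*+\overline\partial^*\overline\partial$. All inner products and norms are pointwise. For $2n$-forms, $A\ge B$ means that $A-B=t\,\omega_n$ with $t\ge 0$ a real function. (1) If $\overline\partial u=0$, then at every point of $X$ $$i\partial\overline\partial(T_u\wedge\omega_{q-1})\ \ge\ \bigl(-2\,\mathrm{Re}\langle\Box u,u\rangle+\langle\Theta_{E\otimes L}\wedge\Lambda u,u\rangle-c|u|^2\bigr)\omega_n ,$$ and the same lower bound holds for $i\partial\overline\partial T_u\wedge\omega_{q-1}$. (2) If $d\omega=0$, then for every such $u$ (not necessarily $\overline\partial$-closed) $$i\partial\overline\partial(T_u\wedge\omega_{q-1})=i\partial\overline\partial T_u\wedge\omega_{q-1}=\bigl(-2\,\mathrm{Re}\langle\overline\partial\,\overline\partial^*u,u\rangle+\langle\Theta_{E\otimes L}\wedge\Lambda u,u\rangle+|\overline\partial\gamma_u|^2+|\overline\partial^*u|^2-|\overline\partial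 u|^2\bigr)\omega_n .$$ -/

import Mathlib

open scoped Manifold ContDiff TensorProduct Topology ComplexConjugate

noncomputable section

namespace DbarForms

/-! ### Complex-valued differential forms on open subsets of `ℂⁿ` -/

/-- The model space `ℂⁿ`. -/
abbrev Cn (n : ℕ) : Type := EuclideanSpace ℂ (Fin n)

/-- Complex-valued real-multilinear alternating `k`-forms on `ℂⁿ`. -/
abbrev CForm (n k : ℕ) : Type := Cn n [⋀^Fin k]→L[ℝ] ℂ

theorem continuous_alternating {n k : ℕ} (f : Cn n [⋀^Fin k]→ₗ[ℝ] ℂ) : Continuous f := by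
  classical
  let b := Module.finBasis ℝ (Cn n)
  have h : ∀ v : Fin k → Cn n, f v = ∑ s : Fin k → Fin (Module.finrank ℝ (Cn n)),
      (∏ i, b.coord (s i) (v i)) • f (fun i => b (s i)) := by
    intro v
    have hv : v = fun i => ∑ j, b.coord j (v i) • b j := by
      funext i
      exact (b.sum_repr (v i)).symm
    conv_lhs => rw [hv]
    rw [← AlternatingMap.coe_multilinearMap, MultilinearMap.map_sum]
    refine Finset.sum_congr rfl fun s _ => ?_
    rw [MultilinearMap.map_smul_univ]
  have hf : (f : (Fin k → Cn n) → ℂ) = fun v => ∑ s : Fin k → Fin (Module.finrank ℝ (Cn n)),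
      (∏ i, b.coord (s i) (v i)) • f (fun i => b (s i)) := funext h
  rw [hf]
  refine continuous_finsetSum _ fun s _ => ?_
  refine Continuous.smul (f := fun v : Fin k → Cn n => ∏ i, b.coord (s i) (v i)) ?_ continuous_const
  refine continuous_finsetProd _ fun i _ => ?_
  exact (LinearMap.continuous_of_finiteDimensional (b.coord (s i))).comp (continuous_apply i)

/-- An alternating map on `ℂⁿ` as an element of `CForm` (continuity is automatic). -/
def ofAlt {n k : ℕ} (f : Cn n [⋀^Fin k]→ₗ[ℝ] ℂ) : CForm n k :=
  { f with cont := continuous_alternating f }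

/-- A `k`-form regarded as an `m`-form when `k = m`. -/
def castForm {n k m : ℕ} (h : k = m) (a : CForm n k) : CForm n m :=
  ofAlt (a.toAlternatingMap.domDomCongr (finCongr h))

/-- The wedge product (sum over shuffles), `k + l = m`. -/
def wedge {n k l m : ℕ} (h : k + l = m) (a : CForm n k) (b : CForm n l) : CForm n m :=
  ofAlt (((LinearMap.mul' ℝ ℂ).compAlternatingMap
    (a.toAlternatingMap.domCoprod b.toAlternatingMap)).domDomCongr
      (finSumFinEquiv.trans (finCongr h)))

/-- Complex conjugation of forms. -/
def conjForm {n k : ℕ} (a : CForm n k) : CForm n k :=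
  (Complex.conjCLE : ℂ →L[ℝ] ℂ).compContinuousAlternatingMap a

/-- A number as a `0`-form. -/
def zeroForm {n : ℕ} (c : ℂ) : CForm n 0 :=
  ContinuousAlternatingMap.constOfIsEmpty ℝ (Cn n) (Fin 0) c

/-- The coordinate form `dz_j`. -/
def dz {n : ℕ} (j : Fin n) : CForm n 1 :=
  ContinuousAlternatingMap.ofSubsingleton ℝ (Cn n) ℂ (0 : Fin 1)
    ((EuclideanSpace.proj j : Cn n →L[ℂ] ℂ).restrictScalars ℝ)

/-- Multiplication by `i` on `ℂⁿ` as a real-linear map. -/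
def mulI (n : ℕ) : Cn n →L[ℝ] Cn n :=
  (Complex.I • ContinuousLinearMap.id ℂ (Cn n)).restrictScalars ℝ

/-- The operator `∂` on `k`-forms: the alternation of the complex-linear part
`(A v - i A (i v)) / 2` of the derivative `A`. -/
def del {n k : ℕ} (a : Cn n → CForm n k) (z : Cn n) : CForm n (k + 1) :=
  ContinuousAlternatingMap.alternatizeUncurryFin
    ((1 / 2 : ℂ) • (fderiv ℝ a z - Complex.I • (fderiv ℝ a z).comp (mulI n)))

/-- The operator `∂̄` on `k`-forms: the alternation of the conjugate-linear part
`(A v + i A (i v)) / 2` of the derivative `A`. -/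
def dbar {n k : ℕ} (a : Cn n → CForm n k) (z : Cn n) : CForm n (k + 1) :=
  ContinuousAlternatingMap.alternatizeUncurryFin
    ((1 / 2 : ℂ) • (fderiv ℝ a z + Complex.I • (fderiv ℝ a z).comp (mulI n)))

/-! ### Pointwise Hermitian algebra

`G` is the matrix `G j k = ⟨∂/∂z_j, ∂/∂z_k⟩` (linear in the first slot) of a Hermitian metric at
a point; the associated Riemannian metric is its real part. -/

/-- The fundamental form `ω = (i/2) ∑ G_{jk} dz_j ∧ dz̄_k`. -/
def omega {n : ℕ} (G : Matrix (Fin n) (Fin n) ℂ) : CForm n 2 :=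
  ∑ j, ∑ k, (Complex.I / 2 * G j k) • wedge (m := 2) rfl (dz j) (conjForm (dz k))

/-- `ω_s = ω ^ s / s!`. -/
def omegaPow {n : ℕ} (G : Matrix (Fin n) (Fin n) ℂ) : (s : ℕ) → CForm n (2 * s)
  | 0 => zeroForm 1
  | s + 1 => (1 / ((s : ℂ) + 1)) • wedge (by omega) (omegaPow G s) (omega G)

/-- The real basis `∂/∂x_j`, `∂/∂y_j` of `ℂⁿ`. -/
def realBasis {n : ℕ} (s : Fin n × Fin 2) : Cn n :=
  EuclideanSpace.single s.1 (if s.2 = 0 then 1 else Complex.I)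

/-- The Gram matrix of the Riemannian metric in the real basis. -/
def riemGram {n : ℕ} (G : Matrix (Fin n) (Fin n) ℂ) : Matrix (Fin n × Fin 2) (Fin n × Fin 2) ℝ :=
  fun s t => (∑ j, ∑ k, G j k * realBasis s j * conj (realBasis t k)).re

/-- The Hermitian inner product on complex `k`-forms induced by the Riemannian metric:
`(1/k!) ∑ g^{s₁t₁} ⋯ g^{s_k t_k} a_{s₁…s_k} conj (b_{t₁…t_k})`. -/
def formInner {n k : ℕ} (G : Matrix (Fin n) (Fin n) ℂ) (a b : CForm n k) : ℂ :=
  (1 / (k.factorial : ℂ)) * ∑ s : Fin k → Fin n × Fin 2, ∑ t : Fin k → Fin n × Fin 2,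
    ((∏ l, (riemGram G)⁻¹ (s l) (t l) : ℝ) : ℂ) *
      (a (fun l => realBasis (s l)) * conj (b (fun l => realBasis (t l))))

/-- The (complex linear) Hodge operator: `* a` is the form with
`c ∧ conj (* a) = ⟨c, a⟩ ω_n` for all `c`. -/
def hodge {n k l : ℕ} (G : Matrix (Fin n) (Fin n) ℂ) (h : k + l = 2 * n) (a : CForm n k) :
    CForm n l :=
  Classical.epsilon fun b : CForm n l =>
    ∀ c : CForm n k, wedge h c (conjForm b) = formInner G c a • omegaPow G n

/-- The operator `Λ`, the adjoint of `c ↦ ω ∧ c`. -/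
def lambdaOp {n k m : ℕ} (G : Matrix (Fin n) (Fin n) ℂ) (h : 2 + k = m) (a : CForm n m) :
    CForm n k :=
  Classical.epsilon fun b : CForm n k =>
    ∀ c : CForm n k, formInner G b c = formInner G a (wedge h (omega G) c)

/-- `A ≥ B` for forms of top degree: `A - B` is a nonnegative real multiple of `ω_n`. -/
def TopGE {n : ℕ} (G : Matrix (Fin n) (Fin n) ℂ) (A B : CForm n (2 * n)) : Prop :=
  ∃ t : ℝ, 0 ≤ t ∧ A = B + (t : ℂ) • omegaPow G n

/-! ### Vector-valued forms in a holomorphic frame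

`u : Fin r → Cn n → CForm n k` are the components `u^α` in a holomorphic frame,
`H z α β = h(e_α, e_β)` (linear in the first slot) is the matrix of the fibre metric and `G z` the
matrix of the metric of the base. -/

/-- The Chern connection forms `∑_β (∂H_{lβ}) H^{βα}`. -/
def conn {n r : ℕ} (H : Cn n → Matrix (Fin r) (Fin r) ℂ) (l α : Fin r) (z : Cn n) : CForm n 1 :=
  ∑ β, ((H z)⁻¹ β α) • (del (fun w => zeroForm (H w l β)) z : CForm n (0 + 1))

/-- `D'`, the `(1,0)`-part of the Chern connection. -/
def dPrime {n r k : ℕ} (H : Cn n → Matrix (Fin r) (Fin r) ℂ) (u : Fin r → Cn n → CForm n k)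
    (α : Fin r) (z : Cn n) : CForm n (k + 1) :=
  del (u α) z + ∑ l, wedge (Nat.add_comm 1 k) (conn H l α z) (u l z)

/-- The curvature form `Θ = i (D'∂̄ + ∂̄D')`, with entries `i ∂̄(∑_β (∂H_{lβ}) H^{βα})`. Lowering the
index `α` with `H` gives `-i ∑ (∂_a∂_b̄ H - ∂_a H H⁻¹ ∂_b̄ H) dz_a ∧ dz̄_b`. -/
def curv {n r : ℕ} (H : Cn n → Matrix (Fin r) (Fin r) ℂ) (l α : Fin r) (z : Cn n) : CForm n 2 :=
  Complex.I • (dbar (conn H l α) z : CForm n (1 + 1))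

/-- The pointwise inner product of vector-valued forms. -/
def vInner {n r k : ℕ} (G : Cn n → Matrix (Fin n) (Fin n) ℂ) (H : Cn n → Matrix (Fin r) (Fin r) ℂ)
    (u v : Fin r → Cn n → CForm n k) (z : Cn n) : ℂ :=
  ∑ α, ∑ β, H z α β * formInner (G z) (u α z) (v β z)

/-- The Hodge operator on vector-valued forms, applied to each component. -/
def vHodge {n r k l : ℕ} (G : Cn n → Matrix (Fin n) (Fin n) ℂ) (h : k + l = 2 * n)
    (u : Fin r → Cn n → CForm n k) (α : Fin r) (z : Cn n) : CForm n l :=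
  hodge (G z) h (u α z)

/-- `∂̄` on vector-valued forms in a holomorphic frame. -/
def vDbar {n r k : ℕ} (u : Fin r → Cn n → CForm n k) (α : Fin r) (z : Cn n) : CForm n (k + 1) :=
  dbar (u α) z

/-- `∂̄* = - * D' *`; forms of degree `k > 2n` vanish and are sent to `0`. -/
def dbarStar {n r k m : ℕ} (G : Cn n → Matrix (Fin n) (Fin n) ℂ)
    (H : Cn n → Matrix (Fin r) (Fin r) ℂ) (h : m + 1 = k)
    (u : Fin r → Cn n → CForm n k) (α : Fin r) (z : Cn n) : CForm n m :=
  if hk : k ≤ 2 * n then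
    - vHodge (k := 2 * n - k + 1) G (by omega)
        (dPrime H (vHodge (l := 2 * n - k) G (by omega) u)) α z
  else 0

/-- `∂̄∂̄*`. -/
def dbarDbarStar {n r k : ℕ} (G : Cn n → Matrix (Fin n) (Fin n) ℂ)
    (H : Cn n → Matrix (Fin r) (Fin r) ℂ) (hk : 1 ≤ k)
    (u : Fin r → Cn n → CForm n k) (α : Fin r) (z : Cn n) : CForm n k :=
  castForm (by omega) (vDbar (dbarStar (m := k - 1) G H (by omega) u) α z)

/-- The `∂̄`-Laplacian `□ = ∂̄∂̄* + ∂̄*∂̄`. -/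
def box {n r k : ℕ} (G : Cn n → Matrix (Fin n) (Fin n) ℂ)
    (H : Cn n → Matrix (Fin r) (Fin r) ℂ) (hk : 1 ≤ k)
    (u : Fin r → Cn n → CForm n k) (α : Fin r) (z : Cn n) : CForm n k :=
  dbarDbarStar G H hk u α z + dbarStar G H rfl (vDbar u) α z

/-- `Θ ∧ Λu`. -/
def curvLambda {n r k : ℕ} (G : Cn n → Matrix (Fin n) (Fin n) ℂ)
    (H : Cn n → Matrix (Fin r) (Fin r) ℂ) (hk : 2 ≤ k)
    (u : Fin r → Cn n → CForm n k) (α : Fin r) (z : Cn n) : CForm n k :=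
  ∑ l, wedge (by omega) (curv H l α z)
    (lambdaOp (k := k - 2) (G z) (by omega) (u l z))

/-- `γ_u = * u` for an `(n,q)`-form `u`. -/
def gam {n r q : ℕ} (G : Cn n → Matrix (Fin n) (Fin n) ℂ) (hq : q ≤ n)
    (u : Fin r → Cn n → CForm n (n + q)) : Fin r → Cn n → CForm n (n - q) :=
  vHodge G (by omega) u

/-- `T_u = i^{(n-q)²} ∑ H_{αβ} γ^α ∧ conj γ^β`. -/
def tForm {n r q : ℕ} (G : Cn n → Matrix (Fin n) (Fin n) ℂ) (H : Cn n → Matrix (Fin r) (Fin r) ℂ)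
    (hq : q ≤ n) (u : Fin r → Cn n → CForm n (n + q)) (z : Cn n) :
    CForm n ((n - q) + (n - q)) :=
  (Complex.I ^ ((n - q) ^ 2)) •
    ∑ α, ∑ β, H z α β • wedge rfl (gam G hq u α z) (conjForm (gam G hq u β z))

/-- `i∂∂̄(T_u ∧ ω_{q-1})`. -/
def ddbarTOmega {n r q : ℕ} (G : Cn n → Matrix (Fin n) (Fin n) ℂ)
    (H : Cn n → Matrix (Fin r) (Fin r) ℂ) (h1 : 1 ≤ q) (hq : q ≤ n)
    (u : Fin r → Cn n → CForm n (n + q)) (z : Cn n) : CForm n (2 * n) :=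
  castForm (k := 2 * n - 2 + 1 + 1) (by omega) (Complex.I • del (dbar (fun w =>
    wedge (m := 2 * n - 2) (by omega) (tForm G H hq u w) (omegaPow (G w) (q - 1)))) z)

/-- `i∂∂̄T_u ∧ ω_{q-1}`. -/
def ddbarTWedgeOmega {n r q : ℕ} (G : Cn n → Matrix (Fin n) (Fin n) ℂ)
    (H : Cn n → Matrix (Fin r) (Fin r) ℂ) (h1 : 1 ≤ q) (hq : q ≤ n)
    (u : Fin r → Cn n → CForm n (n + q)) (z : Cn n) : CForm n (2 * n) :=
  wedge (by omega) (Complex.I • del (dbar (tForm G H hq u)) z) (omegaPow (G z) (q - 1))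

/-- The right-hand side `(-2 Re⟨□u,u⟩ + ⟨Θ ∧ Λu, u⟩ - c|u|²) ω_n`. -/
def siuLowerBound {n r q : ℕ} (G : Cn n → Matrix (Fin n) (Fin n) ℂ)
    (H : Cn n → Matrix (Fin r) (Fin r) ℂ) (h1 : 1 ≤ q) (hq : q ≤ n) (c : ℝ)
    (u : Fin r → Cn n → CForm n (n + q)) (z : Cn n) : CForm n (2 * n) :=
  (-2 * ((vInner G H (box G H (by omega) u) u z).re : ℂ)
    + vInner G H (curvLambda G H (by omega) u) u z
    - (c : ℂ) * vInner G H u u z) • omegaPow (G z) n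

/-- The right-hand side
`(-2 Re⟨∂̄∂̄*u,u⟩ + ⟨Θ ∧ Λu, u⟩ + |∂̄γ_u|² + |∂̄*u|² - |∂̄u|²) ω_n`. -/
def bochnerTerm {n r q : ℕ} (G : Cn n → Matrix (Fin n) (Fin n) ℂ)
    (H : Cn n → Matrix (Fin r) (Fin r) ℂ) (h1 : 1 ≤ q) (hq : q ≤ n)
    (u : Fin r → Cn n → CForm n (n + q)) (z : Cn n) : CForm n (2 * n) :=
  (-2 * ((vInner G H (dbarDbarStar G H (by omega) u) u z).re : ℂ)
    + vInner G H (curvLambda G H (by omega) u) u z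
    + vInner G H (vDbar (gam G hq u)) (vDbar (gam G hq u)) z
    + vInner G H (dbarStar (m := n + q - 1) G H (by omega) u)
        (dbarStar (m := n + q - 1) G H (by omega) u) z
    - vInner G H (vDbar u) (vDbar u) z) • omegaPow (G z) n

/-! ### Hermitian manifolds, Hermitian holomorphic bundles and bundle-valued forms -/

section Global

variable {n : ℕ} {X : Type*} [TopologicalSpace X] [ChartedSpace (Cn n) X]

/-- The differential at `z` of the inverse of a chart `φ`. -/
def chartFrame (φ : OpenPartialHomeomorph X (Cn n)) (z : Cn n) :
    Cn n →ₗ[ℂ] TangentSpace 𝓘(ℂ, Cn n) (φ.symm z) :=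
  (mfderiv 𝓘(ℂ, Cn n) 𝓘(ℂ, Cn n) φ.symm z :
    TangentSpace 𝓘(ℂ, Cn n) z →L[ℂ] TangentSpace 𝓘(ℂ, Cn n) (φ.symm z)).toLinearMap

variable (n X) in
/-- A smooth Hermitian metric on the complex manifold `X` (conjugate linear in the first slot). -/
structure HermitianMetric where
  toFun : ∀ x : X, TangentSpace 𝓘(ℂ, Cn n) x →ₗ⋆[ℂ] TangentSpace 𝓘(ℂ, Cn n) x →ₗ[ℂ] ℂ
  conj_symm : ∀ x v w, conj (toFun x v w) = toFun x w v
  pos : ∀ x v, v ≠ 0 → 0 < (toFun x v v).re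
  smooth : ∀ φ ∈ atlas (Cn n) X, ∀ a b : Cn n,
    ContDiffOn ℝ ∞ (fun z => toFun (φ.symm z) (chartFrame φ z a) (chartFrame φ z b)) φ.target

/-- The matrix `G j k = ⟨∂/∂z_j, ∂/∂z_k⟩` of a Hermitian metric in a chart. -/
def HermitianMetric.gram (g : HermitianMetric n X) (φ : OpenPartialHomeomorph X (Cn n))
    (z : Cn n) : Matrix (Fin n) (Fin n) ℂ :=
  fun j k => g.toFun (φ.symm z) (chartFrame φ z (EuclideanSpace.single k 1))
    (chartFrame φ z (EuclideanSpace.single j 1))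

/-- `∂̄ω_s = 0`. -/
def HermitianMetric.DbarOmegaPowEqZero (g : HermitianMetric n X) (s : ℕ) : Prop :=
  ∀ φ ∈ atlas (Cn n) X, ∀ z ∈ φ.target, dbar (fun w => omegaPow (g.gram φ w) s) z = 0

/-- The metric is Kähler: `dω = 0`. -/
def HermitianMetric.IsKahler (g : HermitianMetric n X) : Prop :=
  ∀ φ ∈ atlas (Cn n) X, ∀ z ∈ φ.target, extDeriv (fun w => omega (g.gram φ w)) z = 0

/-- A smooth Hermitian metric on a complex vector bundle over `X` (conjugate linear in the first
slot). -/
structure BundleMetric (F : Type*) [NormedAddCommGroup F] [NormedSpace ℂ F] (E : X → Type*)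
    [∀ x, AddCommGroup (E x)] [∀ x, Module ℂ (E x)] [∀ x, TopologicalSpace (E x)]
    [TopologicalSpace (Bundle.TotalSpace F E)] [FiberBundle F E] [VectorBundle ℂ F E] where
  toFun : ∀ x, E x →ₗ⋆[ℂ] E x →ₗ[ℂ] ℂ
  conj_symm : ∀ x v w, conj (toFun x v w) = toFun x w v
  pos : ∀ x v, v ≠ 0 → 0 < (toFun x v v).re
  smooth : ∀ φ ∈ atlas (Cn n) X,
    ∀ (e : Bundle.Trivialization F (Bundle.TotalSpace.proj : Bundle.TotalSpace F E → X))
      [MemTrivializationAtlas e], ∀ a b : F,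
    ContDiffOn ℝ ∞ (fun z => toFun (φ.symm z) (e.symmₗ ℂ (φ.symm z) a) (e.symmₗ ℂ (φ.symm z) b))
      (φ.target ∩ φ.symm ⁻¹' e.baseSet)

section Bundle

variable {r k : ℕ} {E L : X → Type*}
  [∀ x, AddCommGroup (E x)] [∀ x, Module ℂ (E x)] [∀ x, TopologicalSpace (E x)]
  [TopologicalSpace (Bundle.TotalSpace (Cn r) E)] [FiberBundle (Cn r) E] [VectorBundle ℂ (Cn r) E]
  [∀ x, AddCommGroup (L x)] [∀ x, Module ℂ (L x)] [∀ x, TopologicalSpace (L x)]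
  [TopologicalSpace (Bundle.TotalSpace ℂ L)] [FiberBundle ℂ L] [VectorBundle ℂ ℂ L]

variable (n E L k) in
/-- `E ⊗ L`-valued `k`-forms (not necessarily smooth). -/
abbrev BundleForm : Type _ :=
  ∀ x : X, TangentSpace 𝓘(ℂ, Cn n) x [⋀^Fin k]→ₗ[ℝ] (E x ⊗[ℂ] L x)

/-- The `α`-th coordinate on `E_x ⊗ L_x` in the frame `e_1 ⊗ ℓ, …, e_r ⊗ ℓ` given by local
trivializations of `E` and `L`. -/
def tensorCoord (e : Bundle.Trivialization (Cn r) (Bundle.TotalSpace.proj :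
      Bundle.TotalSpace (Cn r) E → X)) [MemTrivializationAtlas e]
    (e' : Bundle.Trivialization ℂ (Bundle.TotalSpace.proj : Bundle.TotalSpace ℂ L → X))
    [MemTrivializationAtlas e'] (x : X) (α : Fin r) : E x ⊗[ℂ] L x →ₗ[ℂ] ℂ :=
  (LinearMap.mul' ℂ ℂ) ∘ₗ TensorProduct.map
    ((EuclideanSpace.proj α : Cn r →L[ℂ] ℂ).toLinearMap ∘ₗ e.linearMapAt ℂ x)
    (e'.linearMapAt ℂ x)

/-- The components `u^α` of an `E ⊗ L`-valued form in a chart of `X` and local holomorphic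
trivializations of `E` and `L`. -/
def localForm (φ : OpenPartialHomeomorph X (Cn n))
    (e : Bundle.Trivialization (Cn r) (Bundle.TotalSpace.proj :
      Bundle.TotalSpace (Cn r) E → X)) [MemTrivializationAtlas e]
    (e' : Bundle.Trivialization ℂ (Bundle.TotalSpace.proj : Bundle.TotalSpace ℂ L → X))
    [MemTrivializationAtlas e'] (u : BundleForm n k E L) (α : Fin r) (z : Cn n) : CForm n k :=
  ofAlt (((tensorCoord e e' (φ.symm z) α).restrictScalars ℝ).compAlternatingMap
    ((u (φ.symm z)).compLinearMap ((chartFrame φ z).restrictScalars ℝ)))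

/-- The part of a chart over which given trivializations of `E` and `L` are defined. -/
def domainOf (φ : OpenPartialHomeomorph X (Cn n))
    (e : Bundle.Trivialization (Cn r) (Bundle.TotalSpace.proj : Bundle.TotalSpace (Cn r) E → X))
    (e' : Bundle.Trivialization ℂ (Bundle.TotalSpace.proj : Bundle.TotalSpace ℂ L → X)) :
    Set (Cn n) :=
  φ.target ∩ φ.symm ⁻¹' (e.baseSet ∩ e'.baseSet)

/-- The matrix `H α β = h_E(e_α, e_β) h_L(ℓ, ℓ)` of the product metric on `E ⊗ L`. -/
def tensorGram (hE : BundleMetric (n := n) (Cn r) E) (hL : BundleMetric (n := n) ℂ L)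
    (φ : OpenPartialHomeomorph X (Cn n))
    (e : Bundle.Trivialization (Cn r) (Bundle.TotalSpace.proj :
      Bundle.TotalSpace (Cn r) E → X)) [MemTrivializationAtlas e]
    (e' : Bundle.Trivialization ℂ (Bundle.TotalSpace.proj : Bundle.TotalSpace ℂ L → X))
    [MemTrivializationAtlas e'] (z : Cn n) : Matrix (Fin r) (Fin r) ℂ :=
  fun α β =>
    hE.toFun (φ.symm z) (e.symmₗ ℂ (φ.symm z) (EuclideanSpace.single β 1))
      (e.symmₗ ℂ (φ.symm z) (EuclideanSpace.single α 1)) *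
    hL.toFun (φ.symm z) (e'.symmₗ ℂ (φ.symm z) 1) (e'.symmₗ ℂ (φ.symm z) 1)

/-- `u` is smooth. -/
def BundleForm.IsSmooth (u : BundleForm n k E L) : Prop :=
  ∀ φ ∈ atlas (Cn n) X,
    ∀ (e : Bundle.Trivialization (Cn r) (Bundle.TotalSpace.proj :
        Bundle.TotalSpace (Cn r) E → X)) [MemTrivializationAtlas e]
      (e' : Bundle.Trivialization ℂ (Bundle.TotalSpace.proj : Bundle.TotalSpace ℂ L → X))
      [MemTrivializationAtlas e'] (α : Fin r),
      ContDiffOn ℝ ∞ (localForm φ e e' u α) (domainOf φ e e')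

/-- `∂̄u = 0`. -/
def BundleForm.DbarClosed (u : BundleForm n k E L) : Prop :=
  ∀ φ ∈ atlas (Cn n) X,
    ∀ (e : Bundle.Trivialization (Cn r) (Bundle.TotalSpace.proj :
        Bundle.TotalSpace (Cn r) E → X)) [MemTrivializationAtlas e]
      (e' : Bundle.Trivialization ℂ (Bundle.TotalSpace.proj : Bundle.TotalSpace ℂ L → X))
      [MemTrivializationAtlas e'] (α : Fin r), ∀ z ∈ domainOf φ e e',
      vDbar (localForm φ e e' u) α z = 0

/-- `u` is of type `(p, q)`. -/
def BundleForm.IsType {p q : ℕ} (u : BundleForm n (p + q) E L) : Prop :=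
  ∀ (x : X) (ζ : ℂ) (v : Fin (p + q) → TangentSpace 𝓘(ℂ, Cn n) x),
    u x (fun i => ζ • v i) = (ζ ^ p * (conj ζ) ^ q) • u x v

end Bundle

end Global

end DbarForms

end

open DbarForms

/-! Put p = n - q and γ = *u. Since u has type (n,q), γ has type (p,0) and u = i^{p²} γ ∧ ω_q;
wedging with ω_q is an isometry from (p,0)-forms to (n,q)-forms, so everything can be computed on γ.
Write {a,b} = ∑ H_{αβ} a^α ∧ conj b^β. The Leibniz rules for the Chern connection and D'∂̄ + ∂̄D' =
-iΘ give (`ddbar_tF`) i∂∂̄T = -i·i^{p²}{∂̄D'γ,γ} + i·i^{p²}{γ,∂̄D'γ} + i^{p²}{Θ∧γ,γ} +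
i^{(p+1)²}({D'γ,D'γ} - {∂̄γ,∂̄γ}).

After wedging with ω_{q-1} each term has a meaning (`ddbar_tF_mul`). As ∂̄*u = i·i^{p²} D'γ ∧
ω_{q-1} and Λu = i^{p²} γ ∧ ω_{q-1}, the first two terms give -2 Re⟨∂̄∂̄*u,u⟩ up to a torsion term
containing D'γ and ∂̄ω_{q-1}, and the third gives ⟨Θ∧Λu,u⟩. The term {D'γ,D'γ} gives |D'γ|² =
|∂̄*u|², and the last one gives |∂̄γ|² - |∂̄γ ∧ ω_q|². For a Kähler metric every ∂̄ω_s vanishes, ∂̄γ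
∧ ω_q is ∂̄u up to a unit factor, and this is the identity (2).

For a general metric and ∂̄u = 0, the relation ∂̄γ ∧ ω_q = ∓ γ ∧ ∂̄ω_q bounds the negative square by
a multiple of |u|². The remaining torsion terms are bounded by multiples of |D'γ||u|, |∂̄γ||u| and
|u|², and the squares |D'γ|² and |∂̄γ|² absorb the first two (`quadratic_bound`). The multiples
depend only on the dimension and on the comass of ∂̄ω_{q-1}, ∂̄ω_q and ∂∂̄ω_{q-1}: in a unitary
frame of E⊗L the estimates are made component by component, so neither the rank nor the fibre metric
enters. Compactness and chart independence of these comasses yield one constant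
(`exists_torsionLE`).

The pointwise algebra rests on one pairing formula, `inner_primitive`: for γ of type (p,0) and p + s
+ t = n, ⟨c, γ∧ω_s⟩ ω_n = i^{p²} c ∧ conj γ ∧ ω_t. It is proved by induction on the degree. The
adjoint of wedging with a 1-form is an antiderivation, and the one attached to dz̄_j kills
(p,0)-forms and sends ω to -i dz_j. Types are recorded by the weight under rotation of the arguments
by unit complex numbers: a (p,q)-form has weight p - q, and weight p in degree p means type (p,0).
-/

section

/-! ### Forms of all degrees inside one exterior algebra. -/

namespace DbarForms

variable {n k l m : ℕ}

/-- The index set of the real basis of `ℂⁿ`. -/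
abbrev Idx (n : ℕ) : Type := Fin n × Fin 2

/-- The exterior algebra in which forms of all degrees are embedded. -/
abbrev Ext (n : ℕ) : Type := ExteriorAlgebra ℂ (Idx n → ℂ)

/-- The generators of the exterior algebra, dual to the real basis. -/
noncomputable def gen (s : Idx n) : Ext n := ExteriorAlgebra.ι ℂ (Pi.single s 1)

@[simp] theorem ofAlt_apply (f : Cn n [⋀^Fin k]→ₗ[ℝ] ℂ) (v : Fin k → Cn n) : ofAlt f v = f v := rfl

@[simp] theorem castForm_apply (h : k = m) (a : CForm n k) (v : Fin m → Cn n) :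
    castForm h a v = a (fun i => v (Fin.cast h i)) := rfl

/-- The factor k! l! replaces the sum over shuffles by a sum over all permutations, which can be
reindexed freely. -/
theorem wedge_apply (a : CForm n k) (b : CForm n l) (v : Fin (k + l) → Cn n) :
    ((k.factorial * l.factorial : ℕ) : ℂ) * wedge rfl a b v =
      ∑ σ : Equiv.Perm (Fin (k + l)), ((Equiv.Perm.sign σ : ℤ) : ℂ) *
        (a (fun i => v (σ (Fin.castAdd l i))) * b (fun i => v (σ (Fin.natAdd k i)))) := by
  have h := MultilinearMap.domCoprod_alternization_eq a.toAlternatingMap b.toAlternatingMap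
  have h2 := congrArg (fun f => LinearMap.mul' ℝ ℂ (f (fun i => v (finSumFinEquiv i)))) h
  simp only [MultilinearMap.alternatization_apply, map_sum, AlternatingMap.smul_apply,
    Fintype.card_fin, map_nsmul] at h2
  have h3 : LinearMap.mul' ℝ ℂ ((a.toAlternatingMap.domCoprod b.toAlternatingMap)
      (fun i => v (finSumFinEquiv i))) = wedge rfl a b v := rfl
  rw [h3] at h2
  rw [← nsmul_eq_mul, ← h2, ← (Equiv.permCongr (finSumFinEquiv (m := k) (n := l))).sum_comp]
  refine Finset.sum_congr rfl fun σ _ => ?_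
  rw [Equiv.Perm.sign_permCongr]
  simp only [MultilinearMap.domDomCongr_apply,
    MultilinearMap.domCoprod_apply]
  rw [Units.smul_def, map_zsmul, zsmul_eq_mul]
  congr 1
  simp [Equiv.permCongr_apply]

theorem realBasis_repr (v : Cn n) :
    v = ∑ j, ((v j).re • realBasis (j, 0) + (v j).im • realBasis (j, 1)) := by
  ext i
  simp [realBasis, Finset.sum_apply, Pi.single_apply, Finset.sum_add_distrib]

/-- The real coordinates on `ℂⁿ`. -/
noncomputable def coordR (s : Idx n) : Cn n →ₗ[ℝ] ℝ :=
  if s.2 = 0 then Complex.reLm ∘ₗ ((EuclideanSpace.proj s.1 : Cn n →L[ℂ] ℂ).restrictScalars ℝ).toLinearMap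
  else Complex.imLm ∘ₗ ((EuclideanSpace.proj s.1 : Cn n →L[ℂ] ℂ).restrictScalars ℝ).toLinearMap

theorem sum_coordR (v : Cn n) : ∑ s : Idx n, coordR s v • realBasis s = v := by
  rw [Fintype.sum_prod_type]
  conv_rhs => rw [realBasis_repr v]
  refine Finset.sum_congr rfl fun j _ => ?_
  simp [coordR, Fin.sum_univ_two]

theorem coordR_realBasis (s t : Idx n) : coordR s (realBasis t) = if s = t then 1 else 0 := by
  obtain ⟨j, a⟩ := s
  obtain ⟨i, b⟩ := t
  by_cases hij : j = i <;> fin_cases a <;> fin_cases b <;> simp [coordR, realBasis, hij]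

/-- Forms are determined by their values on the real basis. -/
theorem form_ext {a b : CForm n k}
    (h : ∀ s : Fin k → Idx n, a (fun i => realBasis (s i)) = b (fun i => realBasis (s i))) :
    a = b := by
  ext v
  have key : ∀ c : CForm n k, c v = ∑ s : Fin k → Idx n,
      (∏ i, coordR (s i) (v i)) • c (fun i => realBasis (s i)) := by
    intro c
    conv_lhs => rw [show v = fun i => ∑ s, coordR s (v i) • realBasis s from
      funext fun i => (sum_coordR (v i)).symm]
    change c.toMultilinearMap _ = _
    rw [MultilinearMap.map_sum]
    refine Finset.sum_congr rfl fun s _ => ?_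
    rw [MultilinearMap.map_smul_univ]
    rfl
  rw [key a, key b]
  simp_rw [h]

instance : FiniteDimensional ℝ (CForm n k) := by
  let f : CForm n k →ₗ[ℝ] ((Fin k → Idx n) → ℂ) :=
    { toFun := fun a s => a (fun i => realBasis (s i))
      map_add' := fun _ _ => rfl
      map_smul' := fun _ _ => rfl }
  exact FiniteDimensional.of_injective f fun a b h => form_ext fun s => congrFun h s

/-- The product of generators indexed by `s`. -/
noncomputable def genProd (s : Fin k → Idx n) : Ext n :=
  ExteriorAlgebra.ιMulti ℂ k (fun i => Pi.single (s i) 1)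

theorem genProd_comp_perm (s : Fin k → Idx n) (σ : Equiv.Perm (Fin k)) :
    genProd (s ∘ σ) = ((Equiv.Perm.sign σ : ℤ) : ℂ) • genProd s := by
  unfold genProd
  have := (ExteriorAlgebra.ιMulti ℂ k).map_perm (fun i => (Pi.single (s i) 1 : Idx n → ℂ)) σ
  refine Eq.trans ?_ (this.trans ?_)
  · rfl
  · rw [Units.smul_def, Int.cast_smul_eq_zsmul]

theorem genProd_append (s : Fin k → Idx n) (t : Fin l → Idx n) :
    genProd (Fin.append s t) = genProd s * genProd t := by
  unfold genProd
  rw [ExteriorAlgebra.ιMulti_mul_ιMulti]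
  congr 1
  ext i : 1
  refine Fin.addCases (fun j => ?_) (fun j => ?_) i <;> simp

/-- The embedding of forms into the exterior algebra. -/
noncomputable def emb : CForm n k →ₗ[ℂ] Ext n where
  toFun a := (1 / (k.factorial : ℂ)) •
    ∑ s : Fin k → Idx n, a (fun i => realBasis (s i)) • genProd s
  map_add' a b := by
    simp only [ContinuousAlternatingMap.add_apply, add_smul, Finset.sum_add_distrib, smul_add]
  map_smul' c a := by
    simp only [ContinuousAlternatingMap.smul_apply, smul_eq_mul, mul_smul, RingHom.id_apply,
      ← Finset.smul_sum]
    rw [smul_comm]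

theorem emb_apply (a : CForm n k) : emb a = (1 / (k.factorial : ℂ)) •
    ∑ s : Fin k → Idx n, a (fun i => realBasis (s i)) • genProd s := rfl

theorem emb_castForm (h : k = m) (a : CForm n k) : emb (castForm h a) = emb a := by
  subst h; rfl

/-- After relabelling the indices by a permutation, its sign cancels against the sign from
reordering the generators. All (k+l)! terms therefore agree, and the factorials in the normalisation
of `emb` cancel them. -/
theorem emb_wedge (h : k + l = m) (a : CForm n k) (b : CForm n l) :
    emb (wedge h a b) = emb a * emb b := by
  subst h
  have hk : (k.factorial : ℂ) ≠ 0 := by exact_mod_cast k.factorial_ne_zero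
  have hl : (l.factorial : ℂ) ≠ 0 := by exact_mod_cast l.factorial_ne_zero
  have hkl : ((k + l).factorial : ℂ) ≠ 0 := by exact_mod_cast (k + l).factorial_ne_zero
  have key : ∑ s : Fin (k + l) → Idx n,
      (((k.factorial * l.factorial : ℕ) : ℂ) * wedge rfl a b (fun i => realBasis (s i))) • genProd s
      = ((k + l).factorial : ℂ) • ∑ s : Fin (k + l) → Idx n,
        (a (fun i => realBasis (s (Fin.castAdd l i))) *
          b (fun i => realBasis (s (Fin.natAdd k i)))) • genProd s := by
    simp_rw [wedge_apply, Finset.sum_smul]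
    rw [Finset.sum_comm]
    have : ∀ σ : Equiv.Perm (Fin (k + l)), ∑ s : Fin (k + l) → Idx n,
        (((Equiv.Perm.sign σ : ℤ) : ℂ) * (a (fun i => realBasis (s (σ (Fin.castAdd l i)))) *
          b (fun i => realBasis (s (σ (Fin.natAdd k i)))))) • genProd s =
        ∑ s : Fin (k + l) → Idx n, (a (fun i => realBasis (s (Fin.castAdd l i))) *
          b (fun i => realBasis (s (Fin.natAdd k i)))) • genProd s := by
      intro σ
      rw [← (Equiv.arrowCongr σ (Equiv.refl (Idx n))).sum_comp (fun s : Fin (k + l) → Idx n =>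
        (((Equiv.Perm.sign σ : ℤ) : ℂ) * (a (fun i => realBasis (s (σ (Fin.castAdd l i)))) *
          b (fun i => realBasis (s (σ (Fin.natAdd k i)))))) • genProd s)]
      refine Finset.sum_congr rfl fun s _ => ?_
      have h1 : (Equiv.arrowCongr σ (Equiv.refl (Idx n))) s = s ∘ (σ⁻¹ : Equiv.Perm _) := rfl
      rw [h1, genProd_comp_perm, smul_smul]
      simp only [Function.comp_apply, Equiv.Perm.inv_def, Equiv.symm_apply_apply, Equiv.Perm.sign_symm]
      congr 1
      rcases Int.units_eq_one_or (Equiv.Perm.sign σ) with h | h <;> simp [h]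
    simp_rw [this]
    simp [Finset.card_univ, Fintype.card_perm, ← Nat.cast_smul_eq_nsmul ℂ]
  have key2 : ∑ s : Fin (k + l) → Idx n, wedge rfl a b (fun i => realBasis (s i)) • genProd s
      = (((k + l).factorial : ℂ) / (k.factorial * l.factorial)) • ∑ s : Fin (k + l) → Idx n,
        (a (fun i => realBasis (s (Fin.castAdd l i))) *
          b (fun i => realBasis (s (Fin.natAdd k i)))) • genProd s := by
    rw [Finset.sum_congr rfl fun s _ => mul_smul ((k.factorial * l.factorial : ℕ) : ℂ) _ (genProd s),
      ← Finset.smul_sum] at key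
    rw [div_eq_inv_mul, mul_smul, ← key, smul_smul]
    push_cast
    rw [inv_mul_cancel₀ (mul_ne_zero hk hl), one_smul]
  rw [emb_apply, key2, emb_apply, emb_apply, smul_mul_smul_comm, Finset.sum_mul_sum, smul_smul,
    ← (Fin.appendEquiv k l).sum_comp, Fintype.sum_prod_type]
  congr 1
  · field_simp
  · refine Finset.sum_congr rfl fun s _ => Finset.sum_congr rfl fun t _ => ?_
    rw [smul_mul_smul_comm, ← genProd_append]
    have : Fin.appendEquiv k l (s, t) = Fin.append s t := rfl
    simp [this]

/-- The functional on the exterior algebra that reads off the coefficient of `genProd t`. -/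
noncomputable def readOff (t : Fin k → Idx n) : Ext n →ₗ[ℂ] ℂ :=
  ExteriorAlgebra.liftAlternating fun i => if h : i = k then
    (Matrix.detRowAlternating (R := ℂ) (n := Fin i)).compLinearMap
      (LinearMap.funLeft ℂ ℂ fun j : Fin i => t (Fin.cast h j)) else 0

theorem readOff_genProd (t s : Fin k → Idx n) : readOff t (genProd s) =
    ∑ σ : Equiv.Perm (Fin k), ((Equiv.Perm.sign σ : ℤ) : ℂ) *
      ∏ i, (if s (σ i) = t i then (1 : ℂ) else 0) := by
  unfold readOff genProd
  rw [ExteriorAlgebra.liftAlternating_apply_ιMulti, dif_pos rfl]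
  refine Eq.trans (Matrix.det_apply' (Matrix.of fun i j : Fin k =>
    (Pi.single (s i) 1 : Idx n → ℂ) (t j))) ?_
  refine Finset.sum_congr rfl fun σ _ => ?_
  congr 1
  refine Finset.prod_congr rfl fun i _ => ?_
  rw [Matrix.of_apply, Pi.single_apply]
  simp only [eq_comm]

theorem readOff_emb (t : Fin k → Idx n) (a : CForm n k) :
    readOff t (emb a) = a (fun i => realBasis (t i)) := by
  have hk : (k.factorial : ℂ) ≠ 0 := by exact_mod_cast k.factorial_ne_zero
  have : ∀ σ : Equiv.Perm (Fin k), ∑ s : Fin k → Idx n, a (fun i => realBasis (s i)) *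
      (((Equiv.Perm.sign σ : ℤ) : ℂ) *
        ∏ i, (if s (σ i) = t i then (1 : ℂ) else 0)) =
      a (fun i => realBasis (t i)) := by
    intro σ
    -- Only the index family `s` with `s ∘ σ = t` survives, and the alternating property turns its
    -- value into `sign σ` times the value at `t`.
    rw [Finset.sum_eq_single (t ∘ (σ⁻¹ : Equiv.Perm _))]
    · have h1 : a (fun i => realBasis ((t ∘ (σ⁻¹ : Equiv.Perm _)) i)) =
          ((Equiv.Perm.sign σ : ℤ) : ℂ) * a (fun i => realBasis (t i)) := by
        have := a.toAlternatingMap.map_perm (fun i => realBasis (t i)) σ⁻¹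
        rw [Units.smul_def, zsmul_eq_mul, Equiv.Perm.sign_inv] at this
        exact this
      rw [h1]
      rcases Int.units_eq_one_or (Equiv.Perm.sign σ) with h | h <;> simp [h]
    · intro s _ hs
      obtain ⟨i, hi⟩ : ∃ i, s (σ i) ≠ t i := by
        by_contra! hcon
        refine hs (funext fun i => ?_)
        simpa using hcon (σ⁻¹ i)
      rw [Finset.prod_eq_zero (Finset.mem_univ i), mul_zero, mul_zero]
      simp [hi]
    · simp
  have main : ∑ s : Fin k → Idx n, readOff t (a (fun i => realBasis (s i)) • genProd s) =
      k.factorial * a (fun i => realBasis (t i)) := by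
    simp_rw [map_smul, readOff_genProd, smul_eq_mul, Finset.mul_sum]
    rw [Finset.sum_comm]
    simp_rw [this]
    simp [Finset.card_univ, Fintype.card_perm]
  rw [emb_apply, map_smul, map_sum, main, smul_eq_mul]
  field_simp

/-- Identities between forms can thus be checked in the algebra, where the product is associative
and casts between equal degrees disappear. -/
theorem emb_injective : Function.Injective (emb : CForm n k → Ext n) := by
  intro a b h
  refine form_ext fun s => ?_
  rw [← readOff_emb, ← readOff_emb, h]

theorem emb_inj {a b : CForm n k} : emb a = emb b ↔ a = b := emb_injective.eq_iff

theorem genProd_zero (s : Fin 0 → Idx n) : genProd s = 1 := by simp [genProd]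

theorem genProd_succ (s : Fin (k + 1) → Idx n) :
    genProd s = gen (s 0) * genProd (fun i => s i.succ) := by
  unfold genProd gen
  rw [ExteriorAlgebra.ιMulti_succ_apply]
  rfl

theorem emb_zeroForm (c : ℂ) : emb (zeroForm c : CForm n 0) = algebraMap ℂ (Ext n) c := by
  rw [emb_apply]
  simp [genProd_zero, zeroForm, Algebra.algebraMap_eq_smul_one]

theorem emb_zero_degree (a : CForm n 0) : emb a = algebraMap ℂ (Ext n) (a ![]) := by
  rw [← emb_zeroForm]
  congr 1
  refine form_ext fun s => ?_
  simp only [zeroForm]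
  rw [Subsingleton.elim (fun i => realBasis (s i)) ![]]
  rfl

theorem emb_one_degree (a : CForm n 1) : emb a = ∑ s, a ![realBasis s] • gen s := by
  rw [emb_apply, ← (Equiv.funUnique (Fin 1) (Idx n)).symm.sum_comp]
  simp only [Nat.factorial_one, Nat.cast_one, div_one, one_smul]
  refine Finset.sum_congr rfl fun s _ => ?_
  rw [genProd_succ, genProd_zero, mul_one]
  congr 2
  ext i : 1
  fin_cases i
  rfl

/-! ### Contraction as an antiderivation of the exterior algebra. -/

/-- Contraction with the vector dual to the generator `gen s`. -/
noncomputable def contr (s : Idx n) : Ext n →ₗ[ℂ] Ext n :=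
  CliffordAlgebra.contractLeft (Q := (0 : QuadraticForm ℂ (Idx n → ℂ))) (LinearMap.proj s)

theorem contr_gen_mul (s t : Idx n) (x : Ext n) :
    contr s (gen t * x) = (if s = t then (1 : ℂ) else 0) • x - gen t * contr s x := by
  have := CliffordAlgebra.contractLeft_ι_mul (Q := (0 : QuadraticForm ℂ (Idx n → ℂ)))
    (LinearMap.proj s) (Pi.single t 1) x
  refine this.trans ?_
  simp only [LinearMap.coe_proj, Function.eval, Pi.single_apply]
  rfl

theorem contr_algebraMap (s : Idx n) (c : ℂ) : contr s (algebraMap ℂ (Ext n) c) = 0 :=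
  CliffordAlgebra.contractLeft_algebraMap _ _ c

theorem contr_one (s : Idx n) : contr s (1 : Ext n) = 0 :=
  CliffordAlgebra.contractLeft_one _ _

theorem gen_mul_emb_eq (s : Idx n) (a : CForm n k) : gen s * emb a = (-1 : ℂ) ^ k • (emb a * gen s) := by
  have key : ∀ (j : ℕ) (s : Idx n) (t : Fin j → Idx n),
      gen s * genProd t = (-1 : ℂ) ^ j • (genProd t * gen s) := by
    intro j s
    induction j with
    | zero => intro t; simp [genProd_zero]
    | succ j ih =>
      intro t
      have h := ExteriorAlgebra.ι_add_mul_swap (R := ℂ) (Pi.single s 1 : Idx n → ℂ) (Pi.single (t 0) 1)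
      have h : gen s * gen (t 0) = -(gen (t 0) * gen s) := eq_neg_of_add_eq_zero_left h
      rw [genProd_succ, ← mul_assoc, h, neg_mul, mul_assoc, ih, mul_smul_comm, mul_assoc, pow_succ,
        mul_neg_one, neg_smul]
  rw [emb_apply, mul_smul_comm, smul_mul_assoc, Finset.mul_sum, Finset.sum_mul, smul_comm]
  congr 1
  rw [Finset.smul_sum]
  refine Finset.sum_congr rfl fun t _ => ?_
  rw [mul_smul_comm, smul_mul_assoc, key, smul_comm]

theorem genProd_mul_emb (s : Fin l → Idx n) (a : CForm n k) :
    genProd s * emb a = (-1 : ℂ) ^ (l * k) • (emb a * genProd s) := by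
  induction l with
  | zero => simp [genProd_zero]
  | succ l ih =>
    rw [genProd_succ, mul_assoc, ih, mul_smul_comm, ← mul_assoc, gen_mul_emb_eq, smul_mul_assoc,
      smul_smul, mul_assoc]
    congr 1
    ring

theorem emb_mul_comm (a : CForm n k) (b : CForm n l) :
    emb a * emb b = (-1 : ℂ) ^ (k * l) • (emb b * emb a) := by
  have h : ∀ s : Fin k → Idx n, a (fun i => realBasis (s i)) • genProd s * emb b =
      (-1 : ℂ) ^ (k * l) • (emb b * a (fun i => realBasis (s i)) • genProd s) := by
    intro s
    rw [mul_smul_comm, smul_mul_assoc, genProd_mul_emb, smul_comm]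
  rw [emb_apply a, smul_mul_assoc, mul_smul_comm, Finset.sum_mul, Finset.mul_sum,
    smul_comm ((-1 : ℂ) ^ (k * l)), Finset.smul_sum (r := (-1 : ℂ) ^ (k * l))]
  simp_rw [h]

/-- By linearity the first factor may be a product of generators, and then the rule for one
generator is iterated. The second factor stays arbitrary, so nested products can be contracted step
by step. -/
theorem contr_emb_mul (s : Idx n) (a : CForm n k) (x : Ext n) :
    contr s (emb a * x) = contr s (emb a) * x + (-1 : ℂ) ^ k • (emb a * contr s x) := by
  have key : ∀ (j : ℕ) (t : Fin j → Idx n),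
      contr s (genProd t * x) = contr s (genProd t) * x + (-1 : ℂ) ^ j • (genProd t * contr s x) := by
    intro j
    induction j with
    | zero => intro t; simp [genProd_zero, contr_one]
    | succ j ih =>
      intro t
      rw [genProd_succ, mul_assoc, contr_gen_mul, contr_gen_mul, ih, mul_add, sub_mul, smul_mul_assoc,
        pow_succ, mul_neg_one, neg_smul, mul_smul_comm, mul_assoc, mul_assoc]
      abel
  have h : ∀ t : Fin k → Idx n, contr s (a (fun i => realBasis (t i)) • genProd t * x) =
      contr s (a (fun i => realBasis (t i)) • genProd t) * x +
        (-1 : ℂ) ^ k • (a (fun i => realBasis (t i)) • genProd t * contr s x) := by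
    intro t
    rw [smul_mul_assoc, map_smul, key, map_smul, smul_add, smul_mul_assoc, smul_mul_assoc,
      smul_comm ((-1 : ℂ) ^ k)]
  rw [emb_apply, smul_mul_assoc, map_smul, map_smul, Finset.sum_mul, map_sum, map_sum,
    smul_mul_assoc, smul_mul_assoc, smul_comm ((-1 : ℂ) ^ k), ← smul_add, Finset.sum_mul,
    Finset.sum_mul, Finset.smul_sum (r := (-1 : ℂ) ^ k), ← Finset.sum_add_distrib]
  simp_rw [h]

/-- The embedding of the alternation of a form-valued linear map. -/
theorem emb_alternatizeUncurryFin (L : Cn n →L[ℝ] CForm n k) :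
    emb (ContinuousAlternatingMap.alternatizeUncurryFin L) = ∑ s, gen s * emb (L (realBasis s)) := by
  have hk : (k.factorial : ℂ) ≠ 0 := by exact_mod_cast k.factorial_ne_zero
  have hk1 : ((k + 1 : ℕ) : ℂ) ≠ 0 := by exact_mod_cast k.succ_ne_zero
  rw [emb_apply]
  simp_rw [ContinuousAlternatingMap.alternatizeUncurryFin_apply, Finset.sum_smul]
  rw [Finset.sum_comm]
  have hR : ∑ s, gen s * emb (L (realBasis s)) = (1 / (k.factorial : ℂ)) •
      ∑ s : Fin (k + 1) → Idx n,
        (L (realBasis (s 0)) (fun i => realBasis (s i.succ))) • genProd s := by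
    rw [← (Fin.consEquiv (fun _ : Fin (k + 1) => Idx n)).sum_comp (fun s : Fin (k + 1) → Idx n =>
      (L (realBasis (s 0)) (fun i => realBasis (s i.succ))) • genProd s)]
    refine Eq.trans ?_ (congrArg _ (Fintype.sum_prod_type _).symm)
    rw [Finset.smul_sum]
    refine Finset.sum_congr rfl fun s _ => ?_
    have h : ∀ t : Fin k → Idx n, gen s * (L (realBasis s) (fun i => realBasis (t i)) • genProd t) =
        L (realBasis s) (fun i => realBasis (t i)) • (gen s * genProd t) :=
      fun t => mul_smul_comm _ _ _
    rw [emb_apply, mul_smul_comm, Finset.mul_sum]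
    simp_rw [h, genProd_succ]
    simp [Fin.consEquiv]
  have : ∀ p : Fin (k + 1), ∑ s : Fin (k + 1) → Idx n,
      ((-1 : ℤ) ^ (p : ℕ) • L (realBasis (s p))
        (p.removeNth fun i => realBasis (s i))) • genProd s =
      ∑ s : Fin (k + 1) → Idx n,
        (L (realBasis (s 0)) (fun i => realBasis (s i.succ))) • genProd s := by
    intro p
    -- The cycle moving slot `p` to the front has sign (-1)^p, so every summand of the alternation
    -- equals the one with `p = 0`. The resulting factor k+1 turns 1/(k+1)! into 1/k!.
    rw [← (Equiv.arrowCongr (Fin.cycleRange p) (Equiv.refl (Idx n))).symm.sum_comp]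
    refine Finset.sum_congr rfl fun s _ => ?_
    have h1 : (Equiv.arrowCongr (Fin.cycleRange p) (Equiv.refl (Idx n))).symm s =
        s ∘ (Fin.cycleRange p) := rfl
    rw [h1, genProd_comp_perm, Fin.sign_cycleRange, smul_smul]
    have h2 : (p.removeNth fun i => (realBasis ((s ∘ (Fin.cycleRange p)) i) : Cn n)) =
        fun i => realBasis (s i.succ) := by
      funext i
      simp [Fin.removeNth]
    rw [h2]
    congr 1
    simp only [Function.comp_apply, Fin.cycleRange_self, zsmul_eq_mul]
    push_cast
    rw [mul_right_comm, ← mul_pow]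
    simp
  simp_rw [this]
  rw [hR]
  simp only [Finset.sum_const, Finset.card_univ, Fintype.card_fin]
  rw [← Nat.cast_smul_eq_nsmul ℂ, smul_smul, Nat.factorial_succ]
  congr 1
  push_cast at hk1 ⊢
  field_simp

/-- Euler's identity for forms. It drives every induction on the degree below. -/
theorem emb_gen_expand (a : CForm n (k + 1)) :
    ∑ s, gen s * emb (a.curryLeft (realBasis s)) = ((k : ℂ) + 1) • emb a := by
  rw [← emb_alternatizeUncurryFin, ContinuousAlternatingMap.alternatizeUncurryFin_curryLeft,
    ← Nat.cast_smul_eq_nsmul ℂ, map_smul]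
  push_cast
  rfl

theorem curryLeft_curryLeft (a : CForm n (k + 2)) (v w : Cn n) :
    (a.curryLeft v).curryLeft w = -(a.curryLeft w).curryLeft v := by
  ext x
  have := a.toAlternatingMap.map_swap (Matrix.vecCons w (Matrix.vecCons v x))
    (i := 0) (j := 1) (by simp)
  simp only [ContinuousAlternatingMap.curryLeft_apply_apply, ContinuousAlternatingMap.neg_apply]
  refine Eq.trans ?_ (this.trans ?_)
  swap
  · rfl
  change a _ = a _
  congr 1
  ext i : 1
  refine Fin.cases ?_ (fun i => Fin.cases ?_ (fun i => ?_) i) i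
  · simp
  · simp
  · have h1 : (i.succ.succ : Fin (k + 2)) ≠ 0 := Fin.succ_ne_zero _
    have h2 : (i.succ.succ : Fin (k + 2)) ≠ 1 := by
      intro h
      exact Fin.succ_ne_zero i (Fin.succ_injective _ (by simpa using h))
    simp [Equiv.swap_apply_of_ne_of_ne h1 h2]

/-- Contract the Euler identity: one summand returns the contraction of `a` itself, and the others
are k+1 more copies of it, because contractions anticommute and the claim is known one degree lower.
Dividing by k+2 finishes. -/
theorem contr_emb (s : Idx n) (a : CForm n (k + 1)) :
    contr s (emb a) = emb (a.curryLeft (realBasis s)) := by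
  induction k with
  | zero =>
    rw [emb_one_degree, emb_zero_degree, map_sum]
    simp_rw [map_smul]
    have h : ∀ t : Idx n, contr s (gen t) = (if s = t then (1 : ℂ) else 0) • 1 := by
      intro t
      rw [← mul_one (gen t), contr_gen_mul, contr_one, mul_zero, sub_zero]
    simp [h, Algebra.algebraMap_eq_smul_one]
  | succ k ih =>
    have hk1 : ((k : ℂ) + 1 + 1) ≠ 0 := by exact_mod_cast (k + 1).succ_ne_zero
    have h := emb_gen_expand a
    push_cast at h
    have h2 := congrArg (contr s) h
    rw [map_smul, map_sum] at h2
    simp_rw [contr_gen_mul, ih] at h2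
    have h3 := emb_gen_expand (a.curryLeft (realBasis s))
    rw [Finset.sum_sub_distrib] at h2
    simp_rw [curryLeft_curryLeft a _ (realBasis s), map_neg, mul_neg] at h2
    rw [Finset.sum_neg_distrib, h3] at h2
    simp only [ite_smul, one_smul, zero_smul, Finset.sum_ite_eq, Finset.mem_univ, if_true,
      sub_neg_eq_add] at h2
    have h4 : ((k : ℂ) + 1 + 1) • contr s (emb a) =
        ((k : ℂ) + 1 + 1) • emb (a.curryLeft (realBasis s)) := by
      rw [← h2, add_smul ((k : ℂ) + 1) 1, one_smul, add_comm]
    exact smul_right_injective _ hk1 h4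

end DbarForms

end

section

namespace DbarForms

open scoped ComplexOrder MatrixOrder

variable {n k l m : ℕ} {G : Matrix (Fin n) (Fin n) ℂ}

/-! ### The Riemannian metric -/

/-- The Hermitian pairing with matrix `G`. -/
noncomputable def herm (G : Matrix (Fin n) (Fin n) ℂ) (v w : Cn n) : ℂ :=
  ∑ j, ∑ k, G j k * v j * conj (w k)

theorem herm_add_left (v v' w : Cn n) : herm G (v + v') w = herm G v w + herm G v' w := by
  simp only [herm, ← Finset.sum_add_distrib, PiLp.add_apply]
  exact Finset.sum_congr rfl fun j _ => Finset.sum_congr rfl fun k _ => by ring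

theorem herm_add_right (v w w' : Cn n) : herm G v (w + w') = herm G v w + herm G v w' := by
  simp only [herm, ← Finset.sum_add_distrib, PiLp.add_apply, map_add]
  exact Finset.sum_congr rfl fun j _ => Finset.sum_congr rfl fun k _ => by ring

theorem herm_smul_left (c : ℂ) (v w : Cn n) : herm G (c • v) w = c * herm G v w := by
  simp only [herm, Finset.mul_sum, PiLp.smul_apply, smul_eq_mul]
  exact Finset.sum_congr rfl fun j _ => Finset.sum_congr rfl fun k _ => by ring

theorem herm_smul_right (c : ℂ) (v w : Cn n) : herm G v (c • w) = conj c * herm G v w := by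
  simp only [herm, Finset.mul_sum, PiLp.smul_apply, smul_eq_mul, map_mul]
  exact Finset.sum_congr rfl fun j _ => Finset.sum_congr rfl fun k _ => by ring

theorem herm_conj_symm (hG : G.PosDef) (v w : Cn n) : conj (herm G v w) = herm G w v := by
  simp only [herm, map_sum, map_mul, Complex.conj_conj]
  rw [Finset.sum_comm]
  refine Finset.sum_congr rfl fun j _ => Finset.sum_congr rfl fun k _ => ?_
  have : conj (G k j) = G j k := hG.isHermitian.apply j k
  rw [this]; ring

theorem herm_self_pos (hG : G.PosDef) {v : Cn n} (hv : v ≠ 0) : 0 < (herm G v v).re := by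
  have h := hG.dotProduct_mulVec_pos (x := fun j => conj (v j)) (by
    intro h
    exact hv (by ext j; simpa using congrFun h j))
  have h2 : star (fun j => conj (v j)) ⬝ᵥ G.mulVec (fun j => conj (v j)) = herm G v v := by
    simp only [dotProduct, Matrix.mulVec, herm, Pi.star_apply, Finset.mul_sum]
    refine Finset.sum_congr rfl fun j _ => Finset.sum_congr rfl fun k _ => ?_
    rw [show star (conj (v j)) = v j from Complex.conj_conj _]
    ring
  rw [h2] at h
  exact (Complex.pos_iff.mp h).1

/-- The Riemannian metric. -/
noncomputable def riem (G : Matrix (Fin n) (Fin n) ℂ) (v w : Cn n) : ℝ := (herm G v w).re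

theorem riemGram_eq (s t : Idx n) : riemGram G s t = riem G (realBasis s) (realBasis t) := rfl

theorem riem_comm (hG : G.PosDef) (v w : Cn n) : riem G v w = riem G w v := by
  rw [riem, riem, ← herm_conj_symm hG, Complex.conj_re]

theorem riem_smul_smul {ζ : ℂ} (hζ : ‖ζ‖ = 1) (v w : Cn n) : riem G (ζ • v) (ζ • w) = riem G v w := by
  rw [riem, herm_smul_left, herm_smul_right, ← mul_assoc, Complex.mul_conj, Complex.normSq_eq_norm_sq,
    hζ]
  simp [riem]

/-- The Riemannian metric as a bilinear form. -/
noncomputable def riemL (G : Matrix (Fin n) (Fin n) ℂ) : Cn n →ₗ[ℝ] Cn n →ₗ[ℝ] ℝ :=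
  LinearMap.mk₂ ℝ (riem G) (fun _ _ _ => by simp [riem, herm_add_left])
    (fun c v w => by
      rw [riem, show c • v = (c : ℂ) • v from rfl, herm_smul_left]; simp [riem])
    (fun _ _ _ => by simp [riem, herm_add_right])
    (fun c v w => by
      rw [riem, show c • w = (c : ℂ) • w from rfl, herm_smul_right]; simp [riem])

theorem riemL_apply (v w : Cn n) : riemL G v w = riem G v w := rfl

theorem riem_self_pos (hG : G.PosDef) {v : Cn n} (hv : v ≠ 0) : 0 < riem G v v :=
  herm_self_pos hG hv

/-- The matrix of real coordinates of a family of vectors. -/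
noncomputable def coordMat (f : Idx n → Cn n) : Matrix (Idx n) (Idx n) ℝ := fun s a => coordR s (f a)

theorem riem_eq_sum (v w : Cn n) :
    riem G v w = ∑ s, ∑ t, coordR s v * riemGram G s t * coordR t w := by
  conv_lhs => rw [← riemL_apply, ← sum_coordR v, ← sum_coordR w]
  simp only [map_sum, map_smul, LinearMap.sum_apply, LinearMap.smul_apply, smul_eq_mul,
    riemL_apply, riemGram_eq, Finset.mul_sum]
  rw [Finset.sum_comm]
  exact Finset.sum_congr rfl fun _ _ => Finset.sum_congr rfl fun _ _ => by ring

theorem coordMat_transpose_mul (f : Idx n → Cn n) (a b : Idx n) :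
    ((coordMat f).transpose * riemGram G * coordMat f) a b = riem G (f a) (f b) := by
  rw [riem_eq_sum, Matrix.mul_apply, Finset.sum_comm]
  refine Finset.sum_congr rfl fun t _ => ?_
  rw [Matrix.mul_apply, Finset.sum_mul]
  rfl

/-- A frame that is orthonormal for the Riemannian metric. -/
def IsONFrame (G : Matrix (Fin n) (Fin n) ℂ) (f : Idx n → Cn n) : Prop :=
  ∀ a b, riem G (f a) (f b) = if a = b then 1 else 0

/-- From FᵀgF = 1 one gets g⁻¹ = FFᵀ. This turns the coordinate formula for the inner product into a
sum over an orthonormal frame, where symmetry and definiteness are visible. -/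
theorem IsONFrame.inv_eq {f : Idx n → Cn n} (hf : IsONFrame G f) :
    (riemGram G)⁻¹ = coordMat f * (coordMat f).transpose := by
  have h1 : (coordMat f).transpose * riemGram G * coordMat f = 1 := by
    ext a b
    rw [coordMat_transpose_mul, hf, Matrix.one_apply]
  refine Matrix.inv_eq_left_inv ?_
  rw [Matrix.mul_assoc]
  exact mul_eq_one_comm.mp h1

theorem riemGram_posDef (hG : G.PosDef) : (riemGram G).PosDef := by
  refine Matrix.PosDef.of_dotProduct_mulVec_pos ?_ fun {x} hx => ?_
  · ext s t
    simp [Matrix.conjTranspose_apply, riemGram_eq, riem_comm hG]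
  · have h : star x ⬝ᵥ (riemGram G).mulVec x = riem G (∑ s, x s • realBasis s) (∑ s, x s • realBasis s) := by
      rw [riem_eq_sum]
      simp [dotProduct, Matrix.mulVec, Finset.mul_sum, coordR_realBasis, mul_assoc]
    rw [h]
    refine riem_self_pos hG fun h0 => hx ?_
    ext s
    have := congrArg (coordR s) h0
    simpa [coordR_realBasis] using this

/-- Factor M = BᵀB and take F = B⁻¹. -/
theorem exists_transpose_mul_mul_eq_one {ι : Type*} [Fintype ι] [DecidableEq ι] {M : Matrix ι ι ℝ}
    (hM : M.PosDef) : ∃ F : Matrix ι ι ℝ, F.transpose * M * F = 1 := by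
  obtain ⟨B, hB2⟩ := CStarAlgebra.nonneg_iff_eq_star_mul_self.mp hM.posSemidef.nonneg
  rw [Matrix.star_eq_conjTranspose, Matrix.conjTranspose_eq_transpose_of_trivial] at hB2
  have hdet : IsUnit B.det := by
    have := (Matrix.isUnit_iff_isUnit_det _).mp hM.isUnit
    rw [hB2, Matrix.det_mul] at this
    exact isUnit_of_mul_isUnit_right this
  refine ⟨B⁻¹, ?_⟩
  rw [hB2, ← Matrix.mul_assoc, ← Matrix.transpose_mul,
    Matrix.mul_nonsing_inv B hdet, Matrix.transpose_one, Matrix.one_mul, Matrix.mul_nonsing_inv B hdet]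

theorem exists_isONFrame (hG : G.PosDef) : ∃ f, IsONFrame G f := by
  obtain ⟨F, hF⟩ := exists_transpose_mul_mul_eq_one (riemGram_posDef hG)
  refine ⟨fun a => ∑ s, F s a • realBasis s, fun a b => ?_⟩
  have hc : coordMat (fun a => ∑ s, F s a • (realBasis s : Cn n)) = F := by
    ext s a
    simp [coordMat, coordR_realBasis]
  have h := coordMat_transpose_mul (G := G) (fun a => ∑ s, F s a • (realBasis s : Cn n)) a b
  rw [hc, hF, Matrix.one_apply] at h
  exact h.symm

/-! ### The inner product on forms -/

theorem form_expand (c : CForm n k) (v : Fin k → Cn n) : c v = ∑ s : Fin k → Idx n,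
    ((∏ i, coordR (s i) (v i) : ℝ) : ℂ) * c (fun i => realBasis (s i)) := by
  conv_lhs => rw [show v = fun i => ∑ s, coordR s (v i) • realBasis s from
    funext fun i => (sum_coordR (v i)).symm]
  change c.toMultilinearMap _ = _
  rw [MultilinearMap.map_sum]
  refine Finset.sum_congr rfl fun s _ => ?_
  rw [MultilinearMap.map_smul_univ, Complex.real_smul]
  rfl

/-- The entries of the inverse of the Gram matrix. -/
noncomputable def gInv (G : Matrix (Fin n) (Fin n) ℂ) (s t : Idx n) : ℝ := (riemGram G)⁻¹ s t

theorem formInner_def (a b : CForm n k) : formInner G a b = (1 / (k.factorial : ℂ)) *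
    ∑ s : Fin k → Idx n, ∑ t : Fin k → Idx n, ((∏ l, gInv G (s l) (t l) : ℝ) : ℂ) *
      (a (fun l => realBasis (s l)) * conj (b (fun l => realBasis (t l)))) := rfl

theorem IsONFrame.gInv_eq {f : Idx n → Cn n} (hf : IsONFrame G f) (s t : Idx n) :
    gInv G s t = ∑ a, coordR s (f a) * coordR t (f a) := by
  rw [gInv, hf.inv_eq]
  rfl

/-- The inner product computed in an orthonormal frame. -/
theorem IsONFrame.formInner_eq {f : Idx n → Cn n} (hf : IsONFrame G f) (a b : CForm n k) :
    formInner G a b = (1 / (k.factorial : ℂ)) * ∑ μ : Fin k → Idx n,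
      a (fun i => f (μ i)) * conj (b (fun i => f (μ i))) := by
  rw [formInner_def]
  congr 1
  have h : ∀ μ : Fin k → Idx n, a (fun i => f (μ i)) * conj (b (fun i => f (μ i))) =
      ∑ s : Fin k → Idx n, ∑ t : Fin k → Idx n,
      ((∏ i, (coordR (s i) (f (μ i)) * coordR (t i) (f (μ i))) : ℝ) : ℂ) *
        (a (fun i => realBasis (s i)) * conj (b (fun i => realBasis (t i)))) := by
    intro μ
    rw [form_expand a, form_expand b, map_sum, Finset.sum_mul_sum]
    refine Finset.sum_congr rfl fun s _ => Finset.sum_congr rfl fun t _ => ?_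
    rw [map_mul, Complex.conj_ofReal, Finset.prod_mul_distrib]
    push_cast
    ring
  rw [Finset.sum_congr rfl fun μ _ => h μ]
  refine Eq.trans (Finset.sum_congr rfl fun s _ => ?_) Finset.sum_comm
  refine Eq.trans (Finset.sum_congr rfl fun t _ => ?_) Finset.sum_comm
  refine Eq.trans ?_ (Finset.sum_mul _ _ _)
  congr 1
  rw [← Complex.ofReal_sum]
  congr 1
  rw [← Fintype.prod_sum (fun i μ => coordR (s i) (f μ) * coordR (t i) (f μ))]
  refine Finset.prod_congr rfl fun i _ => ?_
  rw [hf.gInv_eq]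

/-- `formInner` as a linear form in its first argument. -/
noncomputable def innerL (G : Matrix (Fin n) (Fin n) ℂ) (b : CForm n k) : CForm n k →ₗ[ℂ] ℂ where
  toFun a := formInner G a b
  map_add' a a' := by
    simp only [formInner_def, ContinuousAlternatingMap.add_apply, add_mul, mul_add,
      Finset.sum_add_distrib]
  map_smul' c a := by
    simp only [formInner_def, ContinuousAlternatingMap.smul_apply, smul_eq_mul, Finset.mul_sum,
      RingHom.id_apply]
    exact Finset.sum_congr rfl fun _ _ => Finset.sum_congr rfl fun _ _ => by ring

theorem formInner_add_left (a a' b : CForm n k) :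
    formInner G (a + a') b = formInner G a b + formInner G a' b := (innerL G b).map_add a a'

theorem formInner_smul_left (c : ℂ) (a b : CForm n k) :
    formInner G (c • a) b = c * formInner G a b := (innerL G b).map_smul c a

theorem formInner_sum_left {ι : Type*} (S : Finset ι) (a : ι → CForm n k) (b : CForm n k) :
    formInner G (∑ i ∈ S, a i) b = ∑ i ∈ S, formInner G (a i) b := map_sum (innerL G b) a S

theorem formInner_zero_left (b : CForm n k) : formInner G 0 b = 0 := (innerL G b).map_zero

theorem formInner_conj_symm (hG : G.PosDef) (a b : CForm n k) :
    conj (formInner G a b) = formInner G b a := by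
  obtain ⟨f, hf⟩ := exists_isONFrame hG
  rw [hf.formInner_eq, hf.formInner_eq, map_mul, map_sum]
  congr 1
  · simp
  · exact Finset.sum_congr rfl fun μ _ => by rw [map_mul, Complex.conj_conj, mul_comm]

theorem formInner_add_right (hG : G.PosDef) (a b b' : CForm n k) :
    formInner G a (b + b') = formInner G a b + formInner G a b' := by
  simp only [← formInner_conj_symm hG _ a, formInner_add_left, map_add]

theorem formInner_smul_right (hG : G.PosDef) (c : ℂ) (a b : CForm n k) :
    formInner G a (c • b) = conj c * formInner G a b := by
  simp only [← formInner_conj_symm hG _ a, formInner_smul_left, map_mul]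

theorem formInner_sum_right (hG : G.PosDef) {ι : Type*} (S : Finset ι) (a : CForm n k)
    (b : ι → CForm n k) : formInner G a (∑ i ∈ S, b i) = ∑ i ∈ S, formInner G a (b i) := by
  simp only [← formInner_conj_symm hG _ a, formInner_sum_left, map_sum]

/-- The squared norm of a form. -/
noncomputable def normSqF (G : Matrix (Fin n) (Fin n) ℂ) (a : CForm n k) : ℝ := (formInner G a a).re

theorem IsONFrame.normSqF_eq {f : Idx n → Cn n} (hf : IsONFrame G f) (a : CForm n k) :
    normSqF G a = (1 / (k.factorial : ℝ)) * ∑ μ : Fin k → Idx n, ‖a (fun i => f (μ i))‖ ^ 2 := by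
  rw [normSqF, hf.formInner_eq]
  simp_rw [Complex.mul_conj, Complex.normSq_eq_norm_sq]
  rw [← Complex.ofReal_sum]
  have : (1 / (k.factorial : ℂ)) = ((1 / (k.factorial : ℝ) : ℝ) : ℂ) := by push_cast; rfl
  rw [this, ← Complex.ofReal_mul, Complex.ofReal_re]

theorem normSqF_nonneg (hG : G.PosDef) (a : CForm n k) : 0 ≤ normSqF G a := by
  obtain ⟨f, hf⟩ := exists_isONFrame hG
  rw [hf.normSqF_eq]
  positivity

theorem formInner_self (hG : G.PosDef) (a : CForm n k) : formInner G a a = (normSqF G a : ℂ) := by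
  refine (Complex.conj_eq_iff_re.mp ?_).symm
  exact formInner_conj_symm hG a a

theorem IsONFrame.coord_eq {f : Idx n → Cn n} (hf : IsONFrame G f) (v : Cn n) :
    v = ∑ a, riem G (f a) v • f a := by
  have h1 : (coordMat f * (coordMat f).transpose) * riemGram G = 1 := by
    have h1 : (coordMat f).transpose * riemGram G * coordMat f = 1 := by
      ext a b
      rw [coordMat_transpose_mul, hf, Matrix.one_apply]
    rw [Matrix.mul_assoc]
    exact mul_eq_one_comm.mp h1
  have h2 : ∀ s, coordR s v = coordR s (∑ a, riem G (f a) v • f a) := by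
    intro s
    have h3 := congrFun (congrArg (fun M => Matrix.mulVec M fun t => coordR t v) h1) s
    simp only [Matrix.one_mulVec] at h3
    rw [← h3, ← Matrix.mulVec_mulVec, ← Matrix.mulVec_mulVec, map_sum]
    simp only [Matrix.mulVec, dotProduct, map_smul, smul_eq_mul]
    refine Finset.sum_congr rfl fun a _ => ?_
    rw [riem_eq_sum, mul_comm]
    simp only [coordMat, Matrix.transpose_apply, Finset.mul_sum, mul_assoc]
  have h4 := sum_coordR (∑ a, riem G (f a) v • f a)
  simp_rw [← h2, sum_coordR] at h4
  exact h4

theorem eq_zero_of_normSqF_eq_zero (hG : G.PosDef) {a : CForm n k} (h : normSqF G a = 0) : a = 0 := by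
  obtain ⟨f, hf⟩ := exists_isONFrame hG
  rw [hf.normSqF_eq] at h
  have hk : (0 : ℝ) < 1 / (k.factorial : ℝ) := by positivity
  have h1 : ∀ μ : Fin k → Idx n, a (fun i => f (μ i)) = 0 := by
    have := (mul_eq_zero.mp h).resolve_left hk.ne'
    rw [Finset.sum_eq_zero_iff_of_nonneg fun _ _ => by positivity] at this
    intro μ
    simpa using this μ (Finset.mem_univ μ)
  ext v
  rw [show v = fun i => ∑ c, riem G (f c) (v i) • f c from funext fun i => hf.coord_eq (v i)]
  change a.toMultilinearMap _ = _
  rw [MultilinearMap.map_sum]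
  refine Finset.sum_eq_zero fun s _ => ?_
  rw [MultilinearMap.map_smul_univ]
  exact smul_eq_zero_of_right _ (h1 s)

/-- Nondegeneracy, the standard device below for identifying forms defined through adjunction. -/
theorem eq_of_formInner_eq (hG : G.PosDef) {a b : CForm n k}
    (h : ∀ c, formInner G c a = formInner G c b) : a = b := by
  have h2 : ∀ c, formInner G c (a - b) = 0 := by
    intro c
    rw [sub_eq_add_neg, ← neg_one_smul ℂ b, formInner_add_right hG, formInner_smul_right hG, h]
    simp
  rw [← sub_eq_zero]
  exact eq_zero_of_normSqF_eq_zero hG (by rw [normSqF, h2]; rfl)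

/-! ### Contraction by a 1-form, the adjoint of wedging with it. -/

/-- The adjoint of multiplication by a `1`-form, as an operator on forms. -/
noncomputable def ctr (G : Matrix (Fin n) (Fin n) ℂ) (θ : CForm n 1) (a : CForm n (k + 1)) : CForm n k :=
  ∑ s, ∑ t, ((gInv G s t : ℝ) * conj (θ ![realBasis s])) • a.curryLeft (realBasis t)

/-- The adjoint of multiplication by a `1`-form, as an operator on the exterior algebra. -/
noncomputable def ctrE (G : Matrix (Fin n) (Fin n) ℂ) (θ : CForm n 1) : Ext n →ₗ[ℂ] Ext n :=
  ∑ s, ∑ t, ((gInv G s t : ℝ) * conj (θ ![realBasis s])) • contr t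

theorem ctrE_emb (θ : CForm n 1) (a : CForm n (k + 1)) : ctrE G θ (emb a) = emb (ctr G θ a) := by
  simp only [ctrE, ctr, LinearMap.sum_apply, LinearMap.smul_apply, contr_emb, map_sum, map_smul]

theorem ctrE_algebraMap (θ : CForm n 1) (c : ℂ) : ctrE G θ (algebraMap ℂ (Ext n) c) = 0 := by
  simp only [ctrE, LinearMap.sum_apply, LinearMap.smul_apply, contr_algebraMap, smul_zero,
    Finset.sum_const_zero]

theorem ctrE_emb_mul (θ : CForm n 1) (a : CForm n k) (x : Ext n) :
    ctrE G θ (emb a * x) = ctrE G θ (emb a) * x + (-1 : ℂ) ^ k • (emb a * ctrE G θ x) := by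
  simp only [ctrE, LinearMap.sum_apply, LinearMap.smul_apply, contr_emb_mul, smul_add,
    Finset.sum_add_distrib, Finset.sum_mul, Finset.mul_sum, Finset.smul_sum, smul_mul_assoc,
    mul_smul_comm]
  congr 1
  exact Finset.sum_congr rfl fun _ _ => Finset.sum_congr rfl fun _ _ => smul_comm _ _ _

/-- A `1`-form as a linear map. -/
noncomputable def oneL (θ : CForm n 1) : Cn n →ₗ[ℝ] ℂ where
  toFun v := θ ![v]
  map_add' v w := by
    have h : ∀ x : Cn n, Function.update ![v] 0 x = ![x] := fun x => by ext i; fin_cases i; simp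
    have := θ.toMultilinearMap.map_update_add ![v] 0 v w
    rw [h, h, h] at this
    exact this
  map_smul' x v := by
    have h : ∀ x : Cn n, Function.update ![v] 0 x = ![x] := fun x => by ext i; fin_cases i; simp
    have := θ.toMultilinearMap.map_update_smul ![v] 0 x v
    rw [h, h] at this
    exact this

theorem oneL_apply (θ : CForm n 1) (v : Cn n) : oneL θ v = θ ![v] := rfl

/-- Writing θ ∧ c as an alternation, its k+1 summands contribute equally to the inner product, since
the inner product is invariant under simultaneous permutation of the index families. The summand
with θ in the first slot is contraction of `a` by the metric dual of θ. -/
theorem formInner_mul_left (hG : G.PosDef) (θ : CForm n 1) (c : CForm n k) (c' a : CForm n (k + 1))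
    (hc : emb c' = emb θ * emb c) : formInner G c' a = formInner G c (ctr G θ a) := by
  let L : Cn n →ₗ[ℝ] CForm n k :=
    { toFun := fun v => oneL θ v • c
      map_add' := fun v w => by
        rw [map_add]
        exact add_smul (oneL θ v) (oneL θ w) c
      map_smul' := fun x v => by
        rw [map_smul]
        exact smul_assoc x (oneL θ v) c }
  have hc' : c' = ContinuousAlternatingMap.alternatizeUncurryFin (LinearMap.toContinuousLinearMap L) := by
    rw [← emb_inj, hc, emb_alternatizeUncurryFin, emb_one_degree, Finset.sum_mul]
    refine Finset.sum_congr rfl fun s _ => ?_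
    simp [L, oneL_apply]
  set gi := gInv G with hgi
  have hinv : ∀ (p : Fin (k + 1)), ∑ s : Fin (k + 1) → Idx n, ∑ t : Fin (k + 1) → Idx n,
      ((∏ i, gi (s i) (t i) : ℝ) : ℂ) * (((-1 : ℤ) ^ (p : ℕ) • (θ ![realBasis (s p)] *
        c (p.removeNth fun i => realBasis (s i)))) * conj (a (fun i => realBasis (t i)))) =
      ∑ s : Fin (k + 1) → Idx n, ∑ t : Fin (k + 1) → Idx n,
      ((∏ i, gi (s i) (t i) : ℝ) : ℂ) * ((θ ![realBasis (s 0)] *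
        c (fun i => realBasis (s i.succ))) * conj (a (fun i => realBasis (t i)))) := by
    intro p
    -- Both index families are cycled: the product of inverse metric entries is unchanged, while the
    -- sign picked up by `a` cancels the (-1)^p of the alternation.
    rw [← (Equiv.arrowCongr (Fin.cycleRange p) (Equiv.refl (Idx n))).symm.sum_comp]
    refine Finset.sum_congr rfl fun s _ => ?_
    rw [← (Equiv.arrowCongr (Fin.cycleRange p) (Equiv.refl (Idx n))).symm.sum_comp]
    refine Finset.sum_congr rfl fun t _ => ?_
    have h1 : ∀ s, (Equiv.arrowCongr (Fin.cycleRange p) (Equiv.refl (Idx n))).symm s =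
        s ∘ (Fin.cycleRange p) := fun s => rfl
    rw [h1, h1]
    have h2 : (p.removeNth fun i => (realBasis ((s ∘ (Fin.cycleRange p)) i) : Cn n)) =
        fun i => realBasis (s i.succ) := by
      funext i
      simp [Fin.removeNth]
    have h3 : a (fun i => realBasis ((t ∘ Fin.cycleRange p) i)) =
        (-1 : ℂ) ^ (p : ℕ) * a (fun i => realBasis (t i)) := by
      have := a.toAlternatingMap.map_perm (fun i => realBasis (t i)) (Fin.cycleRange p)
      rw [Units.smul_def, zsmul_eq_mul, Fin.sign_cycleRange] at this
      push_cast at this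
      exact this
    have h4 : (∏ i, gi ((s ∘ Fin.cycleRange p) i) ((t ∘ Fin.cycleRange p) i)) = ∏ i, gi (s i) (t i) :=
      Equiv.prod_comp (Fin.cycleRange p) (fun i => gi (s i) (t i))
    rw [h2, h3, h4]
    simp only [Function.comp_apply, Fin.cycleRange_self, zsmul_eq_mul, map_mul, map_pow, map_neg,
      map_one]
    push_cast
    have h5 : (-1 : ℂ) ^ (p : ℕ) * (-1 : ℂ) ^ (p : ℕ) = 1 := by rw [← mul_pow]; simp
    linear_combination (((∏ i, (gi (s i) (t i) : ℂ))) * (θ ![realBasis (s 0)] *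
        c (fun i => realBasis (s i.succ))) * conj (a (fun i => realBasis (t i)))) * h5
  have hL : formInner G c' a = (1 / (k.factorial : ℂ)) * ∑ s : Fin (k + 1) → Idx n,
      ∑ t : Fin (k + 1) → Idx n, ((∏ i, gi (s i) (t i) : ℝ) : ℂ) * ((θ ![realBasis (s 0)] *
        c (fun i => realBasis (s i.succ))) * conj (a (fun i => realBasis (t i)))) := by
    have e : ∀ s : Fin (k + 1) → Idx n, c' (fun i => realBasis (s i)) =
        ∑ p : Fin (k + 1), (-1 : ℤ) ^ (p : ℕ) • (θ ![realBasis (s p)] *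
        c (p.removeNth fun i => realBasis (s i))) := by
      intro s
      rw [hc', ContinuousAlternatingMap.alternatizeUncurryFin_apply]
      rfl
    rw [formInner_def]
    have e2 : ∀ s t : Fin (k + 1) → Idx n, ((∏ i, gi (s i) (t i) : ℝ) : ℂ) *
        (c' (fun i => realBasis (s i)) * conj (a (fun i => realBasis (t i)))) =
        ∑ p : Fin (k + 1), ((∏ i, gi (s i) (t i) : ℝ) : ℂ) *
          (((-1 : ℤ) ^ (p : ℕ) • (θ ![realBasis (s p)] *
          c (p.removeNth fun i => realBasis (s i)))) * conj (a (fun i => realBasis (t i)))) := by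
      intro s t
      rw [e, Finset.sum_mul, Finset.mul_sum]
    have sw : ∀ F : (Fin (k + 1) → Idx n) → (Fin (k + 1) → Idx n) → Fin (k + 1) → ℂ,
        ∑ s, ∑ t, ∑ p, F s t p = ∑ p, ∑ s, ∑ t, F s t p := by
      intro F
      rw [Finset.sum_comm (s := (Finset.univ : Finset (Fin (k + 1))))]
      exact Finset.sum_congr rfl fun _ _ => Finset.sum_comm
    refine (congrArg _ ((Finset.sum_congr rfl fun s _ => Finset.sum_congr rfl fun t _ =>
      e2 s t).trans (sw _))).trans ?_
    rw [Finset.sum_congr rfl fun p _ => hinv p]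
    have hk1 : ((k : ℂ) + 1) ≠ 0 := by exact_mod_cast k.succ_ne_zero
    have hk : (k.factorial : ℂ) ≠ 0 := by exact_mod_cast k.factorial_ne_zero
    rw [Finset.sum_const, Finset.card_univ, Fintype.card_fin, nsmul_eq_mul, Nat.factorial_succ,
      ← mul_assoc]
    congr 1
    push_cast
    field_simp
  rw [hL]
  simp only [ctr]
  rw [formInner_sum_right hG]
  simp_rw [formInner_sum_right hG, formInner_smul_right hG, map_mul, Complex.conj_conj,
    Complex.conj_ofReal]
  simp_rw [formInner_def]
  rw [← (Fin.consEquiv (fun _ : Fin (k + 1) => Idx n)).sum_comp (fun s : Fin (k + 1) → Idx n =>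
      ∑ t : Fin (k + 1) → Idx n, ((∏ i, gi (s i) (t i) : ℝ) : ℂ) * ((θ ![realBasis (s 0)] *
        c (fun i => realBasis (s i.succ))) * conj (a (fun i => realBasis (t i)))))]
  refine (congrArg _ (Fintype.sum_prod_type _)).trans ?_
  rw [Finset.mul_sum]
  refine Finset.sum_congr rfl fun s0 _ => ?_
  have h6 : ∀ s' : Fin k → Idx n, ∀ F : (Fin (k + 1) → Idx n) → ℂ,
      ∑ t, F t = ∑ t0, ∑ t' : Fin k → Idx n, F (Fin.cons t0 t') := by
    intro s' F
    rw [← (Fin.consEquiv (fun _ : Fin (k + 1) => Idx n)).sum_comp]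
    exact Fintype.sum_prod_type _
  refine (congrArg _ ((Finset.sum_congr rfl fun s' _ => h6 s' _).trans Finset.sum_comm)).trans ?_
  rw [Finset.mul_sum]
  refine Finset.sum_congr rfl fun t0 _ => ?_
  rw [mul_left_comm]
  congr 1
  rw [Finset.mul_sum]
  refine Finset.sum_congr rfl fun s' _ => ?_
  rw [Finset.mul_sum]
  refine Finset.sum_congr rfl fun t' _ => ?_
  have h7 : (fun i => realBasis ((Fin.cons t0 t' : Fin (k + 1) → Idx n) i) : Fin (k + 1) → Cn n) =
      Matrix.vecCons (realBasis t0) (fun i => realBasis (t' i)) := by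
    funext i
    refine Fin.cases ?_ (fun i => ?_) i <;> simp
  rw [h7]
  simp only [Fin.consEquiv, Equiv.coe_fn_mk, Fin.prod_univ_succ, Fin.cons_zero, Fin.cons_succ,
    ContinuousAlternatingMap.curryLeft_apply_apply]
  push_cast
  ring

end DbarForms

end

section

namespace DbarForms

open scoped ComplexOrder MatrixOrder

variable {n k l m : ℕ} {G : Matrix (Fin n) (Fin n) ℂ}

/-! ### Pullback and weights -/

/-- Pullback of a form by a linear map. -/
noncomputable def pull (A : Cn n →L[ℝ] Cn n) (a : CForm n k) : CForm n k := a.compContinuousLinearMap A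

@[simp] theorem pull_apply (A : Cn n →L[ℝ] Cn n) (a : CForm n k) (v : Fin k → Cn n) :
    pull A a v = a (fun i => A (v i)) := rfl

@[simp] theorem conjForm_apply (a : CForm n k) (v : Fin k → Cn n) : conjForm a v = conj (a v) := rfl

theorem wedge_pull (h : k + l = m) (A : Cn n →L[ℝ] Cn n) (a : CForm n k) (b : CForm n l) :
    wedge h (pull A a) (pull A b) = pull A (wedge h a b) := by
  subst h
  ext v
  have hkl : ((k.factorial * l.factorial : ℕ) : ℂ) ≠ 0 := by
    exact_mod_cast mul_ne_zero k.factorial_ne_zero l.factorial_ne_zero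
  refine mul_left_cancel₀ hkl ?_
  rw [wedge_apply, pull_apply, wedge_apply]
  rfl

theorem conjForm_wedge (h : k + l = m) (a : CForm n k) (b : CForm n l) :
    conjForm (wedge h a b) = wedge h (conjForm a) (conjForm b) := by
  subst h
  ext v
  have hkl : ((k.factorial * l.factorial : ℕ) : ℂ) ≠ 0 := by
    exact_mod_cast mul_ne_zero k.factorial_ne_zero l.factorial_ne_zero
  refine mul_left_cancel₀ hkl ?_
  rw [wedge_apply]
  have h2 := congrArg (starRingEnd ℂ) (wedge_apply a b v)
  simp only [map_mul, map_sum, map_natCast, map_intCast] at h2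
  exact h2

@[simp] theorem conjForm_conjForm (a : CForm n k) : conjForm (conjForm a) = a := by
  ext v; simp

theorem conjForm_add (a b : CForm n k) : conjForm (a + b) = conjForm a + conjForm b := by
  ext v; simp

theorem conjForm_neg (a : CForm n k) : conjForm (-a) = -conjForm a := by
  ext v; simp

theorem conjForm_zero : conjForm (0 : CForm n k) = 0 := by
  ext v; simp

theorem conjForm_smul (c : ℂ) (a : CForm n k) : conjForm (c • a) = conj c • conjForm a := by
  ext v; simp

theorem conjForm_sum {ι : Type*} (S : Finset ι) (a : ι → CForm n k) :
    conjForm (∑ i ∈ S, a i) = ∑ i ∈ S, conjForm (a i) := by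
  classical
  induction S using Finset.induction_on with
  | empty => simp [conjForm_zero]
  | insert i S hi ih => rw [Finset.sum_insert hi, Finset.sum_insert hi, conjForm_add, ih]

/-- Multiplication by `ζ` as a real-linear map. -/
noncomputable def mulC (n : ℕ) (ζ : ℂ) : Cn n →L[ℝ] Cn n :=
  (ζ • ContinuousLinearMap.id ℂ (Cn n)).restrictScalars ℝ

@[simp] theorem mulC_apply (ζ : ℂ) (v : Cn n) : mulC n ζ v = ζ • v := rfl

/-- `a` is multiplied by `ζ ^ m` under rotation of its arguments by a unit complex number `ζ`. -/
def HasWeight (m : ℤ) (a : CForm n k) : Prop :=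
  ∀ ζ : ℂ, ‖ζ‖ = 1 → pull (mulC n ζ) a = ζ ^ m • a

theorem hasWeight_iff {m : ℤ} {a : CForm n k} :
    HasWeight m a ↔ ∀ ζ : ℂ, ‖ζ‖ = 1 → ∀ v, a (fun i => ζ • v i) = ζ ^ m * a v :=
  forall₂_congr fun _ _ => ContinuousAlternatingMap.ext_iff

theorem ne_zero_of_norm_one {ζ : ℂ} (h : ‖ζ‖ = 1) : ζ ≠ 0 := by
  rintro rfl; simp at h

theorem HasWeight.wedgeForm {w w' : ℤ} {a : CForm n k} {b : CForm n l} (ha : HasWeight w a)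
    (hb : HasWeight w' b) (h : k + l = m) : HasWeight (w + w') (wedge h a b) := by
  intro ζ hζ
  rw [← wedge_pull, ha ζ hζ, hb ζ hζ, ← emb_inj, emb_wedge, map_smul, map_smul, map_smul, emb_wedge,
    smul_mul_smul_comm, zpow_add₀ (ne_zero_of_norm_one hζ)]

theorem HasWeight.conj {w : ℤ} {a : CForm n k} (ha : HasWeight w a) :
    HasWeight (-w) (conjForm a) := by
  rw [hasWeight_iff] at ha ⊢
  intro ζ hζ v
  rw [conjForm_apply, ha ζ hζ, map_mul, conjForm_apply, map_zpow₀,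
    ← Complex.inv_eq_conj hζ, inv_zpow, zpow_neg]

theorem HasWeight.smul {w : ℤ} {a : CForm n k} (ha : HasWeight w a) (c : ℂ) :
    HasWeight w (c • a) := by
  rw [hasWeight_iff] at ha ⊢
  intro ζ hζ v
  rw [ContinuousAlternatingMap.smul_apply, ContinuousAlternatingMap.smul_apply, ha ζ hζ]
  simp only [smul_eq_mul]
  ring

theorem HasWeight.add {w : ℤ} {a b : CForm n k} (ha : HasWeight w a) (hb : HasWeight w b) :
    HasWeight w (a + b) := by
  rw [hasWeight_iff] at ha hb ⊢
  intro ζ hζ v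
  rw [ContinuousAlternatingMap.add_apply, ContinuousAlternatingMap.add_apply, ha ζ hζ, hb ζ hζ, mul_add]

theorem hasWeight_zero (w : ℤ) : HasWeight w (0 : CForm n k) := by
  rw [hasWeight_iff]
  intro ζ _ v
  simp

theorem HasWeight.sum {w : ℤ} {ι : Type*} {S : Finset ι} {a : ι → CForm n k}
    (ha : ∀ i ∈ S, HasWeight w (a i)) : HasWeight w (∑ i ∈ S, a i) := by
  classical
  induction S using Finset.induction_on with
  | empty => simpa using hasWeight_zero w
  | insert i S hi ih =>
    rw [Finset.sum_insert hi]
    exact (ha i (by simp)).add (ih fun j hj => ha j (by simp [hj]))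

theorem hasWeight_zeroDegree (a : CForm n 0) : HasWeight 0 a := by
  rw [hasWeight_iff]
  intro ζ _ v
  rw [zpow_zero, one_mul]
  congr 1
  exact Subsingleton.elim _ _

theorem exists_zpow_ne_one {d : ℤ} (hd : d ≠ 0) : ∃ ζ : ℂ, ‖ζ‖ = 1 ∧ ζ ^ d ≠ 1 := by
  -- This unit number satisfies ζ^d = e^{iπ} = -1.
  refine ⟨Complex.exp ((Real.pi / d : ℝ) * Complex.I), Complex.norm_exp_ofReal_mul_I _, ?_⟩
  rw [← Complex.exp_int_mul]
  have hd' : (d : ℂ) ≠ 0 := by exact_mod_cast hd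
  have : (d : ℂ) * (((Real.pi / d : ℝ) : ℂ) * Complex.I) = Real.pi * Complex.I := by
    push_cast
    field_simp
  rw [this, Complex.exp_pi_mul_I]
  norm_num

theorem HasWeight.eq_zero_of_ne {w w' : ℤ} {a : CForm n k} (h : HasWeight w a) (h' : HasWeight w' a)
    (hne : w ≠ w') : a = 0 := by
  obtain ⟨ζ, hζ, hd⟩ := exists_zpow_ne_one (sub_ne_zero.mpr hne)
  have h1 : ζ ^ w • a = ζ ^ w' • a := by rw [← h ζ hζ, ← h' ζ hζ]
  have h2 : (ζ ^ w - ζ ^ w') • a = 0 := by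
    ext v
    have := congrArg (fun b : CForm n k => b v) h1
    simp only [ContinuousAlternatingMap.smul_apply, smul_eq_mul] at this
    simp [sub_mul, this]
  refine (smul_eq_zero.mp h2).resolve_left fun h3 => hd ?_
  have h0 := ne_zero_of_norm_one hζ
  rw [zpow_sub₀ h0, sub_eq_zero.mp h3, div_self (zpow_ne_zero _ h0)]

theorem finrank_Cn : Module.finrank ℝ (Cn n) = 2 * n := by
  rw [finrank_real_of_complex, finrank_euclideanSpace, Fintype.card_fin]

theorem eq_zero_of_degree_gt (h : 2 * n < k) (a : CForm n k) : a = 0 := by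
  ext v
  refine a.toAlternatingMap.map_linearDependent v fun hv => ?_
  have := hv.fintype_card_le_finrank
  rw [finrank_Cn, Fintype.card_fin] at this
  omega

theorem det_mulC {ζ : ℂ} (hζ : ‖ζ‖ = 1) : LinearMap.det (mulC n ζ : Cn n →ₗ[ℝ] Cn n) = 1 := by
  have h : (mulC n ζ : Cn n →ₗ[ℝ] Cn n) = (ζ • (LinearMap.id : Cn n →ₗ[ℂ] Cn n)).restrictScalars ℝ := rfl
  rw [h, LinearMap.det_restrictScalars, LinearMap.det_smul, LinearMap.det_id, mul_one, map_pow,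
    Algebra.norm_complex_apply, Complex.normSq_eq_norm_sq, hζ]
  simp

/-- Rotation by a unit ζ has real determinant |ζ|^{2n} = 1, and a top form is a multiple of the
determinant in each of its real and imaginary parts. -/
theorem hasWeight_top (a : CForm n (2 * n)) : HasWeight 0 a := by
  rw [hasWeight_iff]
  intro ζ hζ v
  let b := (Module.finBasis ℝ (Cn n)).reindex (finCongr finrank_Cn)
  have key : ∀ f : Cn n [⋀^Fin (2 * n)]→ₗ[ℝ] ℝ, f (fun i => ζ • v i) = f v := by
    intro f
    rw [f.eq_smul_basis_det b]
    simp only [AlternatingMap.smul_apply]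
    congr 1
    have := b.det_comp (mulC n ζ : Cn n →ₗ[ℝ] Cn n) v
    rw [det_mulC hζ, one_mul] at this
    exact this
  have h1 := key (Complex.reLm.compAlternatingMap a.toAlternatingMap)
  have h2 := key (Complex.imLm.compAlternatingMap a.toAlternatingMap)
  rw [zpow_zero, one_mul]
  exact Complex.ext h1 h2

theorem top_eq_zero_of_hasWeight {w : ℤ} (hw : w ≠ 0) {a : CForm n k} (hk : k = 2 * n)
    (ha : HasWeight w a) : a = 0 := by
  subst hk
  exact ha.eq_zero_of_ne (hasWeight_top a) hw

theorem formInner_pull_mulC (hG : G.PosDef) {ζ : ℂ} (hζ : ‖ζ‖ = 1) (a b : CForm n k) :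
    formInner G (pull (mulC n ζ) a) (pull (mulC n ζ) b) = formInner G a b := by
  obtain ⟨f, hf⟩ := exists_isONFrame hG
  have hf' : IsONFrame G (fun s => ζ • f s) := fun s t => by rw [riem_smul_smul hζ, hf]
  rw [hf.formInner_eq, hf'.formInner_eq a b]
  rfl

/-- Unit rotations are isometries, so the inner product equals itself times ζ^{w-w'}. -/
theorem formInner_eq_zero_of_hasWeight (hG : G.PosDef) {w w' : ℤ} {a b : CForm n k}
    (ha : HasWeight w a) (hb : HasWeight w' b) (h : w ≠ w') : formInner G a b = 0 := by
  obtain ⟨ζ, hζ, hd⟩ := exists_zpow_ne_one (sub_ne_zero.mpr h)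
  have h1 := formInner_pull_mulC hG hζ a b
  rw [ha ζ hζ, hb ζ hζ, formInner_smul_left, formInner_smul_right hG, ← mul_assoc, map_zpow₀,
    ← Complex.inv_eq_conj hζ, inv_zpow, ← div_eq_mul_inv, ← zpow_sub₀ (ne_zero_of_norm_one hζ)] at h1
  by_contra hne
  exact hd (mul_right_cancel₀ hne (h1.trans (one_mul _).symm))

/-- Wedging with θ raises the weight by `w`, so its adjoint lowers it by `w`. -/
theorem HasWeight.contract (hG : G.PosDef) {w w' : ℤ} {θ : CForm n 1} (hθ : HasWeight w θ)
    {a : CForm n (k + 1)} (ha : HasWeight w' a) : HasWeight (w' - w) (ctr G θ a) := by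
  intro ζ hζ
  have h0 := ne_zero_of_norm_one hζ
  refine eq_of_formInner_eq hG fun c => ?_
  obtain ⟨d, rfl⟩ : ∃ d, c = pull (mulC n ζ) d := by
    refine ⟨pull (mulC n ζ⁻¹) c, ?_⟩
    ext v
    simp [smul_smul, inv_mul_cancel₀ h0]
  have e : ∀ d : CForm n k, emb (wedge (m := k + 1) (Nat.add_comm 1 k) θ d) = emb θ * emb d :=
    fun d => emb_wedge _ _ _
  rw [formInner_pull_mulC hG hζ, ← formInner_mul_left hG θ d _ a (e d), ← formInner_pull_mulC hG hζ,
    ← wedge_pull, hθ ζ hζ, ha ζ hζ, formInner_smul_right hG, formInner_smul_right hG,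
    ← formInner_mul_left hG θ _ _ a (e _)]
  have e2 : wedge (m := k + 1) (Nat.add_comm 1 k) (ζ ^ w • θ) (pull (mulC n ζ) d) =
      ζ ^ w • wedge (Nat.add_comm 1 k) θ (pull (mulC n ζ) d) := by
    rw [← emb_inj, emb_wedge, map_smul, map_smul, emb_wedge, smul_mul_assoc]
  rw [e2, formInner_smul_left, ← mul_assoc, map_zpow₀, map_zpow₀, ← Complex.inv_eq_conj hζ, inv_zpow,
    inv_zpow, ← zpow_neg, ← zpow_neg, ← zpow_add₀ h0]
  congr 2
  ring

/-! ### Contraction with the complex coordinate vectors -/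

/-- Contraction with `∂/∂z_j`. -/
noncomputable def curD (j : Fin n) (a : CForm n (k + 1)) : CForm n k :=
  (1 / 2 : ℂ) • (a.curryLeft (realBasis (j, 0)) - Complex.I • a.curryLeft (realBasis (j, 1)))

/-- Contraction with `∂/∂z̄_j`. -/
noncomputable def curDb (j : Fin n) (a : CForm n (k + 1)) : CForm n k :=
  (1 / 2 : ℂ) • (a.curryLeft (realBasis (j, 0)) + Complex.I • a.curryLeft (realBasis (j, 1)))

theorem I_smul_realBasis (j : Fin n) : Complex.I • (realBasis (j, 0) : Cn n) = realBasis (j, 1) := by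
  ext i
  by_cases h : i = j <;> simp [realBasis, h]

theorem curryLeft_smul_realBasis {w : ℤ} {a : CForm n (k + 1)} (ha : HasWeight w a) {ζ : ℂ}
    (hζ : ‖ζ‖ = 1) (j : Fin n) (v : Fin k → Cn n) (b : Fin 2) :
    a.curryLeft (realBasis (j, b)) (fun i => ζ • v i) =
      ζ ^ w * a.curryLeft (ζ⁻¹ • realBasis (j, b)) v := by
  rw [hasWeight_iff] at ha
  have := ha ζ hζ (Matrix.vecCons (ζ⁻¹ • realBasis (j, b)) v)
  rw [ContinuousAlternatingMap.curryLeft_apply_apply, ContinuousAlternatingMap.curryLeft_apply_apply,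
    ← this]
  congr 1
  ext i : 1
  refine Fin.cases ?_ (fun i => ?_) i
  · simp [smul_smul, mul_inv_cancel₀ (ne_zero_of_norm_one hζ)]
  · simp

theorem complex_smul_realBasis (ζ : ℂ) (j : Fin n) : ζ • (realBasis (j, 0) : Cn n) =
    ζ.re • realBasis (j, 0) + ζ.im • realBasis (j, 1) ∧
    ζ • (realBasis (j, 1) : Cn n) = ζ.re • realBasis (j, 1) - ζ.im • realBasis (j, 0) := by
  constructor
  · rw [← I_smul_realBasis]
    conv_lhs => rw [← Complex.re_add_im ζ, add_smul, mul_smul]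
    rfl
  · rw [← I_smul_realBasis]
    conv_lhs => rw [← Complex.re_add_im ζ, add_smul, mul_smul, smul_smul Complex.I, Complex.I_mul_I,
      neg_one_smul, smul_neg]
    rw [sub_eq_add_neg]
    rfl

theorem HasWeight.curD {w : ℤ} {a : CForm n (k + 1)} (ha : HasWeight w a) (j : Fin n) :
    HasWeight (w - 1) (curD j a) := by
  rw [hasWeight_iff]
  intro ζ hζ v
  have h0 := ne_zero_of_norm_one hζ
  simp only [DbarForms.curD, ContinuousAlternatingMap.smul_apply, ContinuousAlternatingMap.sub_apply,
    curryLeft_smul_realBasis ha hζ, (complex_smul_realBasis ζ⁻¹ j).1, (complex_smul_realBasis ζ⁻¹ j).2,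
    map_add, map_sub, map_smul, ContinuousAlternatingMap.add_apply, zpow_sub_one₀ h0]
  simp only [smul_eq_mul, Complex.real_smul]
  have e := Complex.re_add_im ζ⁻¹
  set x := ζ⁻¹
  linear_combination (1 / 2 : ℂ) * ζ ^ w * (a.curryLeft (realBasis (j, 0)) v -
    Complex.I * a.curryLeft (realBasis (j, 1)) v) * e
    + (1 / 2 : ℂ) * ζ ^ w * x.im * a.curryLeft (realBasis (j, 1)) v * Complex.I_mul_I

theorem HasWeight.curDb {w : ℤ} {a : CForm n (k + 1)} (ha : HasWeight w a) (j : Fin n) :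
    HasWeight (w + 1) (curDb j a) := by
  rw [hasWeight_iff]
  intro ζ hζ v
  have h0 := ne_zero_of_norm_one hζ
  have h1 : ζ⁻¹.re = ζ.re ∧ ζ⁻¹.im = -ζ.im := by rw [Complex.inv_eq_conj hζ]; simp
  simp only [DbarForms.curDb, ContinuousAlternatingMap.smul_apply, ContinuousAlternatingMap.sub_apply,
    curryLeft_smul_realBasis ha hζ, (complex_smul_realBasis ζ⁻¹ j).1, (complex_smul_realBasis ζ⁻¹ j).2,
    map_add, map_sub, map_smul, ContinuousAlternatingMap.add_apply, zpow_add_one₀ h0, h1.1, h1.2]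
  simp only [smul_eq_mul, Complex.real_smul]
  have e := Complex.re_add_im ζ
  push_cast
  linear_combination (1 / 2 : ℂ) * ζ ^ w * (a.curryLeft (realBasis (j, 0)) v +
    Complex.I * a.curryLeft (realBasis (j, 1)) v) * e
    - (1 / 2 : ℂ) * ζ ^ w * ζ.im * a.curryLeft (realBasis (j, 1)) v * Complex.I_mul_I

theorem eq_zero_of_curryLeft {a : CForm n (k + 1)} (h : ∀ s, a.curryLeft (realBasis s) = 0) : a = 0 := by
  have := emb_gen_expand a
  simp_rw [h, map_zero, mul_zero] at this
  rw [Finset.sum_const_zero] at this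
  have hk : ((k : ℂ) + 1) ≠ 0 := by exact_mod_cast k.succ_ne_zero
  have h2 := (smul_eq_zero.mp this.symm).resolve_left hk
  exact emb_injective (h2.trans (map_zero _).symm)

theorem eq_zero_of_curD_curDb {a : CForm n (k + 1)} (h : ∀ j, curD j a = 0) (h' : ∀ j, curDb j a = 0) :
    a = 0 := by
  refine eq_zero_of_curryLeft ?_
  rintro ⟨j, b⟩
  have h1 : a.curryLeft (realBasis (j, 0)) = curD j a + curDb j a := by
    ext v; simp [curD, curDb]; ring
  have h2 : a.curryLeft (realBasis (j, 1)) = Complex.I • (curD j a - curDb j a) := by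
    ext v
    simp only [curD, curDb, ContinuousAlternatingMap.smul_apply, ContinuousAlternatingMap.sub_apply,
      ContinuousAlternatingMap.add_apply, smul_eq_mul]
    linear_combination (a.curryLeft (realBasis (j, 1)) v) * Complex.I_mul_I
  fin_cases b
  · exact h1.trans (by rw [h, h', add_zero])
  · exact h2.trans (by rw [h, h', sub_zero]; exact smul_zero Complex.I)

/-- A form whose weight exceeds its degree vanishes. -/
theorem HasWeight.eq_zero_of_gt {w : ℤ} {a : CForm n k} (ha : HasWeight w a) (hw : (k : ℤ) < w) :
    a = 0 := by
  induction k generalizing w with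
  | zero => exact ha.eq_zero_of_ne (hasWeight_zeroDegree a) (by simpa using hw.ne')
  | succ k ih =>
    push_cast at hw
    exact eq_zero_of_curD_curDb (fun j => ih (ha.curD j) (by omega)) (fun j => ih (ha.curDb j) (by omega))

theorem dz_apply (j : Fin n) (v : Fin 1 → Cn n) : dz j v = v 0 j := rfl

theorem hasWeight_dz (j : Fin n) : HasWeight 1 (dz j) := by
  rw [hasWeight_iff]
  intro ζ _ v
  simp [dz_apply]

theorem hasWeight_dzBar (j : Fin n) : HasWeight (-1) (conjForm (dz j)) := (hasWeight_dz j).conj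

theorem emb_dz (j : Fin n) : emb (dz j) = gen (j, 0) + Complex.I • gen (j, 1) := by
  rw [emb_one_degree, Fintype.sum_prod_type, Finset.sum_eq_single j]
  · simp [Fin.sum_univ_two, dz_apply, realBasis]
  · intro i _ hi
    simp [dz_apply, realBasis, hi.symm]
  · simp

theorem emb_dzBar (j : Fin n) : emb (conjForm (dz j)) = gen (j, 0) - Complex.I • gen (j, 1) := by
  rw [emb_one_degree, Fintype.sum_prod_type, Finset.sum_eq_single j]
  · simp [Fin.sum_univ_two, dz_apply, realBasis, sub_eq_add_neg]
  · intro i _ hi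
    simp [dz_apply, realBasis, hi.symm]
  · simp

theorem emb_expand (a : CForm n (k + 1)) : ((k : ℂ) + 1) • emb a =
    ∑ j, (emb (dz j) * emb (curD j a) + emb (conjForm (dz j)) * emb (curDb j a)) := by
  rw [← emb_gen_expand, Fintype.sum_prod_type]
  refine Finset.sum_congr rfl fun j _ => ?_
  rw [Fin.sum_univ_two, emb_dz, emb_dzBar]
  simp only [curD, curDb, map_smul, map_add, map_sub, mul_smul_comm, mul_add, mul_sub, add_mul, sub_mul,
    smul_mul_assoc]
  match_scalars <;> ring_nf <;> simp [Complex.I_sq]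

/-- Every form is a combination of forms of pure weight. -/
theorem weight_induction {P : CForm n k → Prop} (h0 : P 0) (hadd : ∀ a b, P a → P b → P (a + b))
    (hw : ∀ (w : ℤ) (a : CForm n k), HasWeight w a → P a) (a : CForm n k) : P a := by
  have key : a ∈ Submodule.span ℂ {b : CForm n k | ∃ w, HasWeight w b} := by
    clear h0 hadd hw P
    induction k with
    | zero => exact Submodule.subset_span ⟨0, hasWeight_zeroDegree a⟩
    | succ k ih =>
      have hk : ((k : ℂ) + 1) ≠ 0 := by exact_mod_cast k.succ_ne_zero
      have h1 : a = ((k : ℂ) + 1)⁻¹ • ∑ j, (wedge (Nat.add_comm 1 k) (dz j) (curD j a) +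
          wedge (Nat.add_comm 1 k) (conjForm (dz j)) (curDb j a)) := by
        rw [← emb_inj, map_smul, map_sum]
        simp_rw [map_add, emb_wedge]
        rw [← emb_expand, smul_smul, inv_mul_cancel₀ hk, one_smul]
      have h2 : ∀ (θ : CForm n 1) (w : ℤ), HasWeight w θ → ∀ b : CForm n k,
          wedge (Nat.add_comm 1 k) θ b ∈ Submodule.span ℂ {b : CForm n (k + 1) | ∃ w, HasWeight w b} := by
        intro θ w hθ b
        let L : CForm n k →ₗ[ℂ] CForm n (k + 1) :=
          { toFun := fun b => wedge (Nat.add_comm 1 k) θ b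
            map_add' := fun x y => by rw [← emb_inj]; simp [emb_wedge, mul_add]
            map_smul' := fun c x => by rw [← emb_inj]; simp [emb_wedge] }
        have h3 := Submodule.mem_map_of_mem (f := L) (ih b)
        rw [Submodule.map_span] at h3
        refine Submodule.span_mono ?_ h3
        rintro _ ⟨x, ⟨w', hx⟩, rfl⟩
        exact ⟨w + w', hθ.wedgeForm hx _⟩
      rw [h1]
      exact Submodule.smul_mem _ _ (Submodule.sum_mem _ fun j _ => Submodule.add_mem _
        (h2 _ _ (hasWeight_dz j) _) (h2 _ _ (hasWeight_dzBar j) _))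
  -- `P` is not assumed stable under scalars, so the span induction carries an arbitrary scalar;
  -- scaling preserves pure weight.
  have key2 : ∀ c : ℂ, P (c • a) := by
    induction key using Submodule.span_induction with
    | mem x hx => exact fun c => hx.elim fun w h => hw w _ (h.smul c)
    | zero => exact fun c => by rwa [smul_zero]
    | add x y _ _ hx hy => exact fun c => by rw [smul_add]; exact hadd _ _ (hx c) (hy c)
    | smul d x _ hx => exact fun c => by rw [smul_smul]; exact hx _
  simpa using key2 1

end DbarForms

end

section

namespace DbarForms

open scoped ComplexOrder MatrixOrder

variable {n k l m : ℕ} {G : Matrix (Fin n) (Fin n) ℂ}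

/-! ### The fundamental form and its powers -/

theorem wedge_one_one (θ η : CForm n 1) (v w : Cn n) :
    wedge (m := 2) rfl θ η ![v, w] = θ ![v] * η ![w] - θ ![w] * η ![v] := by
  have h := wedge_apply θ η ![v, w]
  have h2 := Matrix.det_apply' (Matrix.of fun i j : Fin 2 =>
    if j = 0 then θ ![(![v, w] : Fin 2 → Cn n) i] else η ![(![v, w] : Fin 2 → Cn n) i])
  have h3 : ∀ (ξ : CForm n 1) (f : Fin 1 → Cn n), ξ f = ξ ![f 0] := by
    intro ξ f
    congr 1
    ext i : 1
    rw [Subsingleton.elim i 0]; rfl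
  rw [Matrix.det_fin_two] at h2
  simp only [Nat.factorial_one, mul_one, Nat.cast_one, one_mul] at h
  refine h.trans (Eq.trans (Finset.sum_congr rfl fun σ _ => ?_) (h2.symm.trans ?_))
  · congr 1
    rw [Fin.prod_univ_two, h3 θ, h3 η]
    rfl
  · simp
    ring

/-- The relation ω(v,w) = g(iv,w) expresses ω through the Riemannian metric and the complex
structure alone, which later gives its naturality under coordinate changes. -/
theorem omega_apply (hG : G.PosDef) (v w : Cn n) : omega G ![v, w] = (riem G (Complex.I • v) w : ℂ) := by
  have h1 : omega G ![v, w] = Complex.I / 2 * (herm G v w - herm G w v) := by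
    rw [omega, ContinuousAlternatingMap.sum_apply]
    simp_rw [ContinuousAlternatingMap.sum_apply, ContinuousAlternatingMap.smul_apply, wedge_one_one]
    simp only [herm, mul_sub, Finset.mul_sum, ← Finset.sum_sub_distrib]
    refine Finset.sum_congr rfl fun j _ => Finset.sum_congr rfl fun k _ => ?_
    simp [dz_apply]
    ring
  rw [h1, riem, herm_smul_left, ← herm_conj_symm hG v w, Complex.sub_conj]
  apply Complex.ext <;> simp

theorem sum_gInv_mul_riem (hG : G.PosDef) (s : Idx n) (v : Cn n) :
    ∑ t, gInv G s t * riem G (realBasis t) v = coordR s v := by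
  have hu : IsUnit (riemGram G).det := (Matrix.isUnit_iff_isUnit_det _).mp (riemGram_posDef hG).isUnit
  have h := congrFun (congrArg (fun M => Matrix.mulVec M fun t => coordR t v)
    (Matrix.nonsing_inv_mul (riemGram G) hu)) s
  rw [Matrix.one_mulVec, ← Matrix.mulVec_mulVec] at h
  rw [← h]
  simp only [Matrix.mulVec, dotProduct]
  refine Finset.sum_congr rfl fun t _ => ?_
  congr 1
  conv_lhs => rw [← riemL_apply, ← sum_coordR v]
  simp [riemL_apply, riemGram_eq, mul_comm]

/-- Contracting ω with e_t gives -g(e_t, i·), and summing against the inverse metric recovers the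
real coordinates of iw. -/
theorem ctr_omega_apply (hG : G.PosDef) (θ : CForm n 1) (w : Cn n) :
    ctr G θ (omega G) ![w] = -conj (θ ![Complex.I • w]) := by
  have h1 : ∀ t : Idx n, (omega G).curryLeft (realBasis t) ![w] =
      -(riem G (realBasis t) (Complex.I • w) : ℂ) := by
    intro t
    rw [ContinuousAlternatingMap.curryLeft_apply_apply, omega_apply hG]
    have : riem G (Complex.I • realBasis t) w = -riem G (realBasis t) (Complex.I • w) := by
      rw [riem, riem, herm_smul_left, herm_smul_right]
      simp
    rw [this]
    push_cast
    rfl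
  rw [ctr, ContinuousAlternatingMap.sum_apply]
  simp_rw [ContinuousAlternatingMap.sum_apply, ContinuousAlternatingMap.smul_apply, h1]
  have h2 : ∀ s : Idx n, ∑ t, ((gInv G s t : ℝ) * conj (θ ![realBasis s])) •
      -(riem G (realBasis t) (Complex.I • w) : ℂ) =
      -conj ((coordR s (Complex.I • w) : ℝ) • θ ![realBasis s]) := by
    intro s
    rw [← sum_gInv_mul_riem hG, Complex.real_smul, map_mul, Complex.conj_ofReal]
    push_cast
    rw [Finset.sum_mul, ← Finset.sum_neg_distrib]
    refine Finset.sum_congr rfl fun t _ => ?_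
    simp only [smul_eq_mul]
    ring
  simp_rw [h2]
  rw [Finset.sum_neg_distrib, ← map_sum, ← oneL_apply]
  congr 2
  conv_rhs => rw [← sum_coordR (Complex.I • w)]
  rw [map_sum]
  simp_rw [map_smul]
  rfl

theorem form_one_ext {a b : CForm n 1} (h : ∀ w, a ![w] = b ![w]) : a = b := by
  ext v
  rw [show v = ![v 0] by ext i : 1; rw [Subsingleton.elim i 0]; rfl]
  exact h _

theorem HasWeight.apply_I {w : ℤ} {θ : CForm n 1} (h : HasWeight w θ) (v : Cn n) :
    θ ![Complex.I • v] = Complex.I ^ w * θ ![v] := by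
  rw [hasWeight_iff] at h
  rw [← h Complex.I (by simp) ![v]]
  congr 1
  ext i : 1
  rw [Subsingleton.elim i 0]; rfl

/-- A (0,1)-form satisfies θ(iw) = -iθ(w), which evaluates the preceding formula. For θ = dz̄_j the
result is -i dz_j, the source of all powers of i below. -/
theorem ctr_omega_of_weight_neg_one (hG : G.PosDef) {θ : CForm n 1} (h : HasWeight (-1) θ) :
    ctr G θ (omega G) = -Complex.I • conjForm θ := by
  refine form_one_ext fun w => ?_
  rw [ctr_omega_apply hG, h.apply_I]
  simp

theorem hasWeight_omega : HasWeight 0 (omega G) :=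
  .sum fun j _ => .sum fun k _ => ((hasWeight_dz j).wedgeForm (hasWeight_dzBar k) rfl).smul _

theorem hasWeight_omegaPow (s : ℕ) : HasWeight 0 (omegaPow G s) := by
  induction s with
  | zero => exact hasWeight_zeroDegree _
  | succ s ih => exact (ih.wedgeForm hasWeight_omega _).smul _

/-- `ω_s` in the exterior algebra. -/
noncomputable def wp (G : Matrix (Fin n) (Fin n) ℂ) (s : ℕ) : Ext n := emb (omegaPow G s)

theorem wp_zero : wp G 0 = 1 := by
  rw [wp, omegaPow, emb_zeroForm, map_one]

theorem wp_succ (s : ℕ) : ((s : ℂ) + 1) • wp G (s + 1) = wp G s * emb (omega G) := by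
  have hk : ((s : ℂ) + 1) ≠ 0 := by exact_mod_cast s.succ_ne_zero
  rw [wp, omegaPow, map_smul, emb_wedge, smul_smul, mul_one_div, div_self hk, one_smul]
  rfl

theorem even_mul_comm {j : ℕ} (hj : Even j) (a : CForm n j) (b : CForm n k) :
    emb a * emb b = emb b * emb a := by
  rw [emb_mul_comm, (hj.mul_right k).neg_one_pow, one_smul]

theorem wp_mul_comm (s : ℕ) (b : CForm n k) : wp G s * emb b = emb b * wp G s :=
  even_mul_comm (even_two_mul s) _ _

theorem omega_mul_comm (b : CForm n k) : emb (omega G) * emb b = emb b * emb (omega G) :=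
  even_mul_comm even_two _ _

/-- Contraction obeys the unsigned Leibniz rule on powers of the even form ω; dividing by s! leaves
no numerical factor. -/
theorem ctrE_wp (θ : CForm n 1) (s : ℕ) :
    ctrE G θ (wp G (s + 1)) = wp G s * emb (ctr G θ (omega G)) := by
  have h0 : ∀ s, ctrE G θ (wp G s * emb (omega G)) =
      ctrE G θ (wp G s) * emb (omega G) + wp G s * emb (ctr G θ (omega G)) := by
    intro s
    rw [wp, ctrE_emb_mul, (even_two_mul s).neg_one_pow, one_smul, ctrE_emb]
  induction s with
  | zero =>
    have := wp_succ (G := G) 0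
    simp only [Nat.cast_zero, zero_add, one_smul] at this
    rw [this, h0, wp_zero, ← map_one (algebraMap ℂ (Ext n)), ctrE_algebraMap, zero_mul, zero_add]
  | succ s ih =>
    have hk : ((s : ℂ) + 1 + 1) ≠ 0 := by exact_mod_cast (s + 1).succ_ne_zero
    have h1 := congrArg (ctrE G θ) (wp_succ (G := G) (s + 1))
    rw [map_smul, h0, ih, mul_assoc, ← omega_mul_comm, ← mul_assoc, ← wp_succ, smul_mul_assoc] at h1
    push_cast at h1
    refine smul_right_injective _ hk (h1.trans ?_)
    change _ = ((s : ℂ) + 1 + 1) • _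
    rw [add_smul ((s : ℂ) + 1) 1, one_smul]

theorem conjForm_omega (hG : G.PosDef) : conjForm (omega G) = omega G := by
  ext v
  have : v = ![v 0, v 1] := by ext i : 1; fin_cases i <;> rfl
  rw [this, conjForm_apply, omega_apply hG, Complex.conj_ofReal]

theorem conjForm_omegaPow (hG : G.PosDef) (s : ℕ) : conjForm (omegaPow G s) = omegaPow G s := by
  induction s with
  | zero => ext v; simp [omegaPow, zeroForm]
  | succ s ih => rw [omegaPow, conjForm_smul, conjForm_wedge, ih, conjForm_omega hG]; simp

theorem ctr_conj (θ : CForm n 1) (a : CForm n (k + 1)) :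
    ctr G (conjForm θ) (conjForm a) = conjForm (ctr G θ a) := by
  simp only [ctr, conjForm_sum, conjForm_smul]
  refine Finset.sum_congr rfl fun s _ => Finset.sum_congr rfl fun t _ => ?_
  rw [map_mul, Complex.conj_ofReal]
  rfl

/-- The constant `i ^ (p ^ 2)`. -/
noncomputable def cI (p : ℕ) : ℂ := Complex.I ^ (p ^ 2)

theorem cI_zero : cI 0 = 1 := by simp [cI]

theorem cI_succ (p : ℕ) : cI (p + 1) = (-1) ^ p * Complex.I * cI p := by
  rw [cI, cI, show (p + 1) ^ 2 = p ^ 2 + 2 * p + 1 by ring, pow_add, pow_add, pow_mul, Complex.I_sq]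
  ring

theorem conj_cI (p : ℕ) : conj (cI p) = (-1) ^ p * cI p := by
  induction p with
  | zero => simp [cI]
  | succ p ih =>
    rw [cI_succ, map_mul, ih]
    simp [pow_succ]
    ring

theorem conj_cI_mul (p : ℕ) : conj (cI p) * cI p = 1 := by
  rw [← Complex.normSq_eq_conj_mul_self, Complex.normSq_eq_norm_sq, cI]
  simp

theorem emb_mul_eq_zero {a : CForm n k} {b : CForm n l} (h : 2 * n < k + l) : emb a * emb b = 0 := by
  rw [← emb_wedge rfl, eq_zero_of_degree_gt h (wedge rfl a b), map_zero]

theorem emb_mul_eq_zero_of_weight {w : ℤ} (hw : w ≠ 0) {a : CForm n (2 * n)} (ha : HasWeight w a) :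
    emb a = 0 := by
  rw [top_eq_zero_of_hasWeight hw rfl ha, map_zero]

/-- Contraction with a `(0,1)`-form annihilates forms of type `(p,0)`. -/
theorem ctr_eq_zero (hG : G.PosDef) {θ : CForm n 1} (hθ : HasWeight (-1) θ) {a : CForm n (k + 1)}
    (ha : HasWeight (k + 1 : ℕ) a) : ctr G θ a = 0 :=
  (hθ.contract hG ha).eq_zero_of_gt (by push_cast; omega)

theorem ctrE_eq_zero (hG : G.PosDef) {θ : CForm n 1} (hθ : HasWeight (-1) θ) {a : CForm n k}
    (ha : HasWeight k a) : ctrE G θ (emb a) = 0 := by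
  cases k with
  | zero => rw [emb_zero_degree, ctrE_algebraMap]
  | succ k => rw [ctrE_emb, ctr_eq_zero hG hθ ha, map_zero]

/-- Every form is the sum of a form of type `(k,0)` and of multiples of the `dz̄_j`. -/
theorem exists_dzBar_decomp (c : CForm n (k + 1)) : ∃ (c0 : CForm n (k + 1)) (d : Fin n → CForm n k),
    HasWeight (k + 1 : ℕ) c0 ∧ c = c0 + ∑ j, wedge (Nat.add_comm 1 k) (conjForm (dz j)) (d j) := by
  induction k with
  | zero =>
    have h1 := emb_expand c
    refine ⟨∑ j, wedge (Nat.add_comm 1 0) (dz j) (curD j c), fun j => curDb j c, ?_, ?_⟩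
    · refine .sum fun j _ => ?_
      exact (hasWeight_dz j).wedgeForm (hasWeight_zeroDegree _) _
    · rw [← emb_inj, map_add, map_sum, map_sum, ← Finset.sum_add_distrib]
      simp_rw [emb_wedge]
      rw [← h1]
      simp
  | succ k ih =>
    have hk : ((k : ℂ) + 1 + 1) ≠ 0 := by exact_mod_cast (k + 1).succ_ne_zero
    have h1 := emb_expand c
    choose A B hA hAB using fun j => ih (curD j c)
    push_cast at h1
    -- Decompose each contraction with ∂/∂z_j as A_j + ∑ dz̄_i ∧ B_{ji}. The dz_j ∧ A_j form the
    -- (k+2,0)-part, and moving dz_j past dz̄_i gives the minus sign in the second witness.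
    refine ⟨((k : ℂ) + 1 + 1)⁻¹ • ∑ j, wedge (Nat.add_comm 1 (k + 1)) (dz j) (A j),
      fun i => ((k : ℂ) + 1 + 1)⁻¹ • (curDb i c - ∑ j, wedge (Nat.add_comm 1 k) (dz j) (B j i)), ?_, ?_⟩
    · refine HasWeight.smul (.sum fun j _ => ?_) _
      have := (hasWeight_dz j).wedgeForm (hA j) (Nat.add_comm 1 (k + 1))
      rwa [show (1 : ℤ) + (k + 1 : ℕ) = (k + 1 + 1 : ℕ) by push_cast; ring] at this
    · rw [← emb_inj]
      refine smul_right_injective _ hk ?_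
      simp only [h1, map_add, map_sum, map_smul, emb_wedge, smul_add, smul_smul, mul_inv_cancel₀ hk,
        one_smul, Finset.smul_sum, mul_smul_comm, map_sub, mul_sub, Finset.sum_sub_distrib,
        Finset.sum_add_distrib]
      have h2 : ∀ j, emb (curD j c) = emb (A j) + ∑ i, emb (conjForm (dz i)) * emb (B j i) := by
        intro j
        conv_lhs => rw [hAB j]
        rw [map_add, map_sum]
        simp_rw [emb_wedge]
      simp_rw [h2, mul_add, Finset.sum_add_distrib, Finset.mul_sum]
      have h3 : ∀ i j, emb (dz j) * (emb (conjForm (dz i)) * emb (B j i)) =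
          -(emb (conjForm (dz i)) * (emb (dz j) * emb (B j i))) := by
        intro i j
        rw [← mul_assoc, emb_mul_comm, ← mul_assoc]
        simp
      rw [Finset.sum_comm (f := fun i j => emb (conjForm (dz i)) * (emb (dz j) * emb (B j i)))]
      simp_rw [h3, Finset.sum_neg_distrib]
      abel

/-- The pairing of a form with `γ ∧ ω_s`, for `γ` of type `(p,0)`. -/
theorem inner_primitive (hG : G.PosDef) {p s t : ℕ} {γ : CForm n p} (hγ : HasWeight p γ)
    (hst : p + s + t = n) (hk : k = p + 2 * s) (c a : CForm n k) (ha : emb a = emb γ * wp G s) :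
    formInner G c a • wp G n = cI p • (emb c * emb (conjForm γ) * wp G t) := by
  induction k generalizing p s t with
  | zero =>
    obtain rfl : p = 0 := by omega
    obtain rfl : s = 0 := by omega
    obtain rfl : t = n := by omega
    rw [wp_zero, mul_one, emb_inj] at ha
    subst ha
    rw [cI_zero, one_smul, emb_zero_degree, emb_zero_degree, ← map_mul, ← Algebra.smul_def]
    congr 1
    simp only [formInner_def, conjForm_apply]
    simp
    congr! 3
  | succ k ih =>
    have ha' : a = castForm (by omega) (wedge rfl γ (omegaPow G s)) := by
      rw [← emb_inj, emb_castForm, emb_wedge, ha]; rfl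
    have hwa : HasWeight p a := by
      have h1 := hγ.wedgeForm (hasWeight_omegaPow (G := G) s) (m := k + 1) hk.symm
      have h2 : a = wedge hk.symm γ (omegaPow G s) := by
        rw [← emb_inj, emb_wedge, ha]; rfl
      rw [h2]
      simpa using h1
    -- both sides vanish on forms of a weight other than `p`
    have hne : ∀ (w : ℤ) (c : CForm n (k + 1)), HasWeight w c → w ≠ p →
        formInner G c a • wp G n = cI p • (emb c * emb (conjForm γ) * wp G t) := by
      intro w c hc hw
      rw [formInner_eq_zero_of_hasWeight hG hc hwa hw, zero_smul]
      have h1 : HasWeight (w + -p + 0) (wedge (m := 2 * n) (by omega) (wedge rfl c (conjForm γ))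
          (omegaPow G t)) := (hc.wedgeForm hγ.conj _).wedgeForm (hasWeight_omegaPow t) _
      have h2 := emb_mul_eq_zero_of_weight (by omega) h1
      rw [emb_wedge, emb_wedge] at h2
      rw [wp, h2, smul_zero]
    have hadd : ∀ c d : CForm n (k + 1),
        formInner G c a • wp G n = cI p • (emb c * emb (conjForm γ) * wp G t) →
        formInner G d a • wp G n = cI p • (emb d * emb (conjForm γ) * wp G t) →
        formInner G (c + d) a • wp G n = cI p • (emb (c + d) * emb (conjForm γ) * wp G t) := by
      intro c d hc hd
      rw [formInner_add_left, add_smul, hc, hd, map_add, add_mul, add_mul, smul_add]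
    have hsum : ∀ (S : Finset (Fin n)) (c : Fin n → CForm n (k + 1)),
        (∀ j, formInner G (c j) a • wp G n = cI p • (emb (c j) * emb (conjForm γ) * wp G t)) →
        formInner G (∑ j ∈ S, c j) a • wp G n =
          cI p • (emb (∑ j ∈ S, c j) * emb (conjForm γ) * wp G t) := by
      intro S c hc
      rw [formInner_sum_left, Finset.sum_smul, map_sum, Finset.sum_mul, Finset.sum_mul, Finset.smul_sum]
      exact Finset.sum_congr rfl fun j _ => hc j
    cases s with
    -- With s = 0, only c of type (p,0) matters. Write it as a sum of dz_j ∧ d, move dz_j to γ, and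
    -- apply the induction hypothesis to the contracted γ, with t + 1 in place of t.
    | zero =>
      obtain rfl : k + 1 = p := by omega
      obtain rfl : a = γ := by rw [← emb_inj, ha, wp_zero, mul_one]
      refine weight_induction (P := fun c => formInner G c a • wp G n =
        cI (k + 1) • (emb c * emb (conjForm a) * wp G t)) ?_ hadd ?_ c
      · simp [formInner_zero_left]
      intro w c hc
      by_cases hw : w = (k + 1 : ℕ)
      swap
      · exact hne w c hc hw
      subst hw
      have hk1 : ((k : ℂ) + 1) ≠ 0 := by exact_mod_cast k.succ_ne_zero
      have hc0 : ∀ j, curDb j c = 0 := fun j => (hc.curDb j).eq_zero_of_gt (by push_cast; omega)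
      have h1 := emb_expand c
      simp_rw [hc0, map_zero, mul_zero, add_zero] at h1
      have h2 : c = ((k : ℂ) + 1)⁻¹ • ∑ j, wedge (Nat.add_comm 1 k) (dz j) (curD j c) := by
        rw [← emb_inj, map_smul, map_sum]
        simp_rw [emb_wedge]
        rw [← h1, smul_smul, inv_mul_cancel₀ hk1, one_smul]
      rw [h2, formInner_smul_left, mul_smul, map_smul, smul_mul_assoc, smul_mul_assoc,
        smul_comm (cI (k + 1))]
      congr 1
      refine hsum _ _ fun j => ?_
      have hd := hc.curD j
      set d := curD j c
      have hd : HasWeight k d := by simpa using hd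
      rw [formInner_mul_left hG (dz j) d _ a (emb_wedge _ _ _), emb_wedge]
      have hg : HasWeight k (ctr G (dz j) a) := by simpa using (hasWeight_dz j).contract hG hγ
      rw [ih hg (s := 0) (t := t + 1) (by omega) rfl d (ctr G (dz j) a) (by rw [wp_zero, mul_one])]
      -- The degree k + (k+1) + 2(t+1) equals 2n + 1, so this product vanishes. Contracting it by
      -- dz̄_j relates the expression supplied by the induction hypothesis to the wanted one.
      have h0 : emb d * (emb (conjForm a) * wp G (t + 1)) = 0 := by
        rw [wp, ← emb_wedge rfl]
        exact emb_mul_eq_zero (by omega)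
      have h3 := congrArg (ctrE G (conjForm (dz j))) h0
      rw [map_zero, ctrE_emb_mul, ctrE_eq_zero hG (hasWeight_dzBar j) hd, zero_mul, zero_add,
        ctrE_emb_mul, ctrE_emb, ctr_conj, ctrE_wp, ctr_omega_of_weight_neg_one hG (hasWeight_dzBar j),
        conjForm_conjForm, map_smul, smul_eq_zero, or_iff_right (by positivity), mul_add] at h3
      have h4 : emb d * (emb (conjForm a) * (wp G t * emb (dz j))) =
          -(emb (dz j) * emb d * emb (conjForm a) * wp G t) := by
        have := emb_mul_comm (dz j) (wedge rfl d (wedge rfl (conjForm a) (omegaPow G t)))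
        rw [emb_wedge, emb_wedge, show (-1 : ℂ) ^ (1 * (k + (k + 1 + 2 * t))) = -1 from
          Odd.neg_one_pow ⟨k + t, by ring⟩] at this
        rw [mul_assoc, mul_assoc, wp, this]
        simp [mul_assoc]
      simp only [mul_smul_comm] at h3
      rw [h4] at h3
      rw [mul_assoc, eq_neg_of_add_eq_zero_left h3, cI_succ]
      simp only [smul_neg, neg_smul, smul_smul, neg_neg]
      rw [← neg_smul]
      congr 1
      rw [pow_succ]
      ring
    | succ s =>
      obtain ⟨c0, d, hc0, rfl⟩ := exists_dzBar_decomp c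
      -- The (k+1,0)-part has weight k + 1 = p + 2(s+1), different from p, and so drops out. Only
      -- multiples of the dz̄_j remain.
      refine hadd _ _ (hne _ _ hc0 (by omega)) (hsum _ _ fun j => ?_)
      rw [formInner_mul_left hG (conjForm (dz j)) (d j) _ a (emb_wedge _ _ _), emb_wedge]
      set γ' := wedge rfl γ (dz j) with hγ'
      have hw' : HasWeight (p + 1 : ℕ) γ' := by
        have := hγ.wedgeForm (hasWeight_dz j) (m := p + 1) rfl
        exact_mod_cast this
      set a' : CForm n k := castForm (by omega) (wedge rfl γ' (omegaPow G s)) with ha1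
      have ha' : emb a' = emb γ' * wp G s := by rw [ha1, emb_castForm, emb_wedge]; rfl
      -- Contraction by dz̄_j kills γ and replaces ω_{s+1} by -i ω_s ∧ dz_j. This is again of the
      -- form treated, with γ ∧ dz_j of type (p+1,0) and s lowered by one.
      have hca : ctr G (conjForm (dz j)) a = ((-1 : ℂ) ^ p * -Complex.I) • a' := by
        rw [← emb_inj, ← ctrE_emb, ha, ctrE_emb_mul, ctrE_eq_zero hG (hasWeight_dzBar j) hγ, zero_mul,
          zero_add, ctrE_wp, ctr_omega_of_weight_neg_one hG (hasWeight_dzBar j), conjForm_conjForm,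
          map_smul, map_smul, ha', hγ', emb_wedge, mul_smul_comm, mul_smul_comm, smul_smul,
          wp_mul_comm, mul_assoc]
      rw [hca, formInner_smul_right hG, mul_smul, ih hw' (s := s) (t := t) (by omega) (by omega) (d j) a' ha',
        hγ', conjForm_wedge, emb_wedge]
      have h4 : emb (d j) * (emb (conjForm γ) * emb (conjForm (dz j))) =
          -(emb (conjForm (dz j)) * emb (d j) * emb (conjForm γ)) := by
        have := emb_mul_comm (conjForm (dz j)) (wedge rfl (d j) (conjForm γ))
        rw [emb_wedge, show (-1 : ℂ) ^ (1 * (k + p)) = -1 from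
          Odd.neg_one_pow ⟨p + s, by omega⟩] at this
        rw [mul_assoc, this]
        simp [mul_assoc]
      rw [h4, cI_succ]
      simp only [neg_mul, smul_neg, smul_smul, map_mul, map_neg, map_pow, map_one, Complex.conj_I]
      rw [← neg_smul]
      congr 1
      have h5 : ((-1 : ℂ) ^ p) * (-1) ^ p = 1 := by rw [← mul_pow]; simp
      linear_combination (-cI p * ((-1) ^ p * (-1) ^ p)) * Complex.I_mul_I + cI p * h5

end DbarForms

end

section

namespace DbarForms

open scoped ComplexOrder MatrixOrder

variable {n k l m : ℕ} {G : Matrix (Fin n) (Fin n) ℂ}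

/-! ### Forms of top degree and the Hodge operator -/

theorem exists_top_ne_zero : ∃ c : CForm n (2 * n), c ≠ 0 := by
  let b := (Module.finBasis ℝ (Cn n)).reindex (finCongr finrank_Cn)
  refine ⟨ofAlt (Complex.ofRealCLM.toLinearMap.compAlternatingMap b.det), fun h => ?_⟩
  have := congrArg (fun c : CForm n (2 * n) => c b) h
  simp [b.det_self] at this

theorem conjForm_zeroForm (c : ℂ) : conjForm (zeroForm c : CForm n 0) = zeroForm (conj c) := by
  ext v; rfl

/-- The pairing formula for the function γ = 1, with s = n. It shows that ω_n spans the top degree,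
so top forms may be compared by their coefficients. -/
theorem emb_top (hG : G.PosDef) (c : CForm n (2 * n)) :
    emb c = formInner G c (omegaPow G n) • wp G n := by
  have h := inner_primitive hG (p := 0) (s := n) (t := 0) (γ := zeroForm 1) (k := 2 * n)
    (hasWeight_zeroDegree _) (by omega) (by omega) c (omegaPow G n) (by
      rw [emb_zeroForm, map_one, one_mul]; rfl)
  rw [h, conjForm_zeroForm, emb_zeroForm, cI_zero, wp_zero]
  simp

theorem wp_ne_zero (hG : G.PosDef) : wp G n ≠ 0 := by
  intro h
  obtain ⟨c, hc⟩ := exists_top_ne_zero (n := n)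
  refine hc (emb_inj.mp ?_)
  rw [emb_top hG c, h, smul_zero, map_zero]

theorem wp_smul_inj (hG : G.PosDef) {a b : ℂ} : a • wp G n = b • wp G n ↔ a = b :=
  (smul_left_injective ℂ (wp_ne_zero hG)).eq_iff

/-- `b = * a`. -/
def IsStar (G : Matrix (Fin n) (Fin n) ℂ) (a : CForm n k) (b : CForm n l) : Prop :=
  ∀ c : CForm n k, emb c * emb (conjForm b) = formInner G c a • wp G n

theorem IsStar.add (hG : G.PosDef) {a a' : CForm n k} {b b' : CForm n l} (h : IsStar G a b)
    (h' : IsStar G a' b') : IsStar G (a + a') (b + b') := by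
  intro c
  rw [conjForm_add, map_add, mul_add, h c, h' c, formInner_add_right hG, add_smul]

theorem IsStar.smul (hG : G.PosDef) {a : CForm n k} {b : CForm n l} (h : IsStar G a b) (t : ℂ) :
    IsStar G (t • a) (t • b) := by
  intro c
  rw [conjForm_smul, map_smul, mul_smul_comm, h c, formInner_smul_right hG, mul_smul]

theorem isStar_zero (hG : G.PosDef) : IsStar G (0 : CForm n k) (0 : CForm n l) := by
  intro c
  have h : formInner G c (0 : CForm n k) = 0 := by
    have := formInner_smul_right hG 0 c (0 : CForm n k)
    rwa [show (0 : ℂ) • (0 : CForm n k) = 0 by ext v; simp, map_zero, zero_mul] at this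
  rw [h, conjForm_zero]
  simp

theorem IsStar.sum (hG : G.PosDef) {ι : Type*} (S : Finset ι) {a : ι → CForm n k} {b : ι → CForm n l}
    (h : ∀ i, IsStar G (a i) (b i)) : IsStar G (∑ i ∈ S, a i) (∑ i ∈ S, b i) := by
  classical
  induction S using Finset.induction_on with
  | empty => simpa using isStar_zero hG
  | insert i S hi ih => rw [Finset.sum_insert hi, Finset.sum_insert hi]; exact (h i).add hG ih

/-- The Hodge operator intertwines wedging with θ and contraction by conj θ, up to sign. This builds
* one degree at a time. -/
theorem IsStar.wedge_one (hG : G.PosDef) (h : k + 1 + l = 2 * n) (θ : CForm n 1) {a : CForm n k}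
    {b : CForm n (l + 1)} (hab : IsStar G a b) :
    IsStar G (wedge (Nat.add_comm 1 k) θ a) ((-1 : ℂ) ^ k • ctr G (conjForm θ) b) := by
  intro c
  have h1 : formInner G c (wedge (Nat.add_comm 1 k) θ a) = formInner G (ctr G θ c) a := by
    rw [← formInner_conj_symm hG, formInner_mul_left hG θ a _ c (emb_wedge _ _ _), formInner_conj_symm hG]
  -- The degree is 2n + 1; contracting this zero by θ produces the identity.
  have h2 : emb c * emb (conjForm b) = 0 := emb_mul_eq_zero (by omega)
  have h3 := congrArg (ctrE G θ) h2
  rw [map_zero, ctrE_emb_mul, ctrE_emb, ctrE_emb, hab, ← h1] at h3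
  rw [eq_neg_of_add_eq_zero_left h3, conjForm_smul, ← ctr_conj, conjForm_conjForm, map_smul, mul_smul_comm,
    pow_succ]
  simp

/-- Induction on the degree: * of a function f is f ω_n, the Euler expansion writes a form as a sum
of wedges with the dz_j and dz̄_j, and the preceding lemma handles each of them. Existence and
uniqueness are both needed, because `hodge` is defined by a choice. -/
theorem exists_isStar (hG : G.PosDef) (h : k + l = 2 * n) (a : CForm n k) :
    ∃ b : CForm n l, IsStar G a b := by
  induction k generalizing l with
  | zero =>
    obtain rfl : l = 2 * n := by omega
    refine ⟨a ![] • omegaPow G n, fun c => ?_⟩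
    rw [conjForm_smul, conjForm_omegaPow hG, map_smul, emb_zero_degree, mul_smul_comm,
      ← Algebra.smul_def, smul_smul]
    congr 1
    simp only [formInner_def]
    simp
    rw [mul_comm]
    congr! 3
  | succ k ih =>
    choose B hB using fun (θ : CForm n 1) (a : CForm n k) =>
      (ih (l := l + 1) (by omega) a).imp fun b hb => hb.wedge_one hG h θ
    have hk1 : ((k : ℂ) + 1) ≠ 0 := by exact_mod_cast k.succ_ne_zero
    have h2 : a = ((k : ℂ) + 1)⁻¹ • ∑ j, (wedge (Nat.add_comm 1 k) (dz j) (curD j a) +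
        wedge (Nat.add_comm 1 k) (conjForm (dz j)) (curDb j a)) := by
      rw [← emb_inj, map_smul, map_sum]
      simp_rw [map_add, emb_wedge]
      rw [← emb_expand, smul_smul, inv_mul_cancel₀ hk1, one_smul]
    rw [h2]
    exact ⟨_, (IsStar.sum hG _ fun j => (hB (dz j) (curD j a)).add hG (hB _ (curDb j a))).smul hG _⟩

/-- If d = *b, then b ∧ conj d = |b|² ω_n. The left side is, up to sign, the conjugate of d ∧ conj
b, which vanishes by hypothesis. -/
theorem eq_zero_of_mul_conj (hG : G.PosDef) (h : k + l = 2 * n) {b : CForm n l}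
    (hb : ∀ c : CForm n k, emb c * emb (conjForm b) = 0) : b = 0 := by
  obtain ⟨d, hd⟩ := exists_isStar hG (k := l) (l := k) (by omega) b
  have h1 := hd b
  have h2 : emb b * emb (conjForm d) = 0 := by
    have h3 := congrArg conjForm (emb_inj.mp ((emb_wedge h d (conjForm b)).trans ((hb d).trans (map_zero emb).symm)))
    rw [conjForm_wedge, conjForm_conjForm, conjForm_zero, ← emb_inj, emb_wedge, map_zero] at h3
    rw [emb_mul_comm, h3, smul_zero]
  rw [h2] at h1
  have h4 := (smul_eq_zero.mp h1.symm).resolve_right (wp_ne_zero hG)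
  rw [formInner_self hG] at h4
  exact eq_zero_of_normSqF_eq_zero hG (by exact_mod_cast h4)

theorem IsStar.unique (hG : G.PosDef) (h : k + l = 2 * n) {a : CForm n k} {b b' : CForm n l}
    (hb : IsStar G a b) (hb' : IsStar G a b') : b = b' := by
  rw [← sub_eq_zero]
  refine eq_zero_of_mul_conj hG h fun c => ?_
  rw [sub_eq_add_neg, conjForm_add, conjForm_neg, map_add, map_neg, mul_add, mul_neg, hb c, hb' c]
  simp

theorem isStar_iff (h : k + l = 2 * n) {a : CForm n k} {b : CForm n l} :
    IsStar G a b ↔ ∀ c : CForm n k, wedge h c (conjForm b) = formInner G c a • omegaPow G n := by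
  refine forall_congr' fun c => ?_
  rw [← emb_inj, emb_wedge, map_smul]
  rfl

theorem isStar_hodge (hG : G.PosDef) (h : k + l = 2 * n) (a : CForm n k) :
    IsStar G a (hodge G h a) := by
  rw [isStar_iff h]
  obtain ⟨b, hb⟩ := exists_isStar hG h a
  exact Classical.epsilon_spec (p := fun b : CForm n l =>
    ∀ c : CForm n k, wedge h c (conjForm b) = formInner G c a • omegaPow G n) ⟨b, (isStar_iff h).mp hb⟩

theorem IsStar.hodge_eq (hG : G.PosDef) (h : k + l = 2 * n) {a : CForm n k} {b : CForm n l}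
    (hb : IsStar G a b) : hodge G h a = b :=
  (isStar_hodge hG h a).unique hG h hb

theorem hodge_zero (hG : G.PosDef) (h : k + l = 2 * n) : hodge G h (0 : CForm n k) = 0 :=
  (isStar_zero hG).hodge_eq hG h

theorem pull_pull_mulC {ζ : ℂ} (hζ : ‖ζ‖ = 1) (c : CForm n k) :
    pull (mulC n ζ) (pull (mulC n ζ⁻¹) c) = c := by
  ext v
  have h0 := ne_zero_of_norm_one hζ
  simp [smul_smul, h0]

/-- The defining equation of * is invariant under unit rotations, so the claim follows from
uniqueness. In particular * of an (n,q)-form has degree and weight both n - q, hence type (n-q,0).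
-/
theorem IsStar.hasWeight (hG : G.PosDef) (h : k + l = 2 * n) {w : ℤ} {a : CForm n k} {b : CForm n l}
    (hb : IsStar G a b) (ha : HasWeight w a) : HasWeight w b := by
  intro ζ hζ
  have h1 : IsStar G (ζ ^ w • a) (pull (mulC n ζ) b) := by
    rw [isStar_iff h]
    intro c
    have hb' := (isStar_iff h).mp hb (pull (mulC n ζ⁻¹) c)
    have h2 : conjForm (pull (mulC n ζ) b) = pull (mulC n ζ) (conjForm b) := rfl
    rw [h2, ← pull_pull_mulC hζ c, wedge_pull, hb', ← ha ζ hζ, formInner_pull_mulC hG hζ]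
    have h3 := hasWeight_omegaPow (G := G) n ζ hζ
    rw [zpow_zero, one_smul] at h3
    conv_rhs => rw [← h3]
    rfl
  exact h1.unique hG h (hb.smul hG _)

/-! ### Identities for forms of type `(p, 0)` -/

theorem cI_mul_conj (p : ℕ) : cI p * conj (cI p) = 1 := by rw [mul_comm, conj_cI_mul]

/-- If `* u = γ` is of type `(p,0)` then `u = i^{p²} γ ∧ ω_q`. -/
theorem IsStar.emb_eq (hG : G.PosDef) {p q : ℕ} (hpq : p + q = n) {u : CForm n (n + q)} {γ : CForm n p}
    (hγ : HasWeight p γ) (h : IsStar G u γ) : emb u = cI p • (emb γ * wp G q) := by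
  let a : CForm n (n + q) := wedge (by omega) γ (omegaPow G q)
  have ha : emb a = emb γ * wp G q := emb_wedge _ _ _
  have h1 : u = cI p • a := by
    refine eq_of_formInner_eq hG fun c => ?_
    rw [← wp_smul_inj hG, ← h c, formInner_smul_right hG, mul_smul,
      inner_primitive hG hγ (t := 0) (by omega) (by omega) c a ha, smul_smul, conj_cI_mul, one_smul,
      wp_zero, mul_one]
  rw [h1, map_smul, ha]

/-- The pairing formula with t = 1 and t = 0 shows that Λ(γ∧ω_{q+1}) = γ∧ω_q. The usual factor n - p
- q is 1 here. -/
theorem emb_lambdaOp (hG : G.PosDef) {p q : ℕ} (hpq : p + (q + 1) = n) {u : CForm n m} {γ : CForm n p}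
    (hm : m = n + (q + 1)) (hγ : HasWeight p γ) (hu : emb u = cI p • (emb γ * wp G (q + 1)))
    (h : 2 + k = m) : emb (lambdaOp G h u) = cI p • (emb γ * wp G q) := by
  let a : CForm n k := wedge (by omega) γ (omegaPow G q)
  have ha : emb a = emb γ * wp G q := emb_wedge _ _ _
  let a' : CForm n m := wedge (by omega) γ (omegaPow G (q + 1))
  have ha' : emb a' = emb γ * wp G (q + 1) := emb_wedge _ _ _
  have hu' : u = cI p • a' := by rw [← emb_inj, hu, map_smul, ha']
  have h0 : wp G 1 = emb (omega G) := by
    have := wp_succ (G := G) 0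
    simpa [wp_zero] using this
  have h1 : ∀ c : CForm n k, formInner G (cI p • a) c = formInner G u (wedge h (omega G) c) := by
    intro c
    rw [← formInner_conj_symm hG c, ← formInner_conj_symm hG (wedge h (omega G) c)]
    congr 1
    rw [hu', formInner_smul_right hG, formInner_smul_right hG]
    congr 1
    rw [← wp_smul_inj hG, inner_primitive hG hγ (t := 1) (by omega) (by omega) c a ha,
      inner_primitive hG hγ (t := 0) (by omega) (by omega) _ a' ha', emb_wedge, wp_zero, mul_one, h0,
      ← emb_wedge rfl c, ← omega_mul_comm, emb_wedge, mul_assoc]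
  have h2 := Classical.epsilon_spec (p := fun b : CForm n k =>
    ∀ c : CForm n k, formInner G b c = formInner G u (wedge h (omega G) c)) ⟨_, h1⟩
  have h3 : lambdaOp G h u = cI p • a := by
    refine eq_of_formInner_eq hG fun c => ?_
    rw [← formInner_conj_symm hG, ← formInner_conj_symm hG (cI p • a)]
    congr 1
    exact (h2 c).trans (h1 c).symm
  rw [h3, map_smul, ha]

/-- When p + s = n, wedging with ω_s preserves inner products with (p,0)-forms: the pairing formula
gives the same top form on both sides. -/
theorem formInner_primitive_eq (hG : G.PosDef) {p s t : ℕ} (h : p + s + t = n) {γ : CForm n p}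
    (hγ : HasWeight p γ) {x : CForm n p} {y b : CForm n k} (hk : k = p + 2 * s)
    (hy : emb y = emb x * wp G s) (hb : emb b = emb γ * wp G s) (ht : t = 0) :
    formInner G y b = formInner G x γ := by
  subst ht
  rw [← wp_smul_inj hG, inner_primitive hG hγ h hk y b hb,
    inner_primitive hG hγ (s := 0) (t := s) (by omega) rfl x γ (by rw [wp_zero, mul_one]), hy, wp_zero,
    mul_one, mul_assoc, wp_mul_comm, ← mul_assoc]

/-- `* δ` for `δ` of type `(p + 1, 0)`. -/
theorem hodge_primitive (hG : G.PosDef) {p q : ℕ} (hpq : p + 1 + q = n) {δ : CForm n (p + 1)}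
    (hδ : HasWeight (p + 1 : ℕ) δ) (h : p + 1 + l = 2 * n) :
    emb (hodge G h δ) = (-Complex.I * cI p) • (emb δ * wp G q) := by
  let a : CForm n l := wedge (by omega) δ (omegaPow G q)
  have ha : emb a = emb δ * wp G q := emb_wedge _ _ _
  have h1 : IsStar G δ ((-Complex.I * cI p) • a) := by
    intro c
    rw [inner_primitive hG hδ (s := 0) (t := q) (by omega) rfl c δ (by rw [wp_zero, mul_one]),
      conjForm_smul, conjForm_wedge, conjForm_omegaPow hG, map_smul, emb_wedge, mul_smul_comm, cI_succ,
      mul_assoc]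
    congr 1
    rw [map_mul, conj_cI]
    simp
    ring
    rw [mul_assoc]; rfl
  rw [h1.hodge_eq hG h, map_smul, ha]

/-- The inner product with a form of type `(p, 1)`. -/
theorem inner_type_one (hG : G.PosDef) {p q : ℕ} (hpq : p + (q + 1) = n) (g : Fin n → CForm n p)
    (hg : ∀ j, HasWeight p (g j)) {η c : CForm n (p + 1)} {η' c' : CForm n m} (hm : m = n + (q + 1) + 1)
    (hη : emb η = ∑ j, emb (conjForm (dz j)) * emb (g j)) (hη' : emb η' = emb η * wp G (q + 1))
    (hc' : emb c' = emb c * wp G (q + 1)) :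
    formInner G c' η' • wp G n = formInner G c η • wp G n +
      cI (p + 1) • (emb c * emb (conjForm η) * wp G q) := by
  let e : Fin n → CForm n (p + 1) := fun j => wedge (Nat.add_comm 1 p) (conjForm (dz j)) (g j)
  have he : ∀ j, emb (e j) = emb (conjForm (dz j)) * emb (g j) := fun j => emb_wedge _ _ _
  subst hm
  let gw : Fin n → CForm n (n + (q + 1)) := fun j => wedge (by omega) (g j) (omegaPow G (q + 1))
  have hgw : ∀ j, emb (gw j) = emb (g j) * wp G (q + 1) := fun j => emb_wedge _ _ _
  let e' : Fin n → CForm n (n + (q + 1) + 1) := fun j =>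
    wedge (Nat.add_comm 1 _) (conjForm (dz j)) (gw j)
  have he' : ∀ j, emb (e' j) = emb (conjForm (dz j)) * emb (gw j) := fun j => emb_wedge _ _ _
  have h1 : η = ∑ j, e j := by
    rw [← emb_inj, map_sum, hη]; exact Finset.sum_congr rfl fun j _ => (he j).symm
  have h2 : η' = ∑ j, e' j := by
    rw [← emb_inj, map_sum, hη', hη, Finset.sum_mul]
    exact Finset.sum_congr rfl fun j _ => by rw [he', hgw, mul_assoc]
  rw [h1, h2, formInner_sum_right hG, formInner_sum_right hG, Finset.sum_smul, Finset.sum_smul,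
    conjForm_sum, map_sum, Finset.mul_sum, Finset.sum_mul, Finset.smul_sum, ← Finset.sum_add_distrib]
  refine Finset.sum_congr rfl fun j _ => ?_
  -- Moving dz̄_j to the other side reduces both inner products to (p,0)-forms. Contracting c ∧
  -- ω_{q+1} gives one term reproducing ⟨c,η⟩ and one with -i dz_j ∧ ω_q, which is the correction.
  have h3 : formInner G c (e j) = formInner G (ctr G (conjForm (dz j)) c) (g j) := by
    rw [← formInner_conj_symm hG, formInner_mul_left hG _ (g j) _ c (he j), formInner_conj_symm hG]
  have h4 : formInner G c' (e' j) = formInner G (ctr G (conjForm (dz j)) c') (gw j) := by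
    rw [← formInner_conj_symm hG, formInner_mul_left hG _ (gw j) _ c' (he' j), formInner_conj_symm hG]
  rw [h3, h4, inner_primitive hG (hg j) (s := 0) (t := q + 1) (by omega) rfl _ (g j)
    (by rw [wp_zero, mul_one]), inner_primitive hG (hg j) (t := 0) (by omega) (by omega) _ (gw j) (hgw j),
    ← ctrE_emb, hc', ctrE_emb_mul, ctrE_emb, ctrE_wp, ctr_omega_of_weight_neg_one hG (hasWeight_dzBar j),
    conjForm_conjForm, wp_zero, mul_one, add_mul, smul_add, conjForm_wedge, conjForm_conjForm, emb_wedge,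
    map_smul]
  congr 1
  · rw [mul_assoc, mul_assoc, wp_mul_comm]
  · have h5 : wp G q * emb (dz j) * emb (conjForm (g j)) =
        emb (dz j) * emb (conjForm (g j)) * wp G q := by
      rw [wp_mul_comm, mul_assoc, wp_mul_comm, mul_assoc]
    rw [cI_succ, mul_smul_comm, mul_smul_comm, smul_smul, smul_mul_assoc, smul_smul, mul_assoc, h5,
      ← mul_assoc (emb c)]
    congr 1
    rw [pow_succ]
    ring

end DbarForms

end

section

namespace DbarForms

open scoped ComplexOrder MatrixOrder

variable {n k l m : ℕ} {G : Matrix (Fin n) (Fin n) ℂ}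

/-! ### Differential calculus of forms -/

section Partial

variable {V W Y : Type*} [NormedAddCommGroup V] [NormedSpace ℝ V]
  [NormedAddCommGroup W] [NormedSpace ℝ W] [NormedAddCommGroup Y] [NormedSpace ℝ Y]

theorem fderiv_bilin (B : V →L[ℝ] W →L[ℝ] Y) {a : Cn n → V} {b : Cn n → W} {z : Cn n}
    (ha : DifferentiableAt ℝ a z) (hb : DifferentiableAt ℝ b z) (v : Cn n) :
    fderiv ℝ (fun w => B (a w) (b w)) z v = B (fderiv ℝ a z v) (b z) + B (a z) (fderiv ℝ b z v) := by
  have h : HasFDerivAt (fun w => B (a w) (b w)) _ z :=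
    (B.hasFDerivAt.comp z ha.hasFDerivAt).clm_apply hb.hasFDerivAt
  rw [h.fderiv]
  simp [add_comm]

theorem fderiv_linear (B : V →L[ℝ] W) {a : Cn n → V} {z : Cn n} (ha : DifferentiableAt ℝ a z) (v : Cn n) :
    fderiv ℝ (fun w => B (a w)) z v = B (fderiv ℝ a z v) := by
  have h : HasFDerivAt (fun w => B (a w)) _ z := B.hasFDerivAt.comp z ha.hasFDerivAt
  rw [h.fderiv]
  simp

theorem differentiableAt_of_contDiffOn {U : Set (Cn n)} (hU : IsOpen U) {a : Cn n → V}
    (ha : ContDiffOn ℝ ∞ a U) {z : Cn n} (hz : z ∈ U) : DifferentiableAt ℝ a z :=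
  (ha.contDiffAt (hU.mem_nhds hz)).differentiableAt (by simp)

variable [NormedSpace ℂ V] [NormedSpace ℂ W] [NormedSpace ℂ Y]

/-- The operator `∂/∂z_j`. -/
noncomputable def pd (j : Fin n) (a : Cn n → V) (z : Cn n) : V :=
  (1 / 2 : ℂ) • (fderiv ℝ a z (realBasis (j, 0)) - Complex.I • fderiv ℝ a z (realBasis (j, 1)))

/-- The operator `∂/∂z̄_j`. -/
noncomputable def pdb (j : Fin n) (a : Cn n → V) (z : Cn n) : V :=
  (1 / 2 : ℂ) • (fderiv ℝ a z (realBasis (j, 0)) + Complex.I • fderiv ℝ a z (realBasis (j, 1)))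

theorem pd_bilin (B : V →L[ℝ] W →L[ℝ] Y) (hl : ∀ (c : ℂ) x y, B (c • x) y = c • B x y)
    (hr : ∀ (c : ℂ) x y, B x (c • y) = c • B x y) {a : Cn n → V} {b : Cn n → W} {z : Cn n}
    (ha : DifferentiableAt ℝ a z) (hb : DifferentiableAt ℝ b z) (j : Fin n) :
    pd j (fun w => B (a w) (b w)) z = B (pd j a z) (b z) + B (a z) (pd j b z) := by
  rw [pd, pd, pd, fderiv_bilin B ha hb, fderiv_bilin B ha hb]
  simp [hl, hr, smul_sub, smul_add]
  abel

theorem pdb_bilin (B : V →L[ℝ] W →L[ℝ] Y) (hl : ∀ (c : ℂ) x y, B (c • x) y = c • B x y)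
    (hr : ∀ (c : ℂ) x y, B x (c • y) = c • B x y) {a : Cn n → V} {b : Cn n → W} {z : Cn n}
    (ha : DifferentiableAt ℝ a z) (hb : DifferentiableAt ℝ b z) (j : Fin n) :
    pdb j (fun w => B (a w) (b w)) z = B (pdb j a z) (b z) + B (a z) (pdb j b z) := by
  rw [pdb, pdb, pdb, fderiv_bilin B ha hb, fderiv_bilin B ha hb]
  simp [hl, hr, smul_add]
  abel

theorem pd_linear (B : V →L[ℝ] W) (hl : ∀ (c : ℂ) x, B (c • x) = c • B x) {a : Cn n → V} {z : Cn n}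
    (ha : DifferentiableAt ℝ a z) (j : Fin n) : pd j (fun w => B (a w)) z = B (pd j a z) := by
  rw [pd, pd, fderiv_linear B ha, fderiv_linear B ha]
  simp [hl]

theorem pdb_linear (B : V →L[ℝ] W) (hl : ∀ (c : ℂ) x, B (c • x) = c • B x) {a : Cn n → V} {z : Cn n}
    (ha : DifferentiableAt ℝ a z) (j : Fin n) : pdb j (fun w => B (a w)) z = B (pdb j a z) := by
  rw [pdb, pdb, fderiv_linear B ha, fderiv_linear B ha]
  simp [hl]

/-- Conjugation exchanges ∂/∂z_j and ∂/∂z̄_j, so statements about ∂̄ can be deduced from those about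
∂. -/
theorem pd_conjLinear (B : V →L[ℝ] W) (hl : ∀ (c : ℂ) x, B (c • x) = conj c • B x) {a : Cn n → V}
    {z : Cn n} (ha : DifferentiableAt ℝ a z) (j : Fin n) :
    pd j (fun w => B (a w)) z = B (pdb j a z) := by
  rw [pd, pdb, fderiv_linear B ha, fderiv_linear B ha]
  have h2 : conj (1 / 2 : ℂ) = 1 / 2 := by simp [map_ofNat]
  rw [hl, h2, map_add, hl, Complex.conj_I, neg_smul, sub_eq_add_neg]

theorem pd_sum {ι : Type*} (S : Finset ι) {a : ι → Cn n → V} {z : Cn n}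
    (ha : ∀ i ∈ S, DifferentiableAt ℝ (a i) z) (j : Fin n) :
    pd j (fun w => ∑ i ∈ S, a i w) z = ∑ i ∈ S, pd j (a i) z := by
  simp only [pd]
  rw [fderiv_fun_sum ha, sum_apply, sum_apply, Finset.smul_sum,
    ← Finset.sum_sub_distrib, Finset.smul_sum]

theorem pdb_sum {ι : Type*} (S : Finset ι) {a : ι → Cn n → V} {z : Cn n}
    (ha : ∀ i ∈ S, DifferentiableAt ℝ (a i) z) (j : Fin n) :
    pdb j (fun w => ∑ i ∈ S, a i w) z = ∑ i ∈ S, pdb j (a i) z := by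
  simp only [pdb]
  rw [fderiv_fun_sum ha, sum_apply, sum_apply, Finset.smul_sum,
    ← Finset.sum_add_distrib, Finset.smul_sum]

variable [IsScalarTower ℝ ℂ V]

theorem contDiffOn_pd {U : Set (Cn n)} (hU : IsOpen U) {a : Cn n → V} (ha : ContDiffOn ℝ ∞ a U)
    (j : Fin n) : ContDiffOn ℝ ∞ (pd j a) U := by
  have h := ha.fderiv_of_isOpen hU (m := ∞) (by simp)
  have h1 : ∀ v, ContDiffOn ℝ ∞ (fun z => fderiv ℝ a z v) U := fun v => h.clm_apply contDiffOn_const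
  exact ((h1 _).sub ((h1 _).const_smul Complex.I)).const_smul (1 / 2 : ℂ)

theorem contDiffOn_pdb {U : Set (Cn n)} (hU : IsOpen U) {a : Cn n → V} (ha : ContDiffOn ℝ ∞ a U)
    (j : Fin n) : ContDiffOn ℝ ∞ (pdb j a) U := by
  have h := ha.fderiv_of_isOpen hU (m := ∞) (by simp)
  have h1 : ∀ v, ContDiffOn ℝ ∞ (fun z => fderiv ℝ a z v) U := fun v => h.clm_apply contDiffOn_const
  exact ((h1 _).add ((h1 _).const_smul Complex.I)).const_smul (1 / 2 : ℂ)

/-- `∂/∂z_i` and `∂/∂z̄_j` commute. -/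
theorem pd_pdb_comm {U : Set (Cn n)} (hU : IsOpen U) {a : Cn n → V} (ha : ContDiffOn ℝ ∞ a U)
    {z : Cn n} (hz : z ∈ U) (i j : Fin n) : pd i (pdb j a) z = pdb j (pd i a) z := by
  have h := ha.fderiv_of_isOpen hU (m := ∞) (by simp)
  have hd := (h.contDiffAt (hU.mem_nhds hz)).differentiableAt (by simp)
  have hs : ∀ v w, fderiv ℝ (fderiv ℝ a) z v w = fderiv ℝ (fderiv ℝ a) z w v :=
    (ha.contDiffAt (hU.mem_nhds hz)).isSymmSndFDerivAt (by simpa using ENat.LEInfty.out)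
  let L (c : ℂ) (j : Fin n) : (Cn n →L[ℝ] V) →L[ℝ] V :=
    (1 / 2 : ℂ) • (ContinuousLinearMap.apply ℝ V (realBasis (j, 0)) +
      c • ContinuousLinearMap.apply ℝ V (realBasis (j, 1)))
  have hL : ∀ c j A, L c j A = (1 / 2 : ℂ) • (A (realBasis (j, 0)) + c • A (realBasis (j, 1))) :=
    fun _ _ _ => rfl
  have e1 : pdb j a = fun w => L Complex.I j (fderiv ℝ a w) := rfl
  have e2 : pd i a = fun w => L (-Complex.I) i (fderiv ℝ a w) := by
    funext w; rw [hL, pd, neg_smul, sub_eq_add_neg]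
  rw [e1, e2, pd, pdb]
  simp only [fderiv_linear _ hd]
  simp only [hL]
  rw [hs (realBasis (j, 0)) (realBasis (i, 0)), hs (realBasis (j, 0)) (realBasis (i, 1)),
    hs (realBasis (j, 1)) (realBasis (i, 0)), hs (realBasis (j, 1)) (realBasis (i, 1))]
  module

end Partial

end DbarForms

end

section

namespace DbarForms

open scoped ComplexOrder MatrixOrder

variable {n k l m : ℕ} {G : Matrix (Fin n) (Fin n) ℂ}

/-! ### The operators `∂` and `∂̄` -/

theorem wedge_add_left (h : k + l = m) (a a' : CForm n k) (b : CForm n l) :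
    wedge h (a + a') b = wedge h a b + wedge h a' b := by
  rw [← emb_inj]; simp only [emb_wedge, map_add, add_mul]

theorem wedge_add_right (h : k + l = m) (a : CForm n k) (b b' : CForm n l) :
    wedge h a (b + b') = wedge h a b + wedge h a b' := by
  rw [← emb_inj]; simp only [emb_wedge, map_add, mul_add]

theorem wedge_smul_left (h : k + l = m) (c : ℂ) (a : CForm n k) (b : CForm n l) :
    wedge h (c • a) b = c • wedge h a b := by
  rw [← emb_inj]; simp only [emb_wedge, map_smul, smul_mul_assoc]

theorem wedge_smul_right (h : k + l = m) (c : ℂ) (a : CForm n k) (b : CForm n l) :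
    wedge h a (c • b) = c • wedge h a b := by
  rw [← emb_inj]; simp only [emb_wedge, map_smul, mul_smul_comm]

theorem real_smul_form (c : ℝ) (a : CForm n k) : c • a = (c : ℂ) • a := by
  ext v; simp

/-- The wedge product as a continuous bilinear map. -/
noncomputable def wedgeL (h : k + l = m) : CForm n k →L[ℝ] CForm n l →L[ℝ] CForm n m :=
  (LinearMap.mk₂ ℝ (wedge h) (wedge_add_left h)
    (fun c a b => by rw [real_smul_form, wedge_smul_left, ← real_smul_form]) (wedge_add_right h)
    (fun c a b => by rw [real_smul_form, wedge_smul_right, ← real_smul_form])).toContinuousBilinearMap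

@[simp] theorem wedgeL_apply (h : k + l = m) (a : CForm n k) (b : CForm n l) :
    wedgeL h a b = wedge h a b := rfl

/-- Conjugation as a continuous real-linear map. -/
noncomputable def conjL : CForm n k →L[ℝ] CForm n k :=
  LinearMap.toContinuousLinearMap
    { toFun := conjForm
      map_add' := conjForm_add
      map_smul' := fun c a => by rw [real_smul_form, conjForm_smul, Complex.conj_ofReal, ← real_smul_form]; rfl }

@[simp] theorem conjL_apply (a : CForm n k) : conjL a = conjForm a := rfl

/-- `zeroForm` as a continuous real-linear map. -/
noncomputable def zeroFormL : ℂ →L[ℝ] CForm n 0 :=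
  LinearMap.toContinuousLinearMap
    { toFun := zeroForm
      map_add' := fun _ _ => rfl
      map_smul' := fun _ _ => rfl }

@[simp] theorem zeroFormL_apply (c : ℂ) : (zeroFormL c : CForm n 0) = zeroForm c := rfl

section Smooth

variable {U : Set (Cn n)}

theorem contDiffOn_bilin {V W Y : Type*} [NormedAddCommGroup V] [NormedSpace ℝ V]
    [NormedAddCommGroup W] [NormedSpace ℝ W] [NormedAddCommGroup Y] [NormedSpace ℝ Y]
    (B : V →L[ℝ] W →L[ℝ] Y) {a : Cn n → V} {b : Cn n → W}
    (ha : ContDiffOn ℝ ∞ a U) (hb : ContDiffOn ℝ ∞ b U) : ContDiffOn ℝ ∞ (fun w => B (a w) (b w)) U := by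
  have h1 : ContDiffOn ℝ ∞ (fun w => B (a w)) U := B.contDiff.comp_contDiffOn ha
  exact h1.clm_apply hb

theorem contDiffOn_wedge (h : k + l = m) {a : Cn n → CForm n k} {b : Cn n → CForm n l}
    (ha : ContDiffOn ℝ ∞ a U) (hb : ContDiffOn ℝ ∞ b U) :
    ContDiffOn ℝ ∞ (fun w => wedge h (a w) (b w)) U := by
  exact contDiffOn_bilin (wedgeL h) ha hb

theorem contDiffOn_conjForm {a : Cn n → CForm n k} (ha : ContDiffOn ℝ ∞ a U) :
    ContDiffOn ℝ ∞ (fun w => conjForm (a w)) U := conjL.contDiff.comp_contDiffOn ha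

theorem contDiffOn_zeroForm {f : Cn n → ℂ} (hf : ContDiffOn ℝ ∞ f U) :
    ContDiffOn ℝ ∞ (fun w => (zeroForm (f w) : CForm n 0)) U := zeroFormL.contDiff.comp_contDiffOn hf

theorem contDiffOn_sum {V : Type*} [NormedAddCommGroup V] [NormedSpace ℝ V] {ι : Type*} (S : Finset ι)
    {a : ι → Cn n → V} (ha : ∀ i ∈ S, ContDiffOn ℝ ∞ (a i) U) :
    ContDiffOn ℝ ∞ (fun w => ∑ i ∈ S, a i w) U := ContDiffOn.sum ha

theorem contDiffOn_smul {f : Cn n → ℂ} {a : Cn n → CForm n k} (hf : ContDiffOn ℝ ∞ f U)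
    (ha : ContDiffOn ℝ ∞ a U) : ContDiffOn ℝ ∞ (fun w => f w • a w) U := hf.smul ha

end Smooth

theorem emb_del (a : Cn n → CForm n k) (z : Cn n) :
    emb (del a z) = ∑ j, emb (dz j) * emb (pd j a z) := by
  rw [del, emb_alternatizeUncurryFin, Fintype.sum_prod_type]
  refine Finset.sum_congr rfl fun j _ => ?_
  have h1 : mulI n (realBasis (j, 0)) = realBasis (j, 1) := I_smul_realBasis j
  have h2 : mulI n (realBasis (j, 1)) = -realBasis (j, 0) := by
    rw [← h1]
    change Complex.I • Complex.I • (realBasis (j, 0) : Cn n) = _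
    rw [smul_smul, Complex.I_mul_I, neg_one_smul]
  rw [Fin.sum_univ_two, emb_dz, pd]
  simp only [smul_apply, sub_apply, ContinuousLinearMap.comp_apply,
    h1, h2, map_neg, map_smul, map_sub, mul_smul_comm, add_mul, mul_sub, smul_mul_assoc, mul_neg]
  match_scalars <;> ring_nf <;> simp [Complex.I_sq] <;> norm_num

theorem emb_dbar (a : Cn n → CForm n k) (z : Cn n) :
    emb (dbar a z) = ∑ j, emb (conjForm (dz j)) * emb (pdb j a z) := by
  rw [dbar, emb_alternatizeUncurryFin, Fintype.sum_prod_type]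
  refine Finset.sum_congr rfl fun j _ => ?_
  have h1 : mulI n (realBasis (j, 0)) = realBasis (j, 1) := I_smul_realBasis j
  have h2 : mulI n (realBasis (j, 1)) = -realBasis (j, 0) := by
    rw [← h1]
    change Complex.I • Complex.I • (realBasis (j, 0) : Cn n) = _
    rw [smul_smul, Complex.I_mul_I, neg_one_smul]
  rw [Fin.sum_univ_two, emb_dzBar, pdb]
  simp only [smul_apply, add_apply, ContinuousLinearMap.comp_apply,
    h1, h2, map_neg, map_smul, map_add, mul_smul_comm, sub_mul, mul_add, smul_mul_assoc, mul_neg]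
  match_scalars <;> ring_nf <;> simp [Complex.I_sq] <;> norm_num

theorem del_eq_sum (a : Cn n → CForm n k) (z : Cn n) :
    del a z = ∑ j, wedge (Nat.add_comm 1 k) (dz j) (pd j a z) := by
  rw [← emb_inj, emb_del, map_sum]
  exact Finset.sum_congr rfl fun j _ => (emb_wedge _ _ _).symm

theorem dbar_eq_sum (a : Cn n → CForm n k) (z : Cn n) :
    dbar a z = ∑ j, wedge (Nat.add_comm 1 k) (conjForm (dz j)) (pdb j a z) := by
  rw [← emb_inj, emb_dbar, map_sum]
  exact Finset.sum_congr rfl fun j _ => (emb_wedge _ _ _).symm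

theorem del_congr {a b : Cn n → CForm n k} {z : Cn n} (h : a =ᶠ[𝓝 z] b) : del a z = del b z := by
  rw [del, del, h.fderiv_eq]

theorem dbar_congr {a b : Cn n → CForm n k} {z : Cn n} (h : a =ᶠ[𝓝 z] b) : dbar a z = dbar b z := by
  rw [dbar, dbar, h.fderiv_eq]

theorem del_zero (z : Cn n) : del (fun _ => (0 : CForm n k)) z = 0 := by
  rw [← emb_inj, emb_del]
  simp [pd]

theorem contDiffOn_del {U : Set (Cn n)} (hU : IsOpen U) {a : Cn n → CForm n k}
    (ha : ContDiffOn ℝ ∞ a U) : ContDiffOn ℝ ∞ (del a) U := by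
  rw [show del a = _ from funext (del_eq_sum a)]
  exact contDiffOn_sum _ fun j _ => contDiffOn_wedge _ contDiffOn_const (contDiffOn_pd hU ha j)

theorem contDiffOn_dbar {U : Set (Cn n)} (hU : IsOpen U) {a : Cn n → CForm n k}
    (ha : ContDiffOn ℝ ∞ a U) : ContDiffOn ℝ ∞ (dbar a) U := by
  rw [show dbar a = _ from funext (dbar_eq_sum a)]
  exact contDiffOn_sum _ fun j _ => contDiffOn_wedge _ contDiffOn_const (contDiffOn_pdb hU ha j)

theorem conjForm_del {a : Cn n → CForm n k} {z : Cn n} (ha : DifferentiableAt ℝ a z) :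
    conjForm (del a z) = dbar (fun w => conjForm (a w)) z := by
  have h1 : DifferentiableAt ℝ (fun w => conjForm (a w)) z := conjL.differentiableAt.comp z ha
  rw [del_eq_sum, dbar_eq_sum, conjForm_sum]
  refine Finset.sum_congr rfl fun j _ => ?_
  have := pd_conjLinear conjL (fun c x => conjForm_smul c x) h1 j
  simp only [conjL_apply, conjForm_conjForm] at this
  rw [conjForm_wedge, this, conjForm_conjForm]

theorem conjForm_dbar {a : Cn n → CForm n k} {z : Cn n} (ha : DifferentiableAt ℝ a z) :
    conjForm (dbar a z) = del (fun w => conjForm (a w)) z := by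
  have h1 : DifferentiableAt ℝ (fun w => conjForm (a w)) z := conjL.differentiableAt.comp z ha
  have := conjForm_del h1
  simp only [conjForm_conjForm] at this
  rw [← this, conjForm_conjForm]

/-! ### The graded Leibniz rules for ∂ and ∂̄. -/

section Leibniz

variable {z : Cn n}

theorem emb_del_wedge (h : k + l = m) {a : Cn n → CForm n k} {b : Cn n → CForm n l}
    (ha : DifferentiableAt ℝ a z) (hb : DifferentiableAt ℝ b z) :
    emb (del (fun w => wedge h (a w) (b w)) z) =
      emb (del a z) * emb (b z) + (-1 : ℂ) ^ k • (emb (a z) * emb (del b z)) := by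
  have h1 : ∀ j, pd j (fun w => wedge h (a w) (b w)) z =
      wedge h (pd j a z) (b z) + wedge h (a z) (pd j b z) :=
    pd_bilin (wedgeL h) (wedge_smul_left h) (fun c a b => wedge_smul_right h c a b) ha hb
  simp only [emb_del, h1, map_add, emb_wedge, mul_add, Finset.sum_add_distrib, Finset.sum_mul,
    Finset.mul_sum, Finset.smul_sum, mul_assoc]
  congr 1
  refine Finset.sum_congr rfl fun j _ => ?_
  rw [← mul_assoc, ← mul_assoc, emb_mul_comm, one_mul, smul_mul_assoc]

theorem emb_dbar_wedge (h : k + l = m) {a : Cn n → CForm n k} {b : Cn n → CForm n l}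
    (ha : DifferentiableAt ℝ a z) (hb : DifferentiableAt ℝ b z) :
    emb (dbar (fun w => wedge h (a w) (b w)) z) =
      emb (dbar a z) * emb (b z) + (-1 : ℂ) ^ k • (emb (a z) * emb (dbar b z)) := by
  have h1 : ∀ j, pdb j (fun w => wedge h (a w) (b w)) z =
      wedge h (pdb j a z) (b z) + wedge h (a z) (pdb j b z) :=
    pdb_bilin (wedgeL h) (wedge_smul_left h) (fun c a b => wedge_smul_right h c a b) ha hb
  simp only [emb_dbar, h1, map_add, emb_wedge, mul_add, Finset.sum_add_distrib, Finset.sum_mul,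
    Finset.mul_sum, Finset.smul_sum, mul_assoc]
  congr 1
  refine Finset.sum_congr rfl fun j _ => ?_
  rw [← mul_assoc, ← mul_assoc, emb_mul_comm, one_mul, smul_mul_assoc]

theorem smul_eq_wedge (c : ℂ) (a : CForm n k) : c • a = wedge (Nat.zero_add k) (zeroForm c) a := by
  rw [← emb_inj, emb_wedge, emb_zeroForm, map_smul, Algebra.smul_def]

theorem emb_del_smul {f : Cn n → ℂ} {a : Cn n → CForm n k} (hf : DifferentiableAt ℝ f z)
    (ha : DifferentiableAt ℝ a z) : emb (del (fun w => f w • a w) z) =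
      emb (del (fun w => zeroForm (f w)) z) * emb (a z) + f z • emb (del a z) := by
  have h1 : DifferentiableAt ℝ (fun w => (zeroForm (f w) : CForm n 0)) z :=
    zeroFormL.differentiableAt.comp z hf
  simp_rw [smul_eq_wedge]
  rw [emb_del_wedge _ h1 ha, pow_zero, one_smul, emb_zeroForm, ← Algebra.smul_def]

theorem del_const_smul (c : ℂ) {a : Cn n → CForm n k} (ha : DifferentiableAt ℝ a z) :
    del (fun w => c • a w) z = c • del a z := by
  simp only [del_eq_sum, Finset.smul_sum]
  refine Finset.sum_congr rfl fun j _ => ?_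
  rw [← wedge_smul_right]
  congr 1
  exact pd_linear ((c • ContinuousLinearMap.id ℝ (CForm n k))) (fun d x => smul_comm c d x) ha j

theorem dbar_const_smul (c : ℂ) {a : Cn n → CForm n k} (ha : DifferentiableAt ℝ a z) :
    dbar (fun w => c • a w) z = c • dbar a z := by
  simp only [dbar_eq_sum, Finset.smul_sum]
  refine Finset.sum_congr rfl fun j _ => ?_
  rw [← wedge_smul_right]
  congr 1
  exact pdb_linear ((c • ContinuousLinearMap.id ℝ (CForm n k))) (fun d x => smul_comm c d x) ha j

theorem del_sum {ι : Type*} (S : Finset ι) {a : ι → Cn n → CForm n k}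
    (ha : ∀ i ∈ S, DifferentiableAt ℝ (a i) z) :
    del (fun w => ∑ i ∈ S, a i w) z = ∑ i ∈ S, del (a i) z := by
  rw [← emb_inj, map_sum]
  simp only [emb_del, pd_sum S ha, map_sum, Finset.mul_sum]
  exact Finset.sum_comm

theorem dbar_sum {ι : Type*} (S : Finset ι) {a : ι → Cn n → CForm n k}
    (ha : ∀ i ∈ S, DifferentiableAt ℝ (a i) z) :
    dbar (fun w => ∑ i ∈ S, a i w) z = ∑ i ∈ S, dbar (a i) z := by
  rw [← emb_inj, map_sum]
  simp only [emb_dbar, pdb_sum S ha, map_sum, Finset.mul_sum]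
  exact Finset.sum_comm

theorem del_add {a b : Cn n → CForm n k} (ha : DifferentiableAt ℝ a z) (hb : DifferentiableAt ℝ b z) :
    del (fun w => a w + b w) z = del a z + del b z := by
  have := del_sum (z := z) Finset.univ (a := ![a, b]) (by
    intro i _; fin_cases i <;> simpa)
  simpa [Fin.sum_univ_two] using this

theorem dbar_add {a b : Cn n → CForm n k} (ha : DifferentiableAt ℝ a z) (hb : DifferentiableAt ℝ b z) :
    dbar (fun w => a w + b w) z = dbar a z + dbar b z := by
  have := dbar_sum (z := z) Finset.univ (a := ![a, b]) (by
    intro i _; fin_cases i <;> simpa)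
  simpa [Fin.sum_univ_two] using this

end Leibniz

/-- The coefficient derivatives commute, while dz_j and dz̄_i anticommute. -/
theorem dbar_del_add_del_dbar {U : Set (Cn n)} (hU : IsOpen U) {a : Cn n → CForm n k}
    (ha : ContDiffOn ℝ ∞ a U) {z : Cn n} (hz : z ∈ U) : dbar (del a) z = -del (dbar a) z := by
  have h1 : ∀ i j, pdb i (fun w => wedge (Nat.add_comm 1 k) (dz j) (pd j a w)) z =
      wedge (Nat.add_comm 1 k) (dz j) (pdb i (pd j a) z) := fun i j =>
    pdb_linear (wedgeL _ (dz j)) (fun c a => wedge_smul_right _ c _ a)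
      (differentiableAt_of_contDiffOn hU (contDiffOn_pd hU ha j) hz) i
  have h2 : ∀ i j, pd i (fun w => wedge (Nat.add_comm 1 k) (conjForm (dz j)) (pdb j a w)) z =
      wedge (Nat.add_comm 1 k) (conjForm (dz j)) (pd i (pdb j a) z) := fun i j =>
    pd_linear (wedgeL _ (conjForm (dz j))) (fun c a => wedge_smul_right _ c _ a)
      (differentiableAt_of_contDiffOn hU (contDiffOn_pdb hU ha j) hz) i
  have e1 : del a = fun w => ∑ j, wedge (Nat.add_comm 1 k) (dz j) (pd j a w) := funext (del_eq_sum a)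
  have e2 : dbar a = fun w => ∑ j, wedge (Nat.add_comm 1 k) (conjForm (dz j)) (pdb j a w) :=
    funext (dbar_eq_sum a)
  have d1 : ∀ j ∈ Finset.univ, DifferentiableAt ℝ
      (fun w => wedge (Nat.add_comm 1 k) (dz j) (pd j a w)) z := fun j _ =>
    differentiableAt_of_contDiffOn hU (contDiffOn_wedge _ contDiffOn_const (contDiffOn_pd hU ha j)) hz
  have d2 : ∀ j ∈ Finset.univ, DifferentiableAt ℝ
      (fun w => wedge (Nat.add_comm 1 k) (conjForm (dz j)) (pdb j a w)) z := fun j _ =>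
    differentiableAt_of_contDiffOn hU (contDiffOn_wedge _ contDiffOn_const (contDiffOn_pdb hU ha j)) hz
  rw [e1, e2, dbar_sum _ d1, del_sum _ d2, ← emb_inj, map_neg, map_sum, map_sum]
  simp_rw [emb_dbar, emb_del, h1, h2, emb_wedge]
  rw [Finset.sum_comm, ← Finset.sum_neg_distrib]
  refine Finset.sum_congr rfl fun j _ => ?_
  rw [← Finset.sum_neg_distrib]
  refine Finset.sum_congr rfl fun i _ => ?_
  rw [pd_pdb_comm hU ha hz, ← mul_assoc, ← mul_assoc, emb_mul_comm]
  simp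

/-! ### Weights of derivatives -/

/-- Rotating the arguments of a form, with the base point fixed, is a constant linear map and
commutes with differentiation. -/
theorem HasWeight.fderiv {w : ℤ} {a : Cn n → CForm n k} {z : Cn n}
    (ha : DifferentiableAt ℝ a z) (h : ∀ᶠ x in 𝓝 z, HasWeight w (a x)) (v : Cn n) :
    HasWeight w (fderiv ℝ a z v) := by
  intro ζ hζ
  let L : CForm n k →L[ℝ] CForm n k := LinearMap.toContinuousLinearMap
    { toFun := pull (mulC n ζ)
      map_add' := fun _ _ => rfl
      map_smul' := fun _ _ => rfl }
  have h1 := fderiv_linear L ha v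
  have h2 := fderiv_linear (ζ ^ w • ContinuousLinearMap.id ℝ (CForm n k)) ha v
  have h3 : (fun x => L (a x)) =ᶠ[𝓝 z] fun x => (ζ ^ w • ContinuousLinearMap.id ℝ (CForm n k)) (a x) :=
    h.mono fun x hx => hx ζ hζ
  rw [h3.fderiv_eq, h2] at h1
  exact h1.symm

theorem HasWeight.neg {w : ℤ} {a : CForm n k} (h : HasWeight w a) : HasWeight w (-a) := by
  have := h.smul (-1)
  rwa [show (-1 : ℂ) • a = -a by ext v; simp] at this

theorem HasWeight.sub {w : ℤ} {a b : CForm n k} (h : HasWeight w a) (h' : HasWeight w b) :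
    HasWeight w (a - b) := by
  rw [sub_eq_add_neg]; exact h.add h'.neg

theorem HasWeight.pd {w : ℤ} {a : Cn n → CForm n k} {z : Cn n}
    (ha : DifferentiableAt ℝ a z) (h : ∀ᶠ x in 𝓝 z, HasWeight w (a x)) (j : Fin n) :
    HasWeight w (pd j a z) :=
  HasWeight.smul (.sub (.fderiv ha h _) (.smul (.fderiv ha h _) _)) _

theorem HasWeight.pdb {w : ℤ} {a : Cn n → CForm n k} {z : Cn n}
    (ha : DifferentiableAt ℝ a z) (h : ∀ᶠ x in 𝓝 z, HasWeight w (a x)) (j : Fin n) :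
    HasWeight w (pdb j a z) :=
  HasWeight.smul (.add (.fderiv ha h _) (.smul (.fderiv ha h _) _)) _

theorem HasWeight.del {w : ℤ} {a : Cn n → CForm n k} {z : Cn n}
    (ha : DifferentiableAt ℝ a z) (h : ∀ᶠ x in 𝓝 z, HasWeight w (a x)) :
    HasWeight (w + 1) (del a z) := by
  rw [del_eq_sum, add_comm w]
  exact .sum fun j _ => (hasWeight_dz j).wedgeForm (.pd ha h j) _

theorem HasWeight.dbar {w : ℤ} {a : Cn n → CForm n k} {z : Cn n}
    (ha : DifferentiableAt ℝ a z) (h : ∀ᶠ x in 𝓝 z, HasWeight w (a x)) :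
    HasWeight (w - 1) (dbar a z) := by
  rw [dbar_eq_sum, sub_eq_neg_add w]
  exact .sum fun j _ => (hasWeight_dzBar j).wedgeForm (.pdb ha h j) _

end DbarForms

end

section

namespace DbarForms

open scoped ComplexOrder MatrixOrder

variable {n r k l m : ℕ} {G : Matrix (Fin n) (Fin n) ℂ} {U : Set (Cn n)}

/-! ### The Chern connection -/

/-- A smooth family of positive definite matrices on `U`. -/
structure IsMetricOn {ι : Type*} (U : Set (Cn n)) (M : Cn n → Matrix ι ι ℂ) : Prop where
  smooth : ∀ i j, ContDiffOn ℝ ∞ (fun z => M z i j) U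
  posDef : ∀ z ∈ U, (M z).PosDef

section Inverse

variable {K : Type*} [NormedField K] [NormedAlgebra ℝ K] {ι : Type*} [Fintype ι] [DecidableEq ι]

theorem contDiffOn_det {M : Cn n → Matrix ι ι K} (h : ∀ i j, ContDiffOn ℝ ∞ (fun z => M z i j) U) :
    ContDiffOn ℝ ∞ (fun z => (M z).det) U := by
  simp_rw [Matrix.det_apply]
  refine contDiffOn_sum _ fun σ _ => ?_
  have h1 : ContDiffOn ℝ ∞ (fun z => ∏ i, M z (σ i) i) U := contDiffOn_prod fun i _ => h _ _
  rcases Int.units_eq_one_or (Equiv.Perm.sign σ) with hs | hs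
  · simpa [hs] using h1
  · simpa [hs] using h1.neg

theorem contDiffOn_inv_apply {M : Cn n → Matrix ι ι K} (h : ∀ i j, ContDiffOn ℝ ∞ (fun z => M z i j) U)
    (hM : ∀ z ∈ U, (M z).det ≠ 0) (i j : ι) : ContDiffOn ℝ ∞ (fun z => (M z)⁻¹ i j) U := by
  have h1 : ∀ z, (M z)⁻¹ i j = ((M z).det)⁻¹ * ((M z).updateRow j (Pi.single i 1)).det := by
    intro z
    rw [Matrix.inv_def, Matrix.smul_apply, Matrix.adjugate_apply, Ring.inverse_eq_inv', smul_eq_mul]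
  rw [show (fun z => (M z)⁻¹ i j) = _ from funext h1]
  refine ((contDiffOn_det h).inv hM).mul (contDiffOn_det fun a b => ?_)
  by_cases ha : a = j
  · subst ha
    simpa using contDiffOn_const
  · simpa [ha] using h a b

end Inverse

theorem IsMetricOn.det_ne_zero {ι : Type*} [Fintype ι] [DecidableEq ι] {M : Cn n → Matrix ι ι ℂ}
    (h : IsMetricOn U M) {z : Cn n} (hz : z ∈ U) : (M z).det ≠ 0 :=
  ((Matrix.isUnit_iff_isUnit_det _).mp (h.posDef z hz).isUnit).ne_zero

/-- The sesquilinear pairing `∑ H_{αβ} a^α ∧ conj b^β`, as a form. -/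
noncomputable def brF (h : k + l = m) (M : Matrix (Fin r) (Fin r) ℂ) (a : Fin r → CForm n k)
    (b : Fin r → CForm n l) : CForm n m :=
  ∑ α, ∑ β, M α β • wedge h (a α) (conjForm (b β))

/-- The sesquilinear pairing `∑ H_{αβ} a^α ∧ conj b^β`. -/
noncomputable def br (M : Matrix (Fin r) (Fin r) ℂ) (a : Fin r → CForm n k) (b : Fin r → CForm n l) : Ext n :=
  ∑ α, ∑ β, M α β • (emb (a α) * emb (conjForm (b β)))

theorem emb_brF (h : k + l = m) (M : Matrix (Fin r) (Fin r) ℂ) (a : Fin r → CForm n k)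
    (b : Fin r → CForm n l) : emb (brF h M a b) = br M a b := by
  simp only [brF, br, map_sum, map_smul, emb_wedge]

theorem conjForm_brF (h : k + l = m) (h' : l + k = m) {M : Matrix (Fin r) (Fin r) ℂ} (hM : M.IsHermitian)
    (a : Fin r → CForm n k) (b : Fin r → CForm n l) :
    conjForm (brF h M a b) = (-1 : ℂ) ^ (k * l) • brF h' M b a := by
  simp only [brF, conjForm_sum, conjForm_smul, conjForm_wedge, conjForm_conjForm, Finset.smul_sum]
  rw [Finset.sum_comm]
  refine Finset.sum_congr rfl fun β _ => Finset.sum_congr rfl fun α _ => ?_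
  have h1 : conj (M α β) = M β α := by
    conv_rhs => rw [← hM]
    rfl
  rw [h1, smul_comm, ← emb_inj]
  simp only [map_smul, emb_wedge]
  rw [emb_mul_comm]

theorem contDiffOn_brF (h : k + l = m) {H : Cn n → Matrix (Fin r) (Fin r) ℂ} (hH : IsMetricOn U H)
    {a : Fin r → Cn n → CForm n k} {b : Fin r → Cn n → CForm n l} (ha : ∀ α, ContDiffOn ℝ ∞ (a α) U)
    (hb : ∀ α, ContDiffOn ℝ ∞ (b α) U) :
    ContDiffOn ℝ ∞ (fun w => brF h (H w) (fun α => a α w) (fun α => b α w)) U :=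
  contDiffOn_sum _ fun α _ => contDiffOn_sum _ fun β _ => contDiffOn_smul (hH.smooth α β)
    (contDiffOn_wedge h (ha α) (contDiffOn_conjForm (hb β)))

theorem emb_dPrime (H : Cn n → Matrix (Fin r) (Fin r) ℂ) (u : Fin r → Cn n → CForm n k) (α : Fin r)
    (z : Cn n) : emb (dPrime H u α z) =
      emb (del (u α) z) + ∑ l, emb (conn H l α z) * emb (u l z) := by
  simp only [dPrime, map_add, map_sum, emb_wedge]

/-- Lowering the index of the connection matrix with H cancels H⁻¹ and leaves ∂H. -/
theorem sum_conn {H : Cn n → Matrix (Fin r) (Fin r) ℂ} {z : Cn n} (hH : (H z).det ≠ 0) (l β : Fin r) :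
    ∑ α, H z α β • emb (conn H l α z) = emb (del (fun w => (zeroForm (H w l β) : CForm n 0)) z) := by
  have h1 := Matrix.nonsing_inv_mul (H z) (isUnit_iff_ne_zero.mpr hH)
  have h2 : ∀ β', ∑ α, (H z)⁻¹ β' α * H z α β = if β' = β then 1 else 0 := fun β' => by
    rw [← Matrix.mul_apply, h1, Matrix.one_apply]
  simp only [conn, map_sum, map_smul, Finset.smul_sum, smul_smul]
  rw [Finset.sum_comm]
  simp_rw [← Finset.sum_smul, mul_comm (H z _ β)]
  refine (Finset.sum_congr rfl fun β' _ => congrArg (· • _) (h2 β')).trans ?_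
  simp

variable {H : Cn n → Matrix (Fin r) (Fin r) ℂ}

theorem contDiffOn_conn (hU : IsOpen U) (hH : IsMetricOn U H) (l α : Fin r) :
    ContDiffOn ℝ ∞ (conn H l α) U :=
  contDiffOn_sum _ fun β _ => contDiffOn_smul
    (contDiffOn_inv_apply hH.smooth (fun _ hz => hH.det_ne_zero hz) β α)
    (contDiffOn_del hU (contDiffOn_zeroForm (hH.smooth l β)))

theorem contDiffOn_dPrime (hU : IsOpen U) (hH : IsMetricOn U H) {u : Fin r → Cn n → CForm n k}
    (hu : ∀ α, ContDiffOn ℝ ∞ (u α) U) (α : Fin r) : ContDiffOn ℝ ∞ (dPrime H u α) U :=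
  (contDiffOn_del hU (hu α)).add (contDiffOn_sum _ fun l _ =>
    contDiffOn_wedge _ (contDiffOn_conn hU hH l α) (hu l))

theorem dPrime_congr {u v : Fin r → Cn n → CForm n k} {z : Cn n} (h : ∀ α, u α =ᶠ[𝓝 z] v α) (α : Fin r) :
    dPrime H u α z = dPrime H v α z := by
  rw [dPrime, dPrime, del_congr (h α)]
  congr 1
  exact Finset.sum_congr rfl fun l _ => by rw [(h l).eq_of_nhds]

theorem hasWeight_conn (hU : IsOpen U) (hH : IsMetricOn U H) {z : Cn n} (hz : z ∈ U) (l α : Fin r) :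
    HasWeight 1 (conn H l α z) :=
  .sum fun β _ => .smul (HasWeight.del (w := 0)
    (differentiableAt_of_contDiffOn hU (contDiffOn_zeroForm (hH.smooth l β)) hz)
    (.of_forall fun _ => hasWeight_zeroDegree _)) _

theorem hasWeight_dPrime (hU : IsOpen U) (hH : IsMetricOn U H) {u : Fin r → Cn n → CForm n k}
    (hu : ∀ α, ContDiffOn ℝ ∞ (u α) U) {w : ℤ} (hw : ∀ α, ∀ z ∈ U, HasWeight w (u α z)) {z : Cn n}
    (hz : z ∈ U) (α : Fin r) : HasWeight (w + 1) (dPrime H u α z) := by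
  refine .add (.del (differentiableAt_of_contDiffOn hU (hu α) hz)
    (Filter.eventually_of_mem (hU.mem_nhds hz) (hw α))) (.sum fun l _ => ?_)
  rw [add_comm w]
  exact (hasWeight_conn hU hH hz l α).wedgeForm (hw l z hz) _

/-- Metric compatibility of the Chern connection: the derivative falling on H supplies the
connection terms of D'. -/
theorem emb_del_brF (hU : IsOpen U) (hH : IsMetricOn U H) (h : k + l = m)
    {a : Fin r → Cn n → CForm n k} {b : Fin r → Cn n → CForm n l} (ha : ∀ α, ContDiffOn ℝ ∞ (a α) U)
    (hb : ∀ α, ContDiffOn ℝ ∞ (b α) U) {z : Cn n} (hz : z ∈ U) :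
    emb (del (fun w => brF h (H w) (fun α => a α w) (fun α => b α w)) z) =
      br (H z) (fun α => dPrime H a α z) (fun α => b α z) +
        (-1 : ℂ) ^ k • br (H z) (fun α => a α z) (fun α => dbar (b α) z) := by
  have hda : ∀ α, DifferentiableAt ℝ (a α) z := fun α => differentiableAt_of_contDiffOn hU (ha α) hz
  have hdb : ∀ α, DifferentiableAt ℝ (b α) z := fun α => differentiableAt_of_contDiffOn hU (hb α) hz
  have hdc : ∀ α, DifferentiableAt ℝ (fun w => conjForm (b α w)) z := fun α =>
    differentiableAt_of_contDiffOn hU (contDiffOn_conjForm (hb α)) hz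
  have hdH : ∀ α β, DifferentiableAt ℝ (fun w => H w α β) z := fun α β =>
    differentiableAt_of_contDiffOn hU (hH.smooth α β) hz
  have hw : ∀ α β, ContDiffOn ℝ ∞ (fun w => wedge h (a α w) (conjForm (b β w))) U := fun α β =>
    contDiffOn_wedge h (ha α) (contDiffOn_conjForm (hb β))
  have hdw : ∀ α β, DifferentiableAt ℝ (fun w => wedge h (a α w) (conjForm (b β w))) z := fun α β =>
    differentiableAt_of_contDiffOn hU (hw α β) hz
  have hdHw : ∀ α β, DifferentiableAt ℝ (fun w => H w α β • wedge h (a α w) (conjForm (b β w))) z :=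
    fun α β => differentiableAt_of_contDiffOn hU (contDiffOn_smul (hH.smooth α β) (hw α β)) hz
  have hds : ∀ α, DifferentiableAt ℝ (fun w => ∑ β, H w α β • wedge h (a α w) (conjForm (b β w))) z :=
    fun α => differentiableAt_of_contDiffOn hU
      (contDiffOn_sum _ fun β _ => contDiffOn_smul (hH.smooth α β) (hw α β)) hz
  have e1 : emb (del (fun w => brF h (H w) (fun α => a α w) (fun α => b α w)) z) =
      ∑ α, ∑ β, (emb (del (fun w => zeroForm (H w α β)) z) * (emb (a α z) * emb (conjForm (b β z))) +
        H z α β • (emb (del (a α) z) * emb (conjForm (b β z)) +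
          (-1 : ℂ) ^ k • (emb (a α z) * emb (conjForm (dbar (b β) z))))) := by
    simp only [brF]
    rw [del_sum _ fun α _ => hds α, map_sum]
    refine Finset.sum_congr rfl fun α _ => ?_
    rw [del_sum _ fun β _ => hdHw α β, map_sum]
    refine Finset.sum_congr rfl fun β _ => ?_
    rw [emb_del_smul (hdH α β) (hdw α β), emb_wedge, emb_del_wedge h (hda α) (hdc β), conjForm_dbar (hdb β)]
  have e2 : br (H z) (fun α => dPrime H a α z) (fun α => b α z) =
      ∑ α, ∑ β, (emb (del (fun w => (zeroForm (H w α β) : CForm n 0)) z) *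
          (emb (a α z) * emb (conjForm (b β z))) +
        H z α β • (emb (del (a α) z) * emb (conjForm (b β z)))) := by
    have e3 : ∀ l β, emb (del (fun w => (zeroForm (H w l β) : CForm n 0)) z) *
        (emb (a l z) * emb (conjForm (b β z))) =
        ∑ α, H z α β • (emb (conn H l α z) * emb (a l z) * emb (conjForm (b β z))) := by
      intro l β
      rw [← sum_conn (hH.det_ne_zero hz), Finset.sum_mul]
      exact Finset.sum_congr rfl fun α _ => by rw [smul_mul_assoc, mul_assoc]
    simp_rw [e3]
    simp only [br, emb_dPrime, add_mul, Finset.sum_mul, smul_add, Finset.smul_sum, Finset.sum_add_distrib]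
    rw [add_comm]
    congr 1
    rw [Finset.sum_comm]
    refine Eq.trans (Finset.sum_congr rfl fun β _ => Finset.sum_comm) ?_
    exact Finset.sum_comm
  rw [e1, e2]
  simp only [br, Finset.smul_sum, ← Finset.sum_add_distrib]
  refine Finset.sum_congr rfl fun α _ => Finset.sum_congr rfl fun β _ => ?_
  rw [smul_add, smul_comm (H z α β), add_assoc]

/-- The conjugate of the preceding rule, by Hermitian symmetry of the pairing; only the signs from
reordering the factors need care. -/
theorem emb_dbar_brF (hU : IsOpen U) (hH : IsMetricOn U H) (h : k + l = m)
    {a : Fin r → Cn n → CForm n k} {b : Fin r → Cn n → CForm n l} (ha : ∀ α, ContDiffOn ℝ ∞ (a α) U)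
    (hb : ∀ α, ContDiffOn ℝ ∞ (b α) U) {z : Cn n} (hz : z ∈ U) :
    emb (dbar (fun w => brF h (H w) (fun α => a α w) (fun α => b α w)) z) =
      br (H z) (fun α => dbar (a α) z) (fun α => b α z) +
        (-1 : ℂ) ^ k • br (H z) (fun α => a α z) (fun α => dPrime H b α z) := by
  have h' : l + k = m := by omega
  have hs := contDiffOn_brF h' hH hb ha
  have hd := differentiableAt_of_contDiffOn hU hs hz
  have e0 : ∀ {i j : ℕ} (hij : i + j = m + 1) (hji : j + i = m + 1) (x : Fin r → CForm n i)
      (y : Fin r → CForm n j), emb (conjForm (brF hij (H z) x y)) = (-1 : ℂ) ^ (i * j) • br (H z) y x := by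
    intro i j hij hji x y
    rw [conjForm_brF hij hji (hH.posDef z hz).isHermitian, map_smul, emb_brF]
  have e1 : (fun w => brF h (H w) (fun α => a α w) (fun α => b α w)) =ᶠ[𝓝 z]
      fun w => (-1 : ℂ) ^ (l * k) • conjForm (brF h' (H w) (fun α => b α w) (fun α => a α w)) := by
    refine Filter.eventually_of_mem (hU.mem_nhds hz) fun w hw => ?_
    dsimp only
    rw [conjForm_brF h' h (hH.posDef w hw).isHermitian, smul_smul, ← mul_pow]
    simp
  have e2 : del (fun w => brF h' (H w) (fun α => b α w) (fun α => a α w)) z =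
      brF (by omega) (H z) (fun α => dPrime H b α z) (fun α => a α z) +
        (-1 : ℂ) ^ l • brF (by omega) (H z) (fun α => b α z) (fun α => dbar (a α) z) := by
    rw [← emb_inj, emb_del_brF hU hH h' hb ha hz, map_add, map_smul, emb_brF, emb_brF]
  rw [dbar_congr e1, dbar_const_smul _ (differentiableAt_of_contDiffOn hU (contDiffOn_conjForm hs) hz),
    ← conjForm_del hd, e2, conjForm_add, conjForm_smul, map_smul, map_add, map_smul, e0 _ (by omega),
    e0 _ (by omega), add_comm, smul_add, smul_smul, smul_smul, smul_smul]
  congr 1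
  · have : (-1 : ℂ) ^ (l * k) * (conj ((-1 : ℂ) ^ l) * (-1) ^ (l * (k + 1))) = 1 := by
      rw [map_pow, map_neg, map_one, ← pow_add, ← pow_add]
      exact Even.neg_one_pow ⟨l * k + l, by ring⟩
    rw [mul_assoc, this, one_smul]
  · congr 1
    rw [← pow_add, show l * k + (l + 1) * k = 2 * (l * k) + k by ring, pow_add, pow_mul]
    simp

/-- `D'∂̄ + ∂̄D' = -iΘ`. -/
theorem emb_dPrime_dbar (hU : IsOpen U) (hH : IsMetricOn U H) {a : Fin r → Cn n → CForm n k}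
    (ha : ∀ α, ContDiffOn ℝ ∞ (a α) U) {z : Cn n} (hz : z ∈ U) (α : Fin r) :
    emb (dPrime H (fun β => dbar (a β)) α z) = -emb (dbar (dPrime H a α) z) -
      Complex.I • ∑ l, emb (curv H l α z) * emb (a l z) := by
  have hc := fun l => contDiffOn_conn hU hH l α
  have e1 : emb (dbar (dPrime H a α) z) = emb (dbar (del (a α)) z) +
      ∑ l, emb (dbar (fun w => wedge (Nat.add_comm 1 k) (conn H l α w) (a l w)) z) := by
    have hs : ∀ l, ContDiffOn ℝ ∞ (fun w => wedge (Nat.add_comm 1 k) (conn H l α w) (a l w)) U :=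
      fun l => contDiffOn_wedge _ (hc l) (ha l)
    rw [← map_sum, ← dbar_sum _ fun l _ => differentiableAt_of_contDiffOn hU (hs l) hz, ← map_add,
      ← dbar_add (differentiableAt_of_contDiffOn hU (contDiffOn_del hU (ha α)) hz)
        (differentiableAt_of_contDiffOn hU (contDiffOn_sum _ fun l _ => hs l) hz)]
    rfl
  have e2 : ∀ l, emb (dbar (fun w => wedge (Nat.add_comm 1 k) (conn H l α w) (a l w)) z) =
      -Complex.I • (emb (curv H l α z) * emb (a l z)) - emb (conn H l α z) * emb (dbar (a l) z) := by
    intro l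
    rw [emb_dbar_wedge _ (differentiableAt_of_contDiffOn hU (hc l) hz)
      (differentiableAt_of_contDiffOn hU (ha l) hz), curv, map_smul, smul_mul_assoc, smul_smul]
    simp [sub_eq_add_neg]
  rw [e1, emb_dPrime, dbar_del_add_del_dbar hU (ha α) hz, map_neg]
  simp_rw [e2]
  rw [Finset.sum_sub_distrib, ← Finset.smul_sum]
  module

end DbarForms

end

section

namespace DbarForms

open scoped ComplexOrder MatrixOrder

variable {n r k l m : ℕ} {U : Set (Cn n)} {G : Cn n → Matrix (Fin n) (Fin n) ℂ}

/-! ### Smoothness of the metric operators -/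

theorem contDiffOn_omega (hG : IsMetricOn U G) : ContDiffOn ℝ ∞ (fun z => omega (G z)) U :=
  contDiffOn_sum _ fun j _ => contDiffOn_sum _ fun k _ =>
    contDiffOn_smul (contDiffOn_const.mul (hG.smooth j k)) contDiffOn_const

theorem contDiffOn_omegaPow (hG : IsMetricOn U G) (s : ℕ) :
    ContDiffOn ℝ ∞ (fun z => omegaPow (G z) s) U := by
  induction s with
  | zero => exact contDiffOn_const
  | succ s ih => exact contDiffOn_smul contDiffOn_const (contDiffOn_wedge _ ih (contDiffOn_omega hG))

/-- Evaluation of a form on fixed vectors, as a continuous linear map. -/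
noncomputable def evalL (v : Fin k → Cn n) : CForm n k →L[ℝ] ℂ :=
  LinearMap.toContinuousLinearMap
    { toFun := fun a => a v
      map_add' := fun _ _ => rfl
      map_smul' := fun _ _ => rfl }

theorem contDiffOn_apply {a : Cn n → CForm n k} (ha : ContDiffOn ℝ ∞ a U) (v : Fin k → Cn n) :
    ContDiffOn ℝ ∞ (fun z => a z v) U := (evalL v).contDiff.comp_contDiffOn ha

theorem contDiffOn_conj {f : Cn n → ℂ} (hf : ContDiffOn ℝ ∞ f U) : ContDiffOn ℝ ∞ (fun z => conj (f z)) U :=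
  Complex.conjCLE.contDiff.comp_contDiffOn hf

theorem contDiffOn_ofReal {f : Cn n → ℝ} (hf : ContDiffOn ℝ ∞ f U) :
    ContDiffOn ℝ ∞ (fun z => (f z : ℂ)) U := Complex.ofRealCLM.contDiff.comp_contDiffOn hf

theorem contDiffOn_riemGram (hG : IsMetricOn U G) (s t : Idx n) :
    ContDiffOn ℝ ∞ (fun z => riemGram (G z) s t) U :=
  Complex.reCLM.contDiff.comp_contDiffOn (contDiffOn_sum _ fun j _ => contDiffOn_sum _ fun k _ =>
    ((hG.smooth j k).mul contDiffOn_const).mul contDiffOn_const)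

theorem contDiffOn_riemGram_inv (hG : IsMetricOn U G) (s t : Idx n) :
    ContDiffOn ℝ ∞ (fun z => (riemGram (G z))⁻¹ s t) U :=
  contDiffOn_inv_apply (contDiffOn_riemGram hG) (fun z hz =>
    ((Matrix.isUnit_iff_isUnit_det _).mp (riemGram_posDef (hG.posDef z hz)).isUnit).ne_zero) s t

theorem contDiffOn_formInner (hG : IsMetricOn U G) {a b : Cn n → CForm n k} (ha : ContDiffOn ℝ ∞ a U)
    (hb : ContDiffOn ℝ ∞ b U) : ContDiffOn ℝ ∞ (fun z => formInner (G z) (a z) (b z)) U :=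
  contDiffOn_const.mul (contDiffOn_sum _ fun s _ => contDiffOn_sum _ fun t _ =>
    (contDiffOn_ofReal (contDiffOn_prod fun l _ => contDiffOn_riemGram_inv hG (s l) (t l))).mul
      ((contDiffOn_apply ha _).mul (contDiffOn_conj (contDiffOn_apply hb _))))

/-- As `hodge` is chosen pointwise, smoothness needs a formula. Pairing with a fixed basis is an
injective linear map independent of the metric; a fixed left inverse recovers * from the smooth
right-hand side of its defining equation. -/
theorem contDiffOn_hodge (hG : IsMetricOn U G) (h : k + l = 2 * n) {a : Cn n → CForm n k}
    (ha : ContDiffOn ℝ ∞ a U) : ContDiffOn ℝ ∞ (fun z => hodge (G z) h (a z)) U := by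
  let c := Module.finBasis ℝ (CForm n k)
  let Ψ : CForm n l →ₗ[ℝ] (Fin (Module.finrank ℝ (CForm n k)) → CForm n (2 * n)) :=
    LinearMap.pi fun i => (wedgeL h (c i) ∘L conjL).toLinearMap
  have hΨ : ∀ b i, Ψ b i = wedge h (c i) (conjForm b) := fun _ _ => rfl
  have hinj : LinearMap.ker Ψ = ⊥ := by
    rw [LinearMap.ker_eq_bot']
    intro b hb
    -- Injectivity does not involve the metric, so the Euclidean one may be used.
    refine eq_zero_of_mul_conj (G := 1) Matrix.PosDef.one h fun d => ?_
    rw [← emb_wedge h, ← c.sum_repr d]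
    have : wedge h (∑ i, c.repr d i • c i) (conjForm b) = ∑ i, c.repr d i • Ψ b i := by
      change wedgeL h _ _ = _
      rw [map_sum, sum_apply]
      exact Finset.sum_congr rfl fun i _ => by rw [map_smul]; rfl
    rw [this, hb]
    simp
  obtain ⟨R, hR⟩ := Ψ.exists_leftInverse_of_injective hinj
  have h1 : ∀ z ∈ U, hodge (G z) h (a z) =
      LinearMap.toContinuousLinearMap R fun i => formInner (G z) (c i) (a z) • omegaPow (G z) n := by
    intro z hz
    have h2 := (isStar_iff h).mp (isStar_hodge (hG.posDef z hz) h (a z))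
    have h3 := LinearMap.congr_fun hR (hodge (G z) h (a z))
    rw [LinearMap.comp_apply, LinearMap.id_apply] at h3
    rw [← h3, LinearMap.coe_toContinuousLinearMap']
    congr 1
    funext i
    rw [hΨ, h2]
  refine ContDiffOn.congr ?_ h1
  refine (ContinuousLinearMap.contDiff _).comp_contDiffOn (contDiffOn_pi.mpr fun i => ?_)
  exact contDiffOn_smul (contDiffOn_formInner hG contDiffOn_const ha) (contDiffOn_omegaPow hG n)

end DbarForms

end

section

namespace DbarForms

open scoped ComplexOrder MatrixOrder

variable {n r k l m : ℕ} {U : Set (Cn n)} {G : Matrix (Fin n) (Fin n) ℂ}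

/-! ### Pairings of vector-valued forms at a point -/

/-- The inner product of vector-valued forms at a point. -/
noncomputable def vin (G : Matrix (Fin n) (Fin n) ℂ) (M : Matrix (Fin r) (Fin r) ℂ)
    (a b : Fin r → CForm n k) : ℂ := ∑ α, ∑ β, M α β * formInner G (a α) (b β)

variable {M : Matrix (Fin r) (Fin r) ℂ}

theorem br_add_left (a a' : Fin r → CForm n k) (b : Fin r → CForm n l) :
    br M (fun α => a α + a' α) b = br M a b + br M a' b := by
  simp only [br, map_add, add_mul, smul_add, Finset.sum_add_distrib]

theorem br_smul_left (c : ℂ) (a : Fin r → CForm n k) (b : Fin r → CForm n l) :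
    br M (fun α => c • a α) b = c • br M a b := by
  simp only [br, map_smul, smul_mul_assoc, Finset.smul_sum]
  exact Finset.sum_congr rfl fun α _ => Finset.sum_congr rfl fun β _ => smul_comm _ _ _

theorem br_wedge_left (h : k + l = m) {j : ℕ} (hj : Even l) (a : Fin r → CForm n k) (x : CForm n l)
    (b : Fin r → CForm n j) : br M (fun α => wedge h (a α) x) b = br M a b * emb x := by
  simp only [br, Finset.sum_mul, smul_mul_assoc, emb_wedge]
  refine Finset.sum_congr rfl fun α _ => Finset.sum_congr rfl fun β _ => ?_
  rw [mul_assoc, even_mul_comm hj, mul_assoc]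

theorem br_wedge_left_odd (h : k + l = m) {j : ℕ} (hj : Odd l) (a : Fin r → CForm n k) (x : CForm n l)
    (b : Fin r → CForm n j) : br M (fun α => wedge h (a α) x) b = (-1 : ℂ) ^ j • (br M a b * emb x) := by
  simp only [br, Finset.sum_mul, smul_mul_assoc, emb_wedge, Finset.smul_sum]
  refine Finset.sum_congr rfl fun α _ => Finset.sum_congr rfl fun β _ => ?_
  rw [mul_assoc, emb_mul_comm x, mul_smul_comm, mul_assoc, smul_comm, pow_mul, hj.neg_one_pow]

theorem br_congr {a : Fin r → CForm n k} {a' : Fin r → CForm n m} {b : Fin r → CForm n l}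
    (h : ∀ α, emb (a α) = emb (a' α)) : br M a b = br M a' b := by
  simp only [br, h]

theorem vin_smul_right (hG : G.PosDef) (c : ℂ) (a b : Fin r → CForm n k) :
    vin G M a (fun α => c • b α) = conj c * vin G M a b := by
  simp only [vin, Finset.mul_sum, formInner_smul_right hG]
  exact Finset.sum_congr rfl fun α _ => Finset.sum_congr rfl fun β _ => by ring

theorem vin_smul_left (c : ℂ) (a b : Fin r → CForm n k) :
    vin G M (fun α => c • a α) b = c * vin G M a b := by
  simp only [vin, Finset.mul_sum, formInner_smul_left]
  exact Finset.sum_congr rfl fun α _ => Finset.sum_congr rfl fun β _ => by ring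

theorem vin_primitive (hG : G.PosDef) {p s t : ℕ} {γ : Fin r → CForm n p} (hγ : ∀ α, HasWeight p (γ α))
    (hst : p + s + t = n) (hk : k = p + 2 * s) (a b : Fin r → CForm n k)
    (hb : ∀ α, emb (b α) = emb (γ α) * wp G s) :
    vin G M a b • wp G n = cI p • (br M a γ * wp G t) := by
  simp only [vin, br, Finset.sum_smul, Finset.sum_mul, Finset.smul_sum, smul_mul_assoc]
  refine Finset.sum_congr rfl fun α _ => Finset.sum_congr rfl fun β _ => ?_
  rw [mul_smul, inner_primitive hG (hγ β) hst hk (a α) (b β) (hb β), smul_comm]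

/-- The form η ∧ conj η ∧ ω_q has no fixed sign for η of type (p,1): it measures the difference of
|η∧ω_{q+1}|² and |η|². -/
theorem vin_type_one (hG : G.PosDef) {p q : ℕ} (hpq : p + (q + 1) = n) (g : Fin r → Fin n → CForm n p)
    (hg : ∀ α j, HasWeight p (g α j)) {η : Fin r → CForm n (p + 1)} {η' : Fin r → CForm n m}
    (hm : m = n + (q + 1) + 1) (hη : ∀ α, emb (η α) = ∑ j, emb (conjForm (dz j)) * emb (g α j))
    (hη' : ∀ α, emb (η' α) = emb (η α) * wp G (q + 1)) :
    cI (p + 1) • (br M η η * wp G q) = (vin G M η' η' - vin G M η η) • wp G n := by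
  simp only [vin, br, Finset.sum_smul, Finset.sum_mul, Finset.smul_sum, smul_mul_assoc, sub_smul,
    ← Finset.sum_sub_distrib]
  refine Finset.sum_congr rfl fun α _ => Finset.sum_congr rfl fun β _ => ?_
  rw [mul_smul, inner_type_one hG hpq (g β) (hg β) hm (hη β) (hη' β) (hη' α), mul_smul, smul_add,
    smul_comm (M α β) (cI (p + 1))]
  abel

/-- Since ω_n is real, conjugating an identity of top forms conjugates the coefficients. This yields
conjugate and torsion terms without recomputation. -/
theorem conj_top (hG : G.PosDef) {c d t : ℂ} {x : CForm n k} {y : CForm n l} {x' : CForm n k}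
    {y' : CForm n l} (h : k + l = 2 * n) (hx : conjForm x = d • x') (hy : conjForm y = y')
    (hxy : c • (emb x * emb y) = t • wp G n) :
    (conj c * d) • (emb x' * emb y') = conj t • wp G n := by
  have h1 : c • wedge h x y = t • omegaPow G n := by
    rw [← emb_inj, map_smul, map_smul, emb_wedge, hxy]; rfl
  have h2 := congrArg conjForm h1
  rw [conjForm_smul, conjForm_smul, conjForm_wedge, hx, hy, conjForm_omegaPow hG, ← emb_inj, map_smul,
    map_smul, emb_wedge, map_smul, smul_mul_assoc, smul_smul] at h2
  exact h2

theorem neg_one_pow_mul_self (p : ℕ) : ((-1 : ℂ) ^ p) * (-1) ^ p = 1 := by rw [← mul_pow]; simp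

/-! ### The form `T` -/

section Local

variable {p : ℕ} {γ : Fin r → Cn n → CForm n p}

/-- The form `i^{p²} ∑ H_{αβ} γ^α ∧ conj γ^β`. -/
noncomputable def tF (H : Cn n → Matrix (Fin r) (Fin r) ℂ) (γ : Fin r → Cn n → CForm n p) (w : Cn n) :
    CForm n (p + p) := cI p • brF rfl (H w) (fun α => γ α w) (fun α => γ α w)

theorem contDiffOn_tF {H : Cn n → Matrix (Fin r) (Fin r) ℂ} (hH : IsMetricOn U H)
    (hγ : ∀ α, ContDiffOn ℝ ∞ (γ α) U) : ContDiffOn ℝ ∞ (tF H γ) U :=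
  contDiffOn_smul contDiffOn_const (contDiffOn_brF rfl hH hγ hγ)

theorem conjForm_tF {H : Cn n → Matrix (Fin r) (Fin r) ℂ} (hH : IsMetricOn U H) {z : Cn n} (hz : z ∈ U) :
    conjForm (tF H γ z) = tF H γ z := by
  rw [tF, conjForm_smul, conjForm_brF rfl rfl (hH.posDef z hz).isHermitian, conj_cI, smul_smul]
  congr 1
  have : (-1 : ℂ) ^ (p * p) = (-1) ^ p := by
    rcases Nat.even_or_odd p with hp | hp
    · rw [(hp.mul_right p).neg_one_pow, hp.neg_one_pow]
    · rw [(hp.mul hp).neg_one_pow, hp.neg_one_pow]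
  rw [this, mul_right_comm, neg_one_pow_mul_self, one_mul]

variable {H : Cn n → Matrix (Fin r) (Fin r) ℂ}

theorem emb_del_tF (hU : IsOpen U) (hH : IsMetricOn U H) (hγ : ∀ α, ContDiffOn ℝ ∞ (γ α) U) {z : Cn n}
    (hz : z ∈ U) : emb (del (tF H γ) z) = cI p • (br (H z) (fun α => dPrime H γ α z) (fun α => γ α z) +
      (-1 : ℂ) ^ p • br (H z) (fun α => γ α z) (fun α => dbar (γ α) z)) := by
  rw [← emb_del_brF hU hH rfl hγ hγ hz, ← map_smul, ← del_const_smul]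
  · rfl
  · exact differentiableAt_of_contDiffOn hU (contDiffOn_brF rfl hH hγ hγ) hz

/-- `Θ ∧ γ`. -/
noncomputable def curvMul (H : Cn n → Matrix (Fin r) (Fin r) ℂ) (γ : Fin r → Cn n → CForm n p) (α : Fin r)
    (z : Cn n) : CForm n (p + 2) := ∑ l, wedge (Nat.add_comm 2 p) (curv H l α z) (γ l z)

theorem emb_curvMul (α : Fin r) (z : Cn n) :
    emb (curvMul H γ α z) = ∑ l, emb (curv H l α z) * emb (γ l z) := by
  simp only [curvMul, map_sum, emb_wedge]

/-- Two applications of the Leibniz rule. The only term in the wrong order is D'∂̄γ, which the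
curvature identity exchanges for -∂̄D'γ - iΘ∧γ. -/
theorem ddbar_tF (hU : IsOpen U) (hH : IsMetricOn U H) (hγ : ∀ α, ContDiffOn ℝ ∞ (γ α) U) {z : Cn n}
    (hz : z ∈ U) : Complex.I • emb (del (dbar (tF H γ)) z) =
      (-Complex.I * cI p) • br (H z) (fun α => dbar (dPrime H γ α) z) (fun α => γ α z) +
      (Complex.I * cI p) • br (H z) (fun α => γ α z) (fun α => dbar (dPrime H γ α) z) +
      cI p • br (H z) (fun α => curvMul H γ α z) (fun α => γ α z) +
      cI (p + 1) • (br (H z) (fun α => dPrime H γ α z) (fun α => dPrime H γ α z) -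
        br (H z) (fun α => dbar (γ α) z) (fun α => dbar (γ α) z)) := by
  have hη : ∀ α, ContDiffOn ℝ ∞ (dbar (γ α)) U := fun α => contDiffOn_dbar hU (hγ α)
  have hδ : ∀ α, ContDiffOn ℝ ∞ (dPrime H γ α) U := fun α => contDiffOn_dPrime hU hH hγ α
  let A : Cn n → CForm n (p + p + 1) := fun w =>
    brF (by omega) (H w) (fun α => dbar (γ α) w) (fun α => γ α w)
  let B : Cn n → CForm n (p + p + 1) := fun w =>
    brF (by omega) (H w) (fun α => γ α w) (fun α => dPrime H γ α w)
  have hA : ContDiffOn ℝ ∞ A U := contDiffOn_brF _ hH hη hγ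
  have hB : ContDiffOn ℝ ∞ B U := contDiffOn_brF _ hH hγ hδ
  have dA := differentiableAt_of_contDiffOn hU hA hz
  have dB := differentiableAt_of_contDiffOn hU hB hz
  have h1 : dbar (tF H γ) =ᶠ[𝓝 z] fun w => cI p • (A w + (-1 : ℂ) ^ p • B w) := by
    refine Filter.eventually_of_mem (hU.mem_nhds hz) fun w hw => ?_
    rw [← emb_inj, map_smul, map_add, map_smul, emb_brF, emb_brF, ← emb_dbar_brF hU hH rfl hγ hγ hw,
      ← map_smul, ← dbar_const_smul]
    · rfl
    · exact differentiableAt_of_contDiffOn hU (contDiffOn_brF rfl hH hγ hγ) hw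
  have dBs : DifferentiableAt ℝ (fun w => (-1 : ℂ) ^ p • B w) z :=
    differentiableAt_of_contDiffOn hU (contDiffOn_smul contDiffOn_const hB) hz
  have dAB : DifferentiableAt ℝ (fun w => A w + (-1 : ℂ) ^ p • B w) z := dA.add dBs
  rw [del_congr h1, del_const_smul _ dAB, del_add dA dBs, del_const_smul _ dB, map_smul, map_add, map_smul,
    emb_del_brF hU hH _ hη hγ hz, emb_del_brF hU hH _ hγ hδ hz]
  have h2 : br (H z) (fun α => dPrime H (fun β => dbar (γ β)) α z) (fun α => γ α z) =
      -br (H z) (fun α => dbar (dPrime H γ α) z) (fun α => γ α z) -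
        Complex.I • br (H z) (fun α => curvMul H γ α z) (fun α => γ α z) := by
    have : ∀ α, emb (dPrime H (fun β => dbar (γ β)) α z) =
        emb ((-1 : ℂ) • dbar (dPrime H γ α) z + (-Complex.I) • curvMul H γ α z) := by
      intro α
      rw [emb_dPrime_dbar hU hH hγ hz, map_add, map_smul, map_smul, emb_curvMul]
      module
    rw [br_congr this, br_add_left, br_smul_left, br_smul_left]
    module
  rw [h2, cI_succ]
  have h3 := neg_one_pow_mul_self p
  simp only [smul_add, smul_sub, smul_smul, smul_neg]
  have e1 : Complex.I * (cI p * Complex.I) = -cI p := by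
    linear_combination cI p * Complex.I_mul_I
  have e2 : Complex.I * (cI p * ((-1) ^ p * (-1) ^ p)) = Complex.I * cI p := by rw [h3, mul_one]
  rw [e1, e2, pow_succ]
  module

end Local

end DbarForms

end

section

namespace DbarForms

open scoped ComplexOrder MatrixOrder

variable {n r k l m : ℕ} {U : Set (Cn n)}

/-! ### The basic identity -/

/-- Wedging with conj γ computes the inner product with u, because γ = *u. -/
theorem vin_star {G : Matrix (Fin n) (Fin n) ℂ} {M : Matrix (Fin r) (Fin r) ℂ} (hG : G.PosDef) {p q : ℕ}
    {γ : Fin r → CForm n p} (hγ : ∀ α, HasWeight p (γ α)) (hpq : p + q = n) (hk : k = n + q)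
    (a u : Fin r → CForm n k) (hu : ∀ α, emb (u α) = cI p • (emb (γ α) * wp G q)) :
    vin G M a u • wp G n = br M a γ := by
  let b : Fin r → CForm n k := fun α => wedge (by omega) (γ α) (omegaPow G q)
  have hb : ∀ α, emb (b α) = emb (γ α) * wp G q := fun α => emb_wedge _ _ _
  have h1 : u = fun α => cI p • b α := by
    funext α
    rw [← emb_inj, hu, map_smul, hb]
  rw [h1, vin_smul_right hG, mul_smul, vin_primitive hG hγ (t := 0) (by omega) (by omega) a b hb, smul_smul,
    conj_cI_mul, one_smul, wp_zero, mul_one]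

theorem conjForm_neg_one_pow_brF {M : Matrix (Fin r) (Fin r) ℂ} (hM : M.IsHermitian) {p : ℕ}
    (h : p + 2 + p = m) (h' : p + (p + 2) = m) (a : Fin r → CForm n (p + 2)) (b : Fin r → CForm n p) :
    conjForm (brF h M a b) = (-1 : ℂ) ^ p • brF h' M b a := by
  rw [conjForm_brF h h' hM]
  congr 1
  rcases Nat.even_or_odd p with hp | hp
  · rw [(hp.mul_left _).neg_one_pow, hp.neg_one_pow]
  · rw [((hp.add_even even_two).mul hp).neg_one_pow, hp.neg_one_pow]

variable {p q : ℕ} {γ : Fin r → Cn n → CForm n p} {G : Cn n → Matrix (Fin n) (Fin n) ℂ}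
  {H : Cn n → Matrix (Fin r) (Fin r) ℂ}

/-- With `q + 1` in the role of the form degree q, `v`, `C` and `η'` stand for ∂̄∂̄*u, Θ∧Λu and,
when ∂̄ω_{q+1} = 0, ∂̄u up to a unit factor. `X` is the coefficient of the torsion term, present
because ∂̄∂̄*u contains D'γ ∧ ∂̄ω_q while i∂∂̄T ∧ ω_q does not. -/
theorem ddbar_tF_mul (hU : IsOpen U) (hG : IsMetricOn U G) (hH : IsMetricOn U H)
    (hγ : ∀ α, ContDiffOn ℝ ∞ (γ α) U) (hw : ∀ α, ∀ z ∈ U, HasWeight p (γ α z)) (hpq : p + (q + 1) = n)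
    {z : Cn n} (hz : z ∈ U) (hk : k = n + (q + 1)) {u v C : Fin r → CForm n k}
    (hu : ∀ α, emb (u α) = cI p • (emb (γ α z) * wp (G z) (q + 1)))
    (hv : ∀ α, emb (v α) = (Complex.I * cI p) • (emb (dbar (dPrime H γ α) z) * wp (G z) q +
      (-1 : ℂ) ^ (p + 1) • (emb (dPrime H γ α z) * emb (dbar (fun w => omegaPow (G w) q) z))))
    (hC : ∀ α, emb (C α) = cI p • (emb (curvMul H γ α z) * wp (G z) q))
    {η' : Fin r → CForm n m} (hm : m = n + (q + 1) + 1)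
    (hη' : ∀ α, emb (η' α) = emb (dbar (γ α) z) * wp (G z) (q + 1)) {X : ℂ}
    (hX : (Complex.I * cI p) • (br (H z) (fun α => dPrime H γ α z) (fun α => γ α z) *
      emb (dbar (fun w => omegaPow (G w) q) z)) = X • wp (G z) n) :
    (Complex.I • emb (del (dbar (tF H γ)) z)) * wp (G z) q =
      (-(vin (G z) (H z) v u + X) - conj (vin (G z) (H z) v u + X) + vin (G z) (H z) C u +
        vin (G z) (H z) (fun α => dPrime H γ α z) (fun α => dPrime H γ α z) +
        vin (G z) (H z) (fun α => dbar (γ α) z) (fun α => dbar (γ α) z) - vin (G z) (H z) η' η') •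
          wp (G z) n := by
  have hGz := hG.posDef z hz
  have hwz : ∀ α, HasWeight p (γ α z) := fun α => hw α z hz
  have hδw : ∀ α, HasWeight (p + 1 : ℕ) (dPrime H γ α z) := fun α => by
    exact_mod_cast hasWeight_dPrime hU hH hγ hw hz α
  -- the terms of second order
  have hκ : (Complex.I * cI p) • (br (H z) (fun α => dbar (dPrime H γ α) z) (fun α => γ α z) * wp (G z) q) =
      (vin (G z) (H z) v u + X) • wp (G z) n := by
    have h1 : ∀ α, emb (v α) = emb ((Complex.I * cI p) • ((wedge (m := k) (by omega) (dbar (dPrime H γ α) z)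
        (omegaPow (G z) q)) + (-1 : ℂ) ^ (p + 1) •
        (wedge (m := k) (by omega) (dPrime H γ α z) (dbar (fun w => omegaPow (G w) q) z)))) := fun α => by
      rw [hv, map_smul, map_add, map_smul, emb_wedge, emb_wedge]; rfl
    rw [add_smul, ← hX, vin_star hGz hwz hpq hk v u hu, br_congr h1, br_smul_left, br_add_left, br_smul_left,
      br_wedge_left _ (even_two_mul q), br_wedge_left_odd _ ⟨q, rfl⟩, smul_smul, ← pow_add,
      Odd.neg_one_pow ⟨p, by ring⟩, ← smul_add]
    rw [neg_one_smul, neg_add_cancel_right]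
    rfl
  -- This is the complex conjugate of the previous term, so together they contribute minus twice a
  -- real part.
  have hκ' : (Complex.I * cI p) • (br (H z) (fun α => γ α z) (fun α => dbar (dPrime H γ α) z) * wp (G z) q) =
      (-conj (vin (G z) (H z) v u + X)) • wp (G z) n := by
    have h1 := conj_top hGz (k := p + 2 + p) (l := 2 * q) (by omega) (conjForm_neg_one_pow_brF
      (hH.posDef z hz).isHermitian rfl (by omega) (fun α => dbar (dPrime H γ α) z) (fun α => γ α z))
      (conjForm_omegaPow hGz q) (by rw [emb_brF]; exact hκ)
    rw [emb_brF, map_mul, conj_cI, Complex.conj_I] at h1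
    rw [neg_smul, ← h1, ← neg_smul]
    congr 1
    linear_combination (-Complex.I * cI p) * neg_one_pow_mul_self p
  have hCu : cI p • (br (H z) (fun α => curvMul H γ α z) (fun α => γ α z) * wp (G z) q) =
      vin (G z) (H z) C u • wp (G z) n := by
    have h1 : ∀ α, emb (C α) = emb (cI p • (wedge (m := k) (by omega) (curvMul H γ α z)
        (omegaPow (G z) q))) := fun α => by
      rw [hC, map_smul, emb_wedge]; rfl
    rw [vin_star hGz hwz hpq hk C u hu, br_congr h1, br_smul_left, br_wedge_left _ (even_two_mul q)]
    rfl
  have hδδ := vin_primitive (M := H z) hGz hδw (s := 0) (t := q) (by omega) rfl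
    (fun α => dPrime H γ α z) (fun α => dPrime H γ α z) (fun α => by rw [wp_zero, mul_one])
  have hηη := vin_type_one (M := H z) hGz hpq (fun α j => pdb j (γ α) z) (fun α j =>
    .pdb (differentiableAt_of_contDiffOn hU (hγ α) hz) (Filter.eventually_of_mem (hU.mem_nhds hz) (hw α)) j)
    hm (fun α => emb_dbar (γ α) z) hη'
  rw [ddbar_tF hU hH hγ hz]
  simp only [add_mul, smul_mul_assoc, sub_mul, smul_sub]
  rw [← hδδ, hηη, hCu, hκ', neg_mul, neg_smul, hκ]
  module

theorem ddbar_mul_even (hU : IsOpen U) {T : Cn n → CForm n (p + p)} {W : Cn n → CForm n l}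
    (hT : ContDiffOn ℝ ∞ T U) (hW : ContDiffOn ℝ ∞ W U) (h : p + p + l = m) {z : Cn n} (hz : z ∈ U) :
    emb (del (dbar (fun w => wedge h (T w) (W w))) z) =
      emb (del (dbar T) z) * emb (W z) - emb (dbar T z) * emb (del W z) + emb (del T z) * emb (dbar W z) +
        emb (T z) * emb (del (dbar W) z) := by
  have hT' := contDiffOn_dbar hU hT
  have hW' := contDiffOn_dbar hU hW
  have hpp : (-1 : ℂ) ^ (p + p) = 1 := Even.neg_one_pow ⟨p, rfl⟩
  have d : ∀ {j : ℕ} {f : Cn n → CForm n j}, ContDiffOn ℝ ∞ f U → DifferentiableAt ℝ f z :=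
    fun hf => differentiableAt_of_contDiffOn hU hf hz
  have h1 : dbar (fun w => wedge h (T w) (W w)) =ᶠ[𝓝 z]
      fun w => wedge (m := m + 1) (by omega) (dbar T w) (W w) +
        wedge (m := m + 1) (by omega) (T w) (dbar W w) := by
    refine Filter.eventually_of_mem (hU.mem_nhds hz) fun w hw => ?_
    rw [← emb_inj, emb_dbar_wedge h (differentiableAt_of_contDiffOn hU hT hw)
      (differentiableAt_of_contDiffOn hU hW hw), map_add, emb_wedge, emb_wedge, hpp, one_smul]
  rw [del_congr h1, del_add (d (contDiffOn_wedge _ hT' hW)) (d (contDiffOn_wedge _ hT hW')), map_add,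
    emb_del_wedge _ (d hT') (d hW), emb_del_wedge _ (d hT) (d hW'), pow_succ, hpp]
  simp only [one_smul, one_mul, neg_smul]
  abel

end DbarForms

end

section

namespace DbarForms

open scoped ComplexOrder MatrixOrder

variable {n r k l m : ℕ} {G : Matrix (Fin n) (Fin n) ℂ}

/-! ### Estimates -/

/-- The comass of `β` is at most `K`. -/
def ComassLE (G : Matrix (Fin n) (Fin n) ℂ) (K : ℝ) (β : CForm n k) : Prop :=
  ∀ v : Fin k → Cn n, ‖β v‖ ≤ K * ∏ i, Real.sqrt (riem G (v i) (v i))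

theorem ComassLE.apply_frame {K : ℝ} {β : CForm n k} (h : ComassLE G K β) {f : Idx n → Cn n}
    (hf : IsONFrame G f) (s : Fin k → Idx n) : ‖β (fun i => f (s i))‖ ≤ K := by
  have h1 := h fun i => f (s i)
  have h2 : ∀ i, Real.sqrt (riem G (f (s i)) (f (s i))) = 1 := fun i => by rw [hf, if_pos rfl, Real.sqrt_one]
  simpa [h2] using h1

/-- A dimensional constant. -/
noncomputable def comassConst (n : ℕ) : ℝ := ((2 * n + 1) ^ (2 * n + 1) * (2 * n + 1).factorial ^ 4 : ℕ)

/-- At most (2n+1)! permutations contribute. Degree 2n + 1 must be admitted because ∂̄u has degree n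
+ q + 1. -/
theorem norm_wedge_frame_le (h : k + l = m) (hm : m ≤ 2 * n + 1) {a : CForm n k} {b : CForm n l} {f : Idx n → Cn n}
    {A B : ℝ} (hA0 : 0 ≤ A) (hB0 : 0 ≤ B) (hA : ∀ s : Fin k → Idx n, ‖a (fun i => f (s i))‖ ≤ A)
    (hB : ∀ s : Fin l → Idx n, ‖b (fun i => f (s i))‖ ≤ B) (s : Fin m → Idx n) :
    ‖wedge h a b (fun i => f (s i))‖ ≤ (2 * n + 1).factorial * (A * B) := by
  subst h
  have h1 := congrArg norm (wedge_apply a b fun i => f (s i))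
  rw [norm_mul, Complex.norm_natCast] at h1
  have h2 : (1 : ℝ) ≤ (k.factorial * l.factorial : ℕ) := by
    exact_mod_cast Nat.mul_pos k.factorial_pos l.factorial_pos
  have h3 : ‖∑ σ : Equiv.Perm (Fin (k + l)), ((Equiv.Perm.sign σ : ℤ) : ℂ) *
      (a (fun i => f (s (σ (Fin.castAdd l i)))) * b (fun i => f (s (σ (Fin.natAdd k i)))))‖ ≤
      ((k + l).factorial : ℝ) * (A * B) := by
    refine (norm_sum_le _ _).trans ?_
    refine (Finset.sum_le_card_nsmul _ _ (A * B) fun σ _ => ?_).trans ?_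
    · rw [norm_mul, norm_mul]
      have : ‖((Equiv.Perm.sign σ : ℤ) : ℂ)‖ = 1 := by
        rcases Int.units_eq_one_or (Equiv.Perm.sign σ) with hs | hs <;> simp [hs]
      rw [this, one_mul]
      exact mul_le_mul (hA _) (hB _) (norm_nonneg _) hA0
    · rw [Finset.card_univ, Fintype.card_perm, Fintype.card_fin, nsmul_eq_mul]
  have h4 : ((k + l).factorial : ℝ) ≤ (2 * n + 1).factorial := by exact_mod_cast Nat.factorial_le hm
  calc ‖wedge rfl a b (fun i => f (s i))‖
      ≤ (k.factorial * l.factorial : ℕ) * ‖wedge rfl a b (fun i => f (s i))‖ :=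
        le_mul_of_one_le_left (norm_nonneg _) h2
    _ ≤ ((k + l).factorial : ℝ) * (A * B) := h1.trans_le h3
    _ ≤ _ := mul_le_mul_of_nonneg_right h4 (mul_nonneg hA0 hB0)

theorem norm_frame_le {f : Idx n → Cn n} (hf : IsONFrame G f) (hk : k ≤ 2 * n + 1) (a : CForm n k)
    (s : Fin k → Idx n) : ‖a (fun i => f (s i))‖ ≤ (2 * n + 1).factorial * Real.sqrt (normSqF G a) := by
  have h1 : ‖a (fun i => f (s i))‖ ^ 2 ≤ k.factorial * normSqF G a := by
    rw [hf.normSqF_eq, ← mul_assoc, mul_one_div, div_self (by exact_mod_cast k.factorial_ne_zero), one_mul]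
    exact Finset.single_le_sum (f := fun μ : Fin k → Idx n => ‖a (fun i => f (μ i))‖ ^ 2)
      (fun _ _ => by positivity) (Finset.mem_univ s)
  have h0 : 0 ≤ normSqF G a := by rw [hf.normSqF_eq]; positivity
  have h2 : (k.factorial : ℝ) ≤ ((2 * n + 1).factorial : ℝ) ^ 2 := by
    have h3 : (k.factorial : ℝ) ≤ (2 * n + 1).factorial := by exact_mod_cast Nat.factorial_le hk
    have h4 : (1 : ℝ) ≤ (2 * n + 1).factorial := by exact_mod_cast (2 * n + 1).factorial_pos
    nlinarith
  refine abs_le_of_sq_le_sq' ?_ (by positivity) |>.2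
  rw [mul_pow, Real.sq_sqrt h0]
  exact h1.trans (mul_le_mul_of_nonneg_right h2 h0)

theorem normSqF_le_of_frame {f : Idx n → Cn n} (hf : IsONFrame G f) (hk : k ≤ 2 * n + 1) {a : CForm n k} {A : ℝ}
    (hA : ∀ s : Fin k → Idx n, ‖a (fun i => f (s i))‖ ≤ A) :
    normSqF G a ≤ (((2 * n + 1) ^ (2 * n + 1) : ℕ) * A) ^ 2 := by
  rw [hf.normSqF_eq]
  have h1 : ∑ μ : Fin k → Idx n, ‖a (fun i => f (μ i))‖ ^ 2 ≤ ((2 * n + 1) ^ (2 * n + 1) : ℕ) * A ^ 2 := by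
    refine (Finset.sum_le_card_nsmul _ _ (A ^ 2) fun μ _ => pow_le_pow_left₀ (norm_nonneg _) (hA μ) 2).trans ?_
    rw [nsmul_eq_mul]
    refine mul_le_mul_of_nonneg_right ?_ (by positivity)
    rw [Finset.card_univ, Fintype.card_fun, Fintype.card_fin, Fintype.card_prod, Fintype.card_fin,
      Fintype.card_fin]
    exact_mod_cast (Nat.pow_le_pow_left (by omega) k).trans (Nat.pow_le_pow_right (by omega) hk)
  have h2 : (1 / (k.factorial : ℝ)) ≤ 1 := by
    rw [div_le_one (by exact_mod_cast k.factorial_pos)]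
    exact_mod_cast k.factorial_pos
  have h3 : (1 : ℝ) ≤ ((2 * n + 1) ^ (2 * n + 1) : ℕ) := by exact_mod_cast Nat.pos_of_ne_zero (by positivity)
  calc _ ≤ 1 * ∑ μ : Fin k → Idx n, ‖a (fun i => f (μ i))‖ ^ 2 :=
        mul_le_mul_of_nonneg_right h2 (by positivity)
    _ ≤ ((2 * n + 1) ^ (2 * n + 1) : ℕ) * A ^ 2 := by rw [one_mul]; exact h1
    _ ≤ _ := by
      rw [mul_pow]
      exact mul_le_mul_of_nonneg_right (by nlinarith) (by positivity)

theorem normSqF_omegaPow (hG : G.PosDef) : normSqF G (omegaPow G n) = 1 := by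
  have h1 := emb_top hG (omegaPow G n)
  rw [formInner_self hG] at h1
  have h2 : (1 : ℂ) • wp G n = (normSqF G (omegaPow G n) : ℂ) • wp G n := by rw [one_smul]; exact h1
  exact_mod_cast ((wp_smul_inj hG).mp h2).symm

theorem norm_top_coeff (hG : G.PosDef) {c : CForm n (2 * n)} {t : ℂ} (h : emb c = t • wp G n) :
    ‖t‖ ^ 2 = normSqF G c := by
  have h1 : c = t • omegaPow G n := by rw [← emb_inj, h, map_smul]; rfl
  have h2 := formInner_self hG c
  rw [h1, formInner_smul_left, formInner_smul_right hG, formInner_self hG, normSqF_omegaPow hG,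
    Complex.ofReal_one, mul_one, Complex.mul_conj, Complex.normSq_eq_norm_sq] at h2
  rw [h1]
  exact_mod_cast h2

/-- As ω_n has norm one, the coefficient is bounded by the norm of the product, which is estimated
through values on an orthonormal frame. -/
theorem norm_top_le (hG : G.PosDef) {K : ℝ} (hK : 0 ≤ K) (h : k + l + m = 2 * n) (x : CForm n k) (y : CForm n l)
    {β : CForm n m} (hβ : ComassLE G K β) {t : ℂ} (ht : emb x * emb (conjForm y) * emb β = t • wp G n) :
    ‖t‖ ≤ comassConst n * K * (Real.sqrt (normSqF G x) * Real.sqrt (normSqF G y)) := by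
  obtain ⟨f, hf⟩ := exists_isONFrame hG
  have hy : ∀ s : Fin l → Idx n, ‖conjForm y (fun i => f (s i))‖ ≤
      (2 * n + 1).factorial * Real.sqrt (normSqF G y) := fun s => by
    rw [conjForm_apply, RCLike.norm_conj]
    exact norm_frame_le hf (by omega) y s
  have h1 := norm_wedge_frame_le (m := k + l) rfl (by omega) (by positivity) (by positivity)
    (norm_frame_le hf (by omega) x) hy
  have h2 := norm_wedge_frame_le h (by omega) (by positivity) hK h1 fun s => hβ.apply_frame hf s
  have h3 := normSqF_le_of_frame hf (by omega) h2
  have h4 : emb (wedge h (wedge rfl x (conjForm y)) β) = t • wp G n := by rw [emb_wedge, emb_wedge, ht]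
  rw [← norm_top_coeff hG h4] at h3
  refine (abs_le_of_sq_le_sq' h3 (by positivity)).2.trans (le_of_eq ?_)
  rw [comassConst]
  push_cast
  ring

theorem normSqF_wedge_le (hG : G.PosDef) {K : ℝ} (hK : 0 ≤ K) (h : k + l = m) (hm : m ≤ 2 * n + 1)
    (x : CForm n k) {β : CForm n l} (hβ : ComassLE G K β) :
    normSqF G (wedge h x β) ≤ (comassConst n * K) ^ 2 * normSqF G x := by
  obtain ⟨f, hf⟩ := exists_isONFrame hG
  have h2 := norm_wedge_frame_le h hm (by positivity) hK (norm_frame_le hf (by omega) x)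
    fun s => hβ.apply_frame hf s
  have h3 := normSqF_le_of_frame hf hm h2
  have h0 : 0 ≤ normSqF G x := normSqF_nonneg hG x
  refine h3.trans ?_
  have h4 : (1 : ℝ) ≤ (2 * n + 1).factorial := by exact_mod_cast (2 * n + 1).factorial_pos
  have h5 : (1 : ℝ) ≤ ((2 * n + 1).factorial : ℝ) ^ 2 := one_le_pow₀ h4
  have e1 : (comassConst n * K) ^ 2 * normSqF G x =
      (((2 * n + 1 : ℕ) ^ (2 * n + 1) : ℝ) * (2 * n + 1).factorial ^ 4 * K * Real.sqrt (normSqF G x)) ^ 2 := by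
    rw [mul_pow _ (Real.sqrt _), Real.sq_sqrt h0, comassConst]
    push_cast
    ring
  rw [e1]
  push_cast
  refine pow_le_pow_left₀ (by positivity) ?_ 2
  have e2 : (2 * (n : ℝ) + 1) ^ (2 * n + 1) * (2 * n + 1).factorial ^ 4 * K * Real.sqrt (normSqF G x) =
      (2 * (n : ℝ) + 1) ^ (2 * n + 1) * ((2 * n + 1).factorial * ((2 * n + 1).factorial *
        Real.sqrt (normSqF G x) * K)) * (2 * n + 1).factorial ^ 2 := by ring
  rw [e2]
  exact le_mul_of_one_le_right (by positivity) h5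

/-! ### Estimates for vector-valued forms -/

variable {M : Matrix (Fin r) (Fin r) ℂ}

/-- A linear change of frame. -/
noncomputable def frameChange (F : Matrix (Fin r) (Fin r) ℂ) (x : Fin r → CForm n k) (μ : Fin r) : CForm n k :=
  ∑ α, F μ α • x α

/-- Passing to a unitary frame decouples the components, which keeps the constants independent of
the rank and of the fibre metric. -/
theorem exists_unitary_frame (hM : M.PosDef) : ∃ F : Matrix (Fin r) (Fin r) ℂ,
    ∀ α β, M α β = ∑ μ, F μ α * conj (F μ β) := by
  obtain ⟨B, hB⟩ := CStarAlgebra.nonneg_iff_eq_star_mul_self.mp hM.posSemidef.nonneg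
  refine ⟨fun μ α => conj (B μ α), fun α β => ?_⟩
  rw [hB, Matrix.mul_apply]
  exact Finset.sum_congr rfl fun μ _ => by simp [Matrix.star_apply]

theorem br_frameChange {F : Matrix (Fin r) (Fin r) ℂ} (hF : ∀ α β, M α β = ∑ μ, F μ α * conj (F μ β))
    (x : Fin r → CForm n k) (y : Fin r → CForm n l) :
    br M x y = ∑ μ, emb (frameChange F x μ) * emb (conjForm (frameChange F y μ)) := by
  simp only [br, frameChange, conjForm_sum, conjForm_smul, map_sum, map_smul, Finset.sum_mul, Finset.mul_sum,
    smul_mul_assoc, mul_smul_comm, hF, Finset.sum_smul]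
  refine Eq.trans (Finset.sum_congr rfl fun α _ => Finset.sum_comm) ?_
  refine Finset.sum_comm.trans (Finset.sum_congr rfl fun μ _ => ?_)
  refine Finset.sum_comm.trans (Finset.sum_congr rfl fun β _ => ?_)
  rw [Finset.smul_sum]
  exact Finset.sum_congr rfl fun α _ => by rw [mul_comm, mul_smul]

theorem vin_frameChange (hG : G.PosDef) {F : Matrix (Fin r) (Fin r) ℂ}
    (hF : ∀ α β, M α β = ∑ μ, F μ α * conj (F μ β)) (x y : Fin r → CForm n k) :
    vin G M x y = ∑ μ, formInner G (frameChange F x μ) (frameChange F y μ) := by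
  simp only [vin, frameChange, formInner_sum_left, formInner_sum_right hG, formInner_smul_left,
    formInner_smul_right hG, hF, Finset.sum_mul]
  refine Eq.trans (Finset.sum_congr rfl fun α _ => Finset.sum_comm) ?_
  refine Finset.sum_comm.trans (Finset.sum_congr rfl fun μ _ => ?_)
  refine Finset.sum_comm.trans (Finset.sum_congr rfl fun β _ => ?_)
  rw [Finset.mul_sum]
  exact Finset.sum_congr rfl fun α _ => by ring

/-- The squared norm of a vector-valued form. -/
noncomputable def vsq (G : Matrix (Fin n) (Fin n) ℂ) (M : Matrix (Fin r) (Fin r) ℂ) (x : Fin r → CForm n k) : ℝ :=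
  (vin G M x x).re

theorem vsq_frameChange (hG : G.PosDef) {F : Matrix (Fin r) (Fin r) ℂ}
    (hF : ∀ α β, M α β = ∑ μ, F μ α * conj (F μ β)) (x : Fin r → CForm n k) :
    vsq G M x = ∑ μ, normSqF G (frameChange F x μ) := by
  rw [vsq, vin_frameChange hG hF, Complex.re_sum]
  rfl

theorem vsq_nonneg (hG : G.PosDef) (hM : M.PosDef) (x : Fin r → CForm n k) : 0 ≤ vsq G M x := by
  obtain ⟨F, hF⟩ := exists_unitary_frame hM
  rw [vsq_frameChange hG hF]
  exact Finset.sum_nonneg fun μ _ => normSqF_nonneg hG _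

theorem vin_self (hG : G.PosDef) (hM : M.PosDef) (x : Fin r → CForm n k) : vin G M x x = (vsq G M x : ℂ) := by
  obtain ⟨F, hF⟩ := exists_unitary_frame hM
  rw [vsq_frameChange hG hF, vin_frameChange hG hF, Complex.ofReal_sum]
  exact Finset.sum_congr rfl fun μ _ => formInner_self hG _

/-- The scalar estimate in each unitary component, followed by the Cauchy–Schwarz inequality for the
sum of products of norms. -/
theorem norm_vtop_le (hG : G.PosDef) (hM : M.PosDef) {K : ℝ} (hK : 0 ≤ K) (h : k + l + m = 2 * n)
    (x : Fin r → CForm n k) (y : Fin r → CForm n l) {β : CForm n m} (hβ : ComassLE G K β) {t : ℂ}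
    (ht : br M x y * emb β = t • wp G n) :
    ‖t‖ ≤ comassConst n * K * (Real.sqrt (vsq G M x) * Real.sqrt (vsq G M y)) := by
  obtain ⟨F, hF⟩ := exists_unitary_frame hM
  have h1 : ∀ μ, ∃ t : ℂ, emb (frameChange F x μ) * emb (conjForm (frameChange F y μ)) * emb β = t • wp G n := by
    intro μ
    refine ⟨_, Eq.trans ?_ (emb_top hG
      (wedge h (wedge rfl (frameChange F x μ) (conjForm (frameChange F y μ))) β))⟩
    rw [emb_wedge, emb_wedge]
  choose τ hτ using h1
  have h2 : t = ∑ μ, τ μ := by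
    rw [← wp_smul_inj hG, ← ht, br_frameChange hF, Finset.sum_mul, Finset.sum_smul]
    exact Finset.sum_congr rfl fun μ _ => hτ μ
  rw [h2, vsq_frameChange hG hF, vsq_frameChange hG hF]
  refine (norm_sum_le _ _).trans ((Finset.sum_le_sum fun μ _ => norm_top_le hG hK h _ _ hβ (hτ μ)).trans ?_)
  rw [← Finset.mul_sum]
  refine mul_le_mul_of_nonneg_left ?_ (mul_nonneg (by rw [comassConst]; positivity) hK)
  exact Real.sum_sqrt_mul_sqrt_le _ (fun μ => normSqF_nonneg hG _) fun μ => normSqF_nonneg hG _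

theorem vsq_wedge_le (hG : G.PosDef) (hM : M.PosDef) {K : ℝ} (hK : 0 ≤ K) (h : k + l = m) (hm : m ≤ 2 * n + 1)
    (x : Fin r → CForm n k) {β : CForm n l} (hβ : ComassLE G K β) :
    vsq G M (fun α => wedge h (x α) β) ≤ (comassConst n * K) ^ 2 * vsq G M x := by
  obtain ⟨F, hF⟩ := exists_unitary_frame hM
  rw [vsq_frameChange hG hF, vsq_frameChange hG hF, Finset.mul_sum]
  refine Finset.sum_le_sum fun μ _ => ?_
  have : frameChange F (fun α => wedge h (x α) β) μ = wedge h (frameChange F x μ) β := by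
    rw [← emb_inj]
    simp only [frameChange, map_sum, map_smul, emb_wedge, Finset.sum_mul, smul_mul_assoc]
  rw [this]
  exact normSqF_wedge_le hG hK h hm _ hβ

end DbarForms

end

section

namespace DbarForms

open scoped ComplexOrder MatrixOrder

variable {n r k l m : ℕ} {U : Set (Cn n)}

/-! ### The inequality in a chart -/

variable {p q : ℕ} {γ : Fin r → Cn n → CForm n p} {G : Cn n → Matrix (Fin n) (Fin n) ℂ}
  {H : Cn n → Matrix (Fin r) (Fin r) ℂ}

theorem conjForm_dbar_omegaPow (hU : IsOpen U) (hG : IsMetricOn U G) {z : Cn n} (hz : z ∈ U) (s : ℕ) :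
    conjForm (dbar (fun w => omegaPow (G w) s) z) = del (fun w => omegaPow (G w) s) z := by
  rw [conjForm_dbar (differentiableAt_of_contDiffOn hU (contDiffOn_omegaPow hG s) hz)]
  exact del_congr (Filter.eventually_of_mem (hU.mem_nhds hz) fun w hw => conjForm_omegaPow (hG.posDef w hw) s)

theorem conjForm_ddbar_omegaPow (hU : IsOpen U) (hG : IsMetricOn U G) {z : Cn n} (hz : z ∈ U) (s : ℕ) :
    conjForm (del (dbar (fun w => omegaPow (G w) s)) z) = -del (dbar (fun w => omegaPow (G w) s)) z := by
  have hW := contDiffOn_omegaPow hG s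
  rw [← dbar_del_add_del_dbar hU hW hz,
    conjForm_del (differentiableAt_of_contDiffOn hU (contDiffOn_dbar hU hW) hz)]
  exact dbar_congr (Filter.eventually_of_mem (hU.mem_nhds hz) fun w hw => conjForm_dbar_omegaPow hU hG hw s)

theorem conjForm_del_tF (hU : IsOpen U) (hH : IsMetricOn U H) (hγ : ∀ α, ContDiffOn ℝ ∞ (γ α) U)
    {z : Cn n} (hz : z ∈ U) : conjForm (del (tF H γ) z) = dbar (tF H γ) z := by
  rw [conjForm_del (differentiableAt_of_contDiffOn hU (contDiffOn_tF hH hγ) hz)]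
  exact dbar_congr (Filter.eventually_of_mem (hU.mem_nhds hz) fun w hw => conjForm_tF hH hw)

theorem eq_one_smul (a : CForm n k) : a = (1 : ℂ) • a := by ext v; simp

/-- T and ω_q are real, so the two mixed terms of the Leibniz expansion are conjugate, and iT ∧
∂∂̄ω_q is real because conjugation sends ∂∂̄ω_q to -∂∂̄ω_q. -/
theorem ddbar_tF_wedge (hU : IsOpen U) (hG : IsMetricOn U G) (hH : IsMetricOn U H)
    (hγ : ∀ α, ContDiffOn ℝ ∞ (γ α) U) (hpq : p + (q + 1) = n) (h : p + p + 2 * q = m) {z : Cn n} (hz : z ∈ U)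
    {Y Z : ℂ} (hY : Complex.I • (emb (del (tF H γ) z) * emb (dbar (fun w => omegaPow (G w) q) z)) =
      Y • wp (G z) n)
    (hZ : Complex.I • (emb (tF H γ z) * emb (del (dbar fun w => omegaPow (G w) q) z)) = Z • wp (G z) n) :
    Complex.I • emb (del (dbar (fun w => wedge h (tF H γ w) (omegaPow (G w) q))) z) =
      (Complex.I • emb (del (dbar (tF H γ)) z)) * wp (G z) q + ((2 * Y.re + Z.re : ℝ) : ℂ) • wp (G z) n := by
  have hGz := hG.posDef z hz
  have h1 := conj_top hGz (d := 1) (by omega)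
    ((conjForm_del_tF hU hH hγ hz).trans (eq_one_smul _)) (conjForm_dbar_omegaPow hU hG hz q) hY
  have h2 := conj_top hGz (d := 1) (by omega) ((conjForm_tF hH hz).trans (eq_one_smul _))
    (conjForm_ddbar_omegaPow hU hG hz q) hZ
  rw [map_neg, mul_neg, smul_neg, ← neg_smul, Complex.conj_I, mul_one, neg_neg, hZ, wp_smul_inj hGz] at h2
  have hZr : Z = (Z.re : ℂ) := (Complex.conj_eq_iff_re.mp h2.symm).symm
  have hYr : Y + conj Y = ((2 * Y.re : ℝ) : ℂ) := by rw [Complex.add_conj]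
  rw [ddbar_mul_even hU (contDiffOn_tF hH hγ) (contDiffOn_omegaPow hG q) h hz, smul_add, smul_add, smul_sub, hY,
    hZ, Complex.ofReal_add, ← hYr, ← hZr, add_smul, add_smul, ← h1, smul_mul_assoc, Complex.conj_I, mul_one]
  have hwq : emb (omegaPow (G z) q) = wp (G z) q := rfl
  rw [hwq]
  module

theorem norm_cI (p : ℕ) : ‖cI p‖ = 1 := by simp [cI]

theorem vsq_of_primitive {G : Matrix (Fin n) (Fin n) ℂ} {M : Matrix (Fin r) (Fin r) ℂ} (hG : G.PosDef)
    {γ : Fin r → CForm n p} (hγ : ∀ α, HasWeight p (γ α)) {s : ℕ} (hps : p + s = n) (hk : k = p + 2 * s) {c : ℂ}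
    (hc : ‖c‖ = 1) {u : Fin r → CForm n k} (hu : ∀ α, emb (u α) = c • (emb (γ α) * wp G s)) :
    vin G M u u = vin G M γ γ := by
  let b : Fin r → CForm n k := fun α => wedge (by omega) (γ α) (omegaPow G s)
  have hb : ∀ α, emb (b α) = emb (γ α) * wp G s := fun α => emb_wedge _ _ _
  have h1 : u = fun α => c • b α := by
    funext α
    rw [← emb_inj, hu, map_smul, hb]
  have hcc : c * conj c = 1 := by rw [Complex.mul_conj, Complex.normSq_eq_norm_sq, hc]; simp
  rw [h1, vin_smul_left, vin_smul_right hG, ← mul_assoc, hcc, one_mul]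
  simp only [vin]
  refine Finset.sum_congr rfl fun α _ => Finset.sum_congr rfl fun β _ => ?_
  rw [formInner_primitive_eq hG (t := 0) (by omega) (hγ β) hk (hb α) (hb β) rfl]

/-- Here a = |D'γ|², b = |∂̄γ|², g = |u|², and s = |∂̄γ∧ω_q|² in the notation of the theorem. The
estimate 2AMC ≤ A² + M²C² absorbs a cross term into a or b; in the second inequality the x-terms
cancel. The coefficient 6 is generous: 2 would do. -/
theorem quadratic_bound {a b g M s x y z : ℝ} (ha : 0 ≤ a) (hb : 0 ≤ b) (hg : 0 ≤ g) (hM : 0 ≤ M)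
    (hs : s ≤ M ^ 2 * g) (hx : |x| ≤ M * (Real.sqrt a * Real.sqrt g))
    (hy : |y| ≤ M * (Real.sqrt g * Real.sqrt b)) (hz : |z| ≤ M * (Real.sqrt g * Real.sqrt g)) :
    0 ≤ (M + 6 * M ^ 2) * g + a + b - s - 2 * x ∧
      0 ≤ (M + 6 * M ^ 2) * g + a + b - s - 2 * x + (2 * (x + y) + z) := by
  have ha' := Real.sq_sqrt ha
  have hb' := Real.sq_sqrt hb
  have hg' := Real.sq_sqrt hg
  set A := Real.sqrt a
  set B := Real.sqrt b
  set C := Real.sqrt g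
  have hx' := abs_le.mp hx
  have hy' := abs_le.mp hy
  have hz' := abs_le.mp hz
  have hMC : 0 ≤ M * C ^ 2 := by positivity
  have hMC2 : 0 ≤ (M * C) ^ 2 := sq_nonneg _
  constructor
  · nlinarith [sq_nonneg (A - M * C), sq_nonneg B]
  · nlinarith [sq_nonneg (A - M * C), sq_nonneg (B - M * C)]

/-- All terms of the pointwise formula other than those of the lower bound are torsion terms or
squares, and `quadratic_bound` makes their sum with c|u|² nonnegative. The hypothesis `hcl` is ∂̄u =
0 rewritten for γ. -/
theorem local_estimate (hU : IsOpen U) (hG : IsMetricOn U G) (hH : IsMetricOn U H)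
    (hγ : ∀ α, ContDiffOn ℝ ∞ (γ α) U) (hw : ∀ α, ∀ z ∈ U, HasWeight p (γ α z)) (hpq : p + (q + 1) = n)
    {z : Cn n} (hz : z ∈ U) (hk : k = n + (q + 1)) {u v C : Fin r → CForm n k}
    (hu : ∀ α, emb (u α) = cI p • (emb (γ α z) * wp (G z) (q + 1)))
    (hv : ∀ α, emb (v α) = (Complex.I * cI p) • (emb (dbar (dPrime H γ α) z) * wp (G z) q +
      (-1 : ℂ) ^ (p + 1) • (emb (dPrime H γ α z) * emb (dbar (fun w => omegaPow (G w) q) z))))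
    (hC : ∀ α, emb (C α) = cI p • (emb (curvMul H γ α z) * wp (G z) q))
    (hcl : ∀ α, emb (dbar (γ α) z) * wp (G z) (q + 1) +
      (-1 : ℂ) ^ p • (emb (γ α z) * emb (dbar (fun w => omegaPow (G w) (q + 1)) z)) = 0)
    {K : ℝ} (hK : 0 ≤ K) (hβ1 : ComassLE (G z) K (dbar (fun w => omegaPow (G w) q) z))
    (hβ2 : ComassLE (G z) K (dbar (fun w => omegaPow (G w) (q + 1)) z))
    (hβ3 : ComassLE (G z) K (del (dbar fun w => omegaPow (G w) q) z)) (h : p + p + 2 * q = m) :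
    ∃ s t : ℝ, 0 ≤ s ∧ 0 ≤ t ∧
      Complex.I • emb (del (dbar (fun w => wedge h (tF H γ w) (omegaPow (G w) q))) z) =
        (-2 * ((vin (G z) (H z) v u).re : ℂ) + vin (G z) (H z) C u -
          ((comassConst n * K + 6 * (comassConst n * K) ^ 2 : ℝ) : ℂ) * vin (G z) (H z) u u + s) • wp (G z) n ∧
      (Complex.I • emb (del (dbar (tF H γ)) z)) * wp (G z) q =
        (-2 * ((vin (G z) (H z) v u).re : ℂ) + vin (G z) (H z) C u -
          ((comassConst n * K + 6 * (comassConst n * K) ^ 2 : ℝ) : ℂ) * vin (G z) (H z) u u + t) • wp (G z) n := by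
  have hGz := hG.posDef z hz
  have hHz := hH.posDef z hz
  have hwz : ∀ α, HasWeight p (γ α z) := fun α => hw α z hz
  set β1 := dbar (fun w => omegaPow (G w) q) z with hβ1def
  set β3 := del (dbar fun w => omegaPow (G w) q) z with hβ3def
  have hM0 : 0 ≤ comassConst n * K := mul_nonneg (by rw [comassConst]; positivity) hK
  set Mc := comassConst n * K with hMc
  have top : ∀ {i j s : ℕ} (hij : i + j + s = 2 * n) (x : Fin r → CForm n i) (y : Fin r → CForm n j)
      (β : CForm n s), ∃ t : ℂ, br (H z) x y * emb β = t • wp (G z) n := by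
    intro i j s hij x y β
    refine ⟨_, Eq.trans ?_ (emb_top hGz (wedge hij (brF rfl (H z) x y) β))⟩
    rw [emb_wedge, emb_brF]
  obtain ⟨x0, hx0⟩ := top (by omega) (fun α => dPrime H γ α z) (fun α => γ α z) β1
  obtain ⟨y0, hy0⟩ := top (by omega) (fun α => γ α z) (fun α => dbar (γ α) z) β1
  obtain ⟨z0, hz0⟩ := top (by omega) (fun α => γ α z) (fun α => γ α z) β3
  have bx := norm_vtop_le hGz hHz hK (by omega) _ _ hβ1 hx0
  have bY := norm_vtop_le hGz hHz hK (by omega) _ _ hβ1 hy0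
  have bz := norm_vtop_le hGz hHz hK (by omega) _ _ hβ3 hz0
  have hIc : ‖Complex.I * cI p‖ = 1 := by rw [norm_mul, norm_cI]; simp
  have hX : (Complex.I * cI p) • (br (H z) (fun α => dPrime H γ α z) (fun α => γ α z) * emb β1) =
      (Complex.I * cI p * x0) • wp (G z) n := by rw [hx0, smul_smul]
  -- The part of ∂T containing D'γ gives the same torsion coefficient as the one hidden in ∂̄∂̄*u,
  -- so it cancels in i∂∂̄(T∧ω_q).
  have hY : Complex.I • (emb (del (tF H γ) z) * emb β1) =
      (Complex.I * cI p * x0 + Complex.I * cI p * (-1) ^ p * y0) • wp (G z) n := by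
    rw [emb_del_tF hU hH hγ hz, smul_mul_assoc, add_mul, smul_mul_assoc, hx0, hy0]
    module
  have hZ : Complex.I • (emb (tF H γ z) * emb β3) = (Complex.I * cI p * z0) • wp (G z) n := by
    rw [tF, map_smul, emb_brF, smul_mul_assoc, hz0, smul_smul, smul_smul, mul_assoc]
  let η' : Fin r → CForm n (n + (q + 1) + 1) := fun α =>
    wedge (by omega) (dbar (γ α) z) (omegaPow (G z) (q + 1))
  have hη' : ∀ α, emb (η' α) = emb (dbar (γ α) z) * wp (G z) (q + 1) := fun α => emb_wedge _ _ _
  -- Closedness replaces the first-order quantity ∂̄γ∧ω_{q+1} by γ∧∂̄ω_{q+1}, which has order zero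
  -- in γ.
  have hη'2 : vsq (G z) (H z) η' ≤ Mc ^ 2 * vsq (G z) (H z) (fun α => γ α z) := by
    have h1 := vsq_wedge_le (m := n + (q + 1) + 1) hGz hHz hK (by omega) (by omega) (fun α => γ α z) hβ2
    refine le_trans (le_of_eq ?_) h1
    have h2 : η' = fun α => (-(-1 : ℂ) ^ p) • wedge (m := n + (q + 1) + 1) (by omega) (γ α z)
        (dbar (fun w => omegaPow (G w) (q + 1)) z) := by
      funext α
      rw [← emb_inj, hη', eq_neg_of_add_eq_zero_left (hcl α), map_smul, emb_wedge, neg_smul]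
    rw [h2, vsq, vsq, vin_smul_left, vin_smul_right hGz, ← mul_assoc]
    have h3 : (-(-1 : ℂ) ^ p) * conj (-(-1 : ℂ) ^ p) = 1 := by
      rw [map_neg, map_pow, map_neg, map_one, neg_mul_neg, neg_one_pow_mul_self]
    rw [h3, one_mul]
  have main := ddbar_tF_mul hU hG hH hγ hw hpq hz hk hu hv hC rfl hη' hX
  have main2 := ddbar_tF_wedge hU hG hH hγ hpq h hz hY hZ
  have huu : vin (G z) (H z) u u = vin (G z) (H z) (fun α => γ α z) (fun α => γ α z) :=
    vsq_of_primitive hGz hwz hpq (by omega) (norm_cI p) hu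
  have ha := vsq_nonneg hGz hHz fun α => dPrime H γ α z
  have hb := vsq_nonneg hGz hHz fun α => dbar (γ α) z
  have hg := vsq_nonneg hGz hHz fun α => γ α z
  rw [vin_self hGz hHz, vin_self hGz hHz, vin_self hGz hHz] at main
  rw [vin_self hGz hHz fun α => γ α z] at huu
  set a := vsq (G z) (H z) fun α => dPrime H γ α z
  set b := vsq (G z) (H z) fun α => dbar (γ α) z
  set g := vsq (G z) (H z) fun α => γ α z
  obtain ⟨hq1, hq2⟩ := quadratic_bound (x := (Complex.I * cI p * x0).re)
    (y := (Complex.I * cI p * (-1) ^ p * y0).re) (z := (Complex.I * cI p * z0).re) ha hb hg hM0 hη'2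
    (((Complex.abs_re_le_norm _).trans (by rw [norm_mul, hIc, one_mul])).trans bx)
    (((Complex.abs_re_le_norm _).trans (by rw [norm_mul, norm_mul, hIc]; simp)).trans bY)
    (((Complex.abs_re_le_norm _).trans (by rw [norm_mul, hIc, one_mul])).trans bz)
  have main' : (Complex.I • emb (del (dbar (tF H γ)) z)) * wp (G z) q =
      (-2 * ((vin (G z) (H z) v u).re : ℂ) + vin (G z) (H z) C u -
        ((Mc + 6 * Mc ^ 2 : ℝ) : ℂ) * g + ((Mc + 6 * Mc ^ 2) * g + a + b - vsq (G z) (H z) η' -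
          2 * (Complex.I * cI p * x0).re : ℝ)) • wp (G z) n := by
    rw [main]
    congr 1
    have h1 := Complex.add_conj (vin (G z) (H z) v u + Complex.I * cI p * x0)
    have h2 : -(vin (G z) (H z) v u + Complex.I * cI p * x0) -
        conj (vin (G z) (H z) v u + Complex.I * cI p * x0) =
        -(((2 * ((vin (G z) (H z) v u).re + (Complex.I * cI p * x0).re) : ℝ)) : ℂ) := by
      rw [← Complex.add_re, ← h1]; ring
    rw [h2]
    push_cast
    ring
  -- The two surpluses are exactly the quadratic expressions just shown to be nonnegative.
  refine ⟨_, _, hq2, hq1, ?_, ?_⟩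
  · rw [main2, main', huu, ← add_smul, Complex.add_re]
    congr 1
    push_cast
    ring
  · rw [main', huu]

theorem local_identity (hU : IsOpen U) (hG : IsMetricOn U G) (hH : IsMetricOn U H)
    (hγ : ∀ α, ContDiffOn ℝ ∞ (γ α) U) (hw : ∀ α, ∀ z ∈ U, HasWeight p (γ α z)) (hpq : p + (q + 1) = n)
    {z : Cn n} (hz : z ∈ U) (hk : k = n + (q + 1)) {u v C : Fin r → CForm n k}
    (hu : ∀ α, emb (u α) = cI p • (emb (γ α z) * wp (G z) (q + 1)))
    (hv : ∀ α, emb (v α) = (Complex.I * cI p) • (emb (dbar (dPrime H γ α) z) * wp (G z) q +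
      (-1 : ℂ) ^ (p + 1) • (emb (dPrime H γ α z) * emb (dbar (fun w => omegaPow (G w) q) z))))
    (hC : ∀ α, emb (C α) = cI p • (emb (curvMul H γ α z) * wp (G z) q))
    {η' : Fin r → CForm n l} (hl : l = n + (q + 1) + 1)
    (hη' : ∀ α, emb (η' α) = emb (dbar (γ α) z) * wp (G z) (q + 1))
    (hW : ∀ w ∈ U, dbar (fun w => omegaPow (G w) q) w = 0) (h : p + p + 2 * q = m) :
    Complex.I • emb (del (dbar (fun w => wedge h (tF H γ w) (omegaPow (G w) q))) z) =
        (Complex.I • emb (del (dbar (tF H γ)) z)) * wp (G z) q ∧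
      (Complex.I • emb (del (dbar (tF H γ)) z)) * wp (G z) q =
        (-2 * ((vin (G z) (H z) v u).re : ℂ) + vin (G z) (H z) C u +
          vin (G z) (H z) (fun α => dbar (γ α) z) (fun α => dbar (γ α) z) +
          vin (G z) (H z) (fun α => dPrime H γ α z) (fun α => dPrime H γ α z) -
          vin (G z) (H z) η' η') • wp (G z) n := by
  have hβ3 : del (dbar fun w => omegaPow (G w) q) z = 0 := by
    rw [del_congr (b := fun _ => 0) (Filter.eventually_of_mem (hU.mem_nhds hz) hW), del_zero]
  constructor
  · have := ddbar_tF_wedge hU hG hH hγ hpq h hz (Y := 0) (Z := 0) (by rw [hW z hz]; simp) (by rw [hβ3]; simp)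
    simpa using this
  · rw [ddbar_tF_mul hU hG hH hγ hw hpq hz hk hu hv hC hl hη' (X := 0) (by rw [hW z hz]; simp)]
    congr 1
    have h1 := Complex.add_conj (vin (G z) (H z) v u)
    rw [add_zero]
    have h2 : -vin (G z) (H z) v u - conj (vin (G z) (H z) v u) = -2 * ((vin (G z) (H z) v u).re : ℂ) := by
      rw [neg_sub_left, add_comm, h1]; push_cast; ring
    rw [h2]
    ring

end DbarForms

end

section

namespace DbarForms

open scoped ComplexOrder MatrixOrder

variable {n r k l m : ℕ} {U : Set (Cn n)}

/-! ### The operators `∂̄*`, `∂̄∂̄*` and `Λ` on `(n, q)`-forms -/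

variable {p q : ℕ} {G : Cn n → Matrix (Fin n) (Fin n) ℂ} {H : Cn n → Matrix (Fin r) (Fin r) ℂ}
  {u : Fin r → Cn n → CForm n (n + (q + 1))}

theorem contDiffOn_vHodge (hG : IsMetricOn U G) (h : k + l = 2 * n) {u : Fin r → Cn n → CForm n k}
    (hu : ∀ α, ContDiffOn ℝ ∞ (u α) U) (α : Fin r) : ContDiffOn ℝ ∞ (vHodge G h u α) U :=
  contDiffOn_hodge hG h (hu α)

theorem hasWeight_vHodge (hG : IsMetricOn U G) (h : k + l = 2 * n) {u : Fin r → Cn n → CForm n k} {w : ℤ}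
    (hw : ∀ α, ∀ z ∈ U, HasWeight w (u α z)) (α : Fin r) (z : Cn n) (hz : z ∈ U) :
    HasWeight w (vHodge G h u α z) :=
  (isStar_hodge (hG.posDef z hz) h _).hasWeight (hG.posDef z hz) h (hw α z hz)

theorem emb_eq_vHodge (hG : IsMetricOn U G) (hpq : p + (q + 1) = n) (h : n + (q + 1) + p = 2 * n)
    (hw : ∀ α, ∀ z ∈ U, HasWeight p (u α z)) (α : Fin r) {z : Cn n} (hz : z ∈ U) :
    emb (u α z) = cI p • (emb (vHodge G h u α z) * wp (G z) (q + 1)) :=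
  (isStar_hodge (hG.posDef z hz) h (u α z)).emb_eq (hG.posDef z hz) hpq (hasWeight_vHodge hG h hw α z hz)

/-- Since D'γ has type (p+1,0), its * is a multiple of D'γ ∧ ω_q, and the sign in ∂̄* = -*D'* turns
the factor -i·i^{p²} into i·i^{p²}. -/
theorem emb_dbarStar (hU : IsOpen U) (hG : IsMetricOn U G) (hH : IsMetricOn U H)
    (hu : ∀ α, ContDiffOn ℝ ∞ (u α) U) (hw : ∀ α, ∀ z ∈ U, HasWeight p (u α z)) (hpq : p + (q + 1) = n)
    (h : n + (q + 1) + p = 2 * n) (hm : m + 1 = n + (q + 1)) (α : Fin r) {z : Cn n} (hz : z ∈ U) :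
    emb (dbarStar G H hm u α z) =
      (Complex.I * cI p) • (emb (dPrime H (vHodge G h u) α z) * wp (G z) q) := by
  -- The definition of `dbarStar` uses this subtraction as the degree of *u.
  obtain rfl : p = 2 * n - (n + (q + 1)) := by omega
  have hδ := hasWeight_dPrime hU hH (contDiffOn_vHodge hG h hu) (hasWeight_vHodge hG h hw) hz α
  rw [dbarStar, dif_pos (by omega), map_neg, vHodge, hodge_primitive (hG.posDef z hz) (q := q) (by omega)
    (by exact_mod_cast hδ), neg_mul, neg_smul, neg_neg]

theorem emb_dbarDbarStar (hU : IsOpen U) (hG : IsMetricOn U G) (hH : IsMetricOn U H)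
    (hu : ∀ α, ContDiffOn ℝ ∞ (u α) U) (hw : ∀ α, ∀ z ∈ U, HasWeight p (u α z)) (hpq : p + (q + 1) = n)
    (h : n + (q + 1) + p = 2 * n) (hk : 1 ≤ n + (q + 1)) (α : Fin r) {z : Cn n} (hz : z ∈ U) :
    emb (dbarDbarStar G H hk u α z) =
      (Complex.I * cI p) • (emb (dbar (dPrime H (vHodge G h u) α) z) * wp (G z) q +
        (-1 : ℂ) ^ (p + 1) • (emb (dPrime H (vHodge G h u) α z) *
          emb (dbar (fun w => omegaPow (G w) q) z))) := by
  have hδ := contDiffOn_dPrime hU hH (contDiffOn_vHodge hG h hu) α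
  have hW := contDiffOn_omegaPow hG q
  have hd : p + 1 + 2 * q = n + (q + 1) - 1 := by omega
  have h1 : dbarStar (m := n + (q + 1) - 1) G H (by omega) u α =ᶠ[𝓝 z] fun w =>
      (Complex.I * cI p) • wedge hd (dPrime H (vHodge G h u) α w) (omegaPow (G w) q) := by
    refine Filter.eventually_of_mem (hU.mem_nhds hz) fun w hw' => ?_
    rw [← emb_inj, emb_dbarStar hU hG hH hu hw hpq h _ α hw', map_smul, emb_wedge]
    rfl
  rw [dbarDbarStar, emb_castForm, vDbar, dbar_congr h1, dbar_const_smul _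
    (differentiableAt_of_contDiffOn hU (contDiffOn_wedge hd hδ hW) hz), map_smul,
    emb_dbar_wedge hd (differentiableAt_of_contDiffOn hU hδ hz) (differentiableAt_of_contDiffOn hU hW hz)]
  rfl

theorem emb_curvLambda (hG : IsMetricOn U G) (hw : ∀ α, ∀ z ∈ U, HasWeight p (u α z))
    (hpq : p + (q + 1) = n) (h : n + (q + 1) + p = 2 * n) (hk : 2 ≤ n + (q + 1)) (α : Fin r) {z : Cn n}
    (hz : z ∈ U) : emb (curvLambda G H hk u α z) =
      cI p • (emb (curvMul H (vHodge G h u) α z) * wp (G z) q) := by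
  rw [curvLambda, map_sum, emb_curvMul, Finset.sum_mul, Finset.smul_sum]
  refine Finset.sum_congr rfl fun l _ => ?_
  rw [emb_wedge, emb_lambdaOp (hG.posDef z hz) hpq rfl (hasWeight_vHodge hG h hw l z hz)
    (emb_eq_vHodge hG hpq h hw l hz), mul_smul_comm, mul_assoc]

theorem emb_vDbar (hU : IsOpen U) (hG : IsMetricOn U G) (hu : ∀ α, ContDiffOn ℝ ∞ (u α) U)
    (hw : ∀ α, ∀ z ∈ U, HasWeight p (u α z)) (hpq : p + (q + 1) = n) (h : n + (q + 1) + p = 2 * n)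
    (α : Fin r) {z : Cn n} (hz : z ∈ U) :
    emb (vDbar u α z) = cI p • (emb (dbar (vHodge G h u α) z) * wp (G z) (q + 1) +
      (-1 : ℂ) ^ p • (emb (vHodge G h u α z) * emb (dbar (fun w => omegaPow (G w) (q + 1)) z))) := by
  have hγ := contDiffOn_vHodge hG h hu α
  have hW := contDiffOn_omegaPow hG (q + 1)
  have hd : p + 2 * (q + 1) = n + (q + 1) := by omega
  have h1 : u α =ᶠ[𝓝 z] fun w => cI p • wedge hd (vHodge G h u α w) (omegaPow (G w) (q + 1)) := by
    refine Filter.eventually_of_mem (hU.mem_nhds hz) fun w hw' => ?_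
    rw [← emb_inj, emb_eq_vHodge hG hpq h hw α hw', map_smul, emb_wedge]
    rfl
  rw [vDbar, dbar_congr h1, dbar_const_smul _
    (differentiableAt_of_contDiffOn hU (contDiffOn_wedge hd hγ hW) hz), map_smul,
    emb_dbar_wedge hd (differentiableAt_of_contDiffOn hU hγ hz) (differentiableAt_of_contDiffOn hU hW hz)]
  rfl

/-- With ∂̄u in place of `v`, this makes □u equal to ∂̄∂̄*u for closed u. -/
theorem dbarStar_eq_zero (hU : IsOpen U) (hG : IsMetricOn U G) (h : m + 1 = k)
    {v : Fin r → Cn n → CForm n k} (hv : ∀ α, ∀ z ∈ U, v α z = 0) (α : Fin r) {z : Cn n} (hz : z ∈ U) :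
    dbarStar G H h v α z = 0 := by
  rw [dbarStar]
  -- For q = n the form ∂̄u has degree 2n + 1, and the second branch is the default value zero.
  split_ifs with hk
  · have h1 : ∀ β, vHodge (l := 2 * n - k) G (by omega) v β =ᶠ[𝓝 z] fun _ => 0 := fun β =>
      Filter.eventually_of_mem (hU.mem_nhds hz) fun w hw => by
        rw [vHodge, hv β w hw, hodge_zero (hG.posDef w hw)]
    have h2 : dPrime H (vHodge (l := 2 * n - k) G (by omega) v) α z = 0 := by
      rw [dPrime_congr (v := fun _ _ => 0) h1, ← emb_inj, emb_dPrime, del_zero]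
      simp
    rw [vHodge, h2, hodge_zero (hG.posDef z hz), neg_zero]
  · rfl

/-! ### The theorem in a chart -/

theorem topGE_of_emb {G : Matrix (Fin n) (Fin n) ℂ} {A : CForm n (2 * n)} {b : ℂ} {t : ℝ} (ht : 0 ≤ t)
    (h : emb A = (b + t) • wp G n) : TopGE G A (b • omegaPow G n) := by
  refine ⟨t, ht, ?_⟩
  rw [← emb_inj, map_add, map_smul, map_smul, ← add_smul, h]
  rfl

theorem chart_estimate (h1 : 1 ≤ q) (hq : q ≤ n) (hU : IsOpen U) (hG : IsMetricOn U G) (hH : IsMetricOn U H)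
    {u : Fin r → Cn n → CForm n (n + q)} (hu : ∀ α, ContDiffOn ℝ ∞ (u α) U)
    (hw : ∀ α, ∀ z ∈ U, HasWeight (n - q : ℕ) (u α z)) (hcl : ∀ α, ∀ z ∈ U, vDbar u α z = 0) {z : Cn n}
    (hz : z ∈ U) {K : ℝ} (hK : 0 ≤ K) (hβ1 : ComassLE (G z) K (dbar (fun w => omegaPow (G w) (q - 1)) z))
    (hβ2 : ComassLE (G z) K (dbar (fun w => omegaPow (G w) q) z))
    (hβ3 : ComassLE (G z) K (del (dbar fun w => omegaPow (G w) (q - 1)) z)) :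
    TopGE (G z) (ddbarTOmega G H h1 hq u z)
        (siuLowerBound G H h1 hq (comassConst n * K + 6 * (comassConst n * K) ^ 2) u z) ∧
      TopGE (G z) (ddbarTWedgeOmega G H h1 hq u z)
        (siuLowerBound G H h1 hq (comassConst n * K + 6 * (comassConst n * K) ^ 2) u z) := by
  -- The local lemmas use ω_q and ω_{q+1} for what the theorem calls ω_{q-1} and ω_q.
  obtain ⟨q, rfl⟩ : ∃ q', q = q' + 1 := ⟨q - 1, by omega⟩
  have hpq : n - (q + 1) + (q + 1) = n := by omega
  have h : n + (q + 1) + (n - (q + 1)) = 2 * n := by omega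
  have hbox : box G H (by omega) u = fun α w => dbarDbarStar G H (by omega) u α w +
    dbarStar G H rfl (vDbar u) α w := rfl
  have hb : vInner G H (box G H (by omega) u) u z =
      vin (G z) (H z) (fun α => dbarDbarStar G H (by omega) u α z) fun α => u α z := by
    rw [vInner, vin]
    simp only [hbox, dbarStar_eq_zero hU hG rfl hcl _ hz, add_zero]
  obtain ⟨s, t, hs, ht, e1, e2⟩ := local_estimate (p := n - (q + 1)) (q := q)
    (γ := vHodge G h u) (k := n + (q + 1)) (m := 2 * n - 2) (u := fun α => u α z)
    (v := fun α => dbarDbarStar G H (by omega) u α z) (C := fun α => curvLambda G H (by omega) u α z)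
    hU hG hH (contDiffOn_vHodge hG h hu) (hasWeight_vHodge hG h hw) hpq hz rfl
    (fun α => emb_eq_vHodge hG hpq h hw α hz) (fun α => emb_dbarDbarStar hU hG hH hu hw hpq h _ α hz)
    (fun α => emb_curvLambda hG hw hpq h _ α hz) (fun α => by
      have h2 := emb_vDbar hU hG hu hw hpq h α hz
      rw [hcl α z hz, map_zero] at h2
      exact (smul_eq_zero.mp h2.symm).resolve_left 
        (norm_ne_zero_iff.mp (by rw [norm_cI]; exact one_ne_zero)))
    hK hβ1 hβ2 hβ3 (by omega)
  rw [siuLowerBound, hb]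
  refine ⟨topGE_of_emb hs ?_, topGE_of_emb ht ?_⟩
  · rw [ddbarTOmega, emb_castForm, map_smul]
    exact e1
  · rw [ddbarTWedgeOmega, emb_wedge, map_smul]
    exact e2

theorem chart_identity (h1 : 1 ≤ q) (hq : q ≤ n) (hU : IsOpen U) (hG : IsMetricOn U G) (hH : IsMetricOn U H)
    {u : Fin r → Cn n → CForm n (n + q)} (hu : ∀ α, ContDiffOn ℝ ∞ (u α) U)
    (hw : ∀ α, ∀ z ∈ U, HasWeight (n - q : ℕ) (u α z))
    (hW : ∀ s, ∀ w ∈ U, dbar (fun w => omegaPow (G w) s) w = 0) {z : Cn n} (hz : z ∈ U) :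
    ddbarTOmega G H h1 hq u z = bochnerTerm G H h1 hq u z ∧
      ddbarTWedgeOmega G H h1 hq u z = bochnerTerm G H h1 hq u z := by
  obtain ⟨q, rfl⟩ : ∃ q', q = q' + 1 := ⟨q - 1, by omega⟩
  have hGz := hG.posDef z hz
  have hpq : n - (q + 1) + (q + 1) = n := by omega
  have h : n + (q + 1) + (n - (q + 1)) = 2 * n := by omega
  let η' : Fin r → CForm n (n + (q + 1) + 1) := fun α =>
    wedge (by omega) (dbar (vHodge G h u α) z) (omegaPow (G z) (q + 1))
  have hη' : ∀ α, emb (η' α) = emb (dbar (vHodge G h u α) z) * wp (G z) (q + 1) := fun α => emb_wedge _ _ _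
  obtain ⟨e1, e2⟩ := local_identity (p := n - (q + 1)) (q := q)
    (γ := vHodge G h u) (k := n + (q + 1)) (m := 2 * n - 2) (u := fun α => u α z)
    (v := fun α => dbarDbarStar G H (by omega) u α z) (C := fun α => curvLambda G H (by omega) u α z)
    hU hG hH (contDiffOn_vHodge hG h hu) (hasWeight_vHodge hG h hw) hpq hz rfl
    (fun α => emb_eq_vHodge hG hpq h hw α hz) (fun α => emb_dbarDbarStar hU hG hH hu hw hpq h _ α hz)
    (fun α => emb_curvLambda hG hw hpq h _ α hz) rfl hη' (hW q) (by omega)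
  have hnc := norm_cI (n - (q + 1))
  have f1 : vInner G H (vDbar u) (vDbar u) z = vin (G z) (H z) η' η' := by
    have h2 : (fun α => vDbar u α z) = fun α => cI (n - (q + 1)) • η' α := by
      funext α
      rw [← emb_inj, emb_vDbar hU hG hu hw hpq h α hz, hW _ z hz, map_smul, hη']
      simp
    have hcc : cI (n - (q + 1)) * conj (cI (n - (q + 1))) = 1 := cI_mul_conj _
    change vin (G z) (H z) (fun α => vDbar u α z) (fun α => vDbar u α z) = _
    rw [h2, vin_smul_left, vin_smul_right hGz, ← mul_assoc, hcc, one_mul]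
  have f2 : vInner G H (dbarStar (m := n + (q + 1) - 1) G H (by omega) u)
      (dbarStar (m := n + (q + 1) - 1) G H (by omega) u) z = vin (G z) (H z)
        (fun α => dPrime H (vHodge G h u) α z) fun α => dPrime H (vHodge G h u) α z := by
    refine vsq_of_primitive hGz (p := n - (q + 1) + 1) (s := q) (c := Complex.I * cI (n - (q + 1)))
      (fun α => ?_) (by omega) (by omega) (by rw [norm_mul, hnc]; simp)
      fun α => emb_dbarStar hU hG hH hu hw hpq h _ α hz
    exact_mod_cast hasWeight_dPrime hU hH (contDiffOn_vHodge hG h hu) (hasWeight_vHodge hG h hw) hz α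
  rw [bochnerTerm, f1, f2, ← emb_inj, ← emb_inj (b := _ • omegaPow (G z) n), map_smul]
  have e3 : emb (ddbarTWedgeOmega G H h1 hq u z) =
      (Complex.I • emb (del (dbar (tF H (vHodge G h u))) z)) * wp (G z) q := by
    rw [ddbarTWedgeOmega, emb_wedge, map_smul]
    rfl
  rw [e3]
  refine ⟨?_, e2⟩
  rw [ddbarTOmega, emb_castForm, map_smul]
  exact e1.trans e2

end DbarForms

end

section

namespace DbarForms

open scoped ComplexOrder MatrixOrder

variable {n r k l m : ℕ}

/-! ### Holomorphic changes of coordinates -/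

theorem extDeriv_eq_del_add_dbar (a : Cn n → CForm n k) (z : Cn n) :
    extDeriv a z = del a z + dbar a z := by
  rw [extDeriv, del, dbar, ← ContinuousAlternatingMap.alternatizeUncurryFin_add]
  congr 1
  ext v w
  simp only [add_apply, smul_apply, sub_apply, smul_eq_mul, ContinuousAlternatingMap.add_apply,
    ContinuousAlternatingMap.smul_apply, ContinuousAlternatingMap.sub_apply]
  ring

theorem pull_add (A : Cn n →L[ℝ] Cn n) (a b : CForm n k) : pull A (a + b) = pull A a + pull A b := rfl

theorem pull_smul (A : Cn n →L[ℝ] Cn n) (c : ℂ) (a : CForm n k) : pull A (c • a) = c • pull A a := rfl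

section Projection

variable {w : ℤ} {a : Cn n → CForm n k} {z : Cn n}

/-- For a of weight w, ∂a and ∂̄a are the parts of da of weights w+1 and w-1. Rotation by i
separates them, because i^{-2} = -1. In this form ∂̄ inherits naturality from d. -/
theorem dbar_eq_extDeriv (ha : DifferentiableAt ℝ a z) (h : ∀ᶠ x in 𝓝 z, HasWeight w (a x)) :
    dbar a z = (1 / 2 : ℂ) •
      (extDeriv a z - Complex.I ^ (-(w + 1)) • pull (mulC n Complex.I) (extDeriv a z)) := by
  rw [extDeriv_eq_del_add_dbar, pull_add, HasWeight.del ha h Complex.I (by simp),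
    HasWeight.dbar ha h Complex.I (by simp), smul_add (Complex.I ^ (-(w + 1))), smul_smul, smul_smul,
    ← zpow_add₀ Complex.I_ne_zero, ← zpow_add₀ Complex.I_ne_zero,
    show -(w + 1) + (w + 1) = 0 by ring, show -(w + 1) + (w - 1) = -2 by ring]
  ext v
  simp [zpow_neg]
  ring

theorem del_eq_extDeriv (ha : DifferentiableAt ℝ a z) (h : ∀ᶠ x in 𝓝 z, HasWeight w (a x)) :
    del a z = (1 / 2 : ℂ) •
      (extDeriv a z + Complex.I ^ (-(w + 1)) • pull (mulC n Complex.I) (extDeriv a z)) := by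
  rw [extDeriv_eq_del_add_dbar, pull_add, HasWeight.del ha h Complex.I (by simp),
    HasWeight.dbar ha h Complex.I (by simp), smul_add (Complex.I ^ (-(w + 1))), smul_smul, smul_smul,
    ← zpow_add₀ Complex.I_ne_zero, ← zpow_add₀ Complex.I_ne_zero,
    show -(w + 1) + (w + 1) = 0 by ring, show -(w + 1) + (w - 1) = -2 by ring]
  ext v
  simp [zpow_neg]
  ring

end Projection

theorem pull_mulC_comm {A : Cn n →L[ℝ] Cn n} (hA : ∀ v, A (Complex.I • v) = Complex.I • A v)
    (a : CForm n k) :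
    pull (mulC n Complex.I) (pull A a) = pull A (pull (mulC n Complex.I) a) := by
  ext v
  simp [hA]

section Pullback

variable {w : ℤ} {a b : Cn n → CForm n k} {F : Cn n → Cn n} {z : Cn n}

theorem extDeriv_of_eventually_pull (ha : DifferentiableAt ℝ a (F z)) (hF : ContDiffAt ℝ ∞ F z)
    (hab : ∀ᶠ x in 𝓝 z, b x = pull (fderiv ℝ F x) (a (F x))) :
    extDeriv b z = pull (fderiv ℝ F z) (extDeriv a (F z)) := by
  rw [Filter.EventuallyEq.extDeriv_eq hab]
  exact extDeriv_pullback ha hF (by simpa using ENat.LEInfty.out)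

/-- A holomorphic map commutes with d by pullback, and its complex-linear differential commutes with
rotation by i. -/
theorem dbar_of_eventually_pull (ha : DifferentiableAt ℝ a (F z)) (hb : DifferentiableAt ℝ b z)
    (hF : ContDiffAt ℝ ∞ F z) (hI : ∀ v, fderiv ℝ F z (Complex.I • v) = Complex.I • fderiv ℝ F z v)
    (hwa : ∀ᶠ x in 𝓝 (F z), HasWeight w (a x)) (hwb : ∀ᶠ x in 𝓝 z, HasWeight w (b x))
    (hab : ∀ᶠ x in 𝓝 z, b x = pull (fderiv ℝ F x) (a (F x))) :
    dbar b z = pull (fderiv ℝ F z) (dbar a (F z)) := by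
  rw [dbar_eq_extDeriv ha hwa, dbar_eq_extDeriv hb hwb, extDeriv_of_eventually_pull ha hF hab,
    pull_mulC_comm hI]
  rfl

theorem del_of_eventually_pull (ha : DifferentiableAt ℝ a (F z)) (hb : DifferentiableAt ℝ b z)
    (hF : ContDiffAt ℝ ∞ F z) (hI : ∀ v, fderiv ℝ F z (Complex.I • v) = Complex.I • fderiv ℝ F z v)
    (hwa : ∀ᶠ x in 𝓝 (F z), HasWeight w (a x)) (hwb : ∀ᶠ x in 𝓝 z, HasWeight w (b x))
    (hab : ∀ᶠ x in 𝓝 z, b x = pull (fderiv ℝ F x) (a (F x))) :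
    del b z = pull (fderiv ℝ F z) (del a (F z)) := by
  rw [del_eq_extDeriv ha hwa, del_eq_extDeriv hb hwb, extDeriv_of_eventually_pull ha hF hab,
    pull_mulC_comm hI]
  rfl

end Pullback

section Metric

variable {G G' : Matrix (Fin n) (Fin n) ℂ} {A : Cn n →L[ℝ] Cn n}

theorem omega_eq_pull (hG : G.PosDef) (hG' : G'.PosDef)
    (hI : ∀ v, A (Complex.I • v) = Complex.I • A v)
    (h : ∀ v w, riem G v w = riem G' (A v) (A w)) : omega G = pull A (omega G') := by
  ext v
  have h1 : v = ![v 0, v 1] := by ext i; fin_cases i <;> rfl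
  have h2 : (fun i => A (v i)) = ![A (v 0), A (v 1)] := by ext i; fin_cases i <;> rfl
  rw [pull_apply, h2, omega_apply hG', h1, omega_apply hG, h, hI]
  rfl

theorem omegaPow_eq_pull (hG : G.PosDef) (hG' : G'.PosDef)
    (hI : ∀ v, A (Complex.I • v) = Complex.I • A v)
    (h : ∀ v w, riem G v w = riem G' (A v) (A w)) (s : ℕ) : omegaPow G s = pull A (omegaPow G' s) := by
  induction s with
  | zero => rfl
  | succ s ih =>
    rw [omegaPow, omegaPow, pull_smul, ih, omega_eq_pull hG hG' hI h, wedge_pull]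

theorem ComassLE.pull {K : ℝ} {β : CForm n k} (hβ : ComassLE G' K β)
    (h : ∀ v w, riem G v w = riem G' (A v) (A w)) : ComassLE G K (pull A β) := by
  intro v
  simp only [h]
  exact hβ _

theorem comassLE_zero (G : Matrix (Fin n) (Fin n) ℂ) : ComassLE G 0 (0 : CForm n k) := by
  intro v
  simp

theorem ComassLE.mono {K K' : ℝ} {β : CForm n k} (hβ : ComassLE G K β) (h : K ≤ K') :
    ComassLE G K' β := fun v =>
  (hβ v).trans (mul_le_mul_of_nonneg_right h (Finset.prod_nonneg fun _ _ => Real.sqrt_nonneg _))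

end Metric

/-! ### Local bounds -/

/-- A metric is locally bounded below by a multiple of the Euclidean one. -/
theorem IsMetricOn.eventually_le_riem {U : Set (Cn n)} (hU : IsOpen U)
    {G : Cn n → Matrix (Fin n) (Fin n) ℂ} (hG : IsMetricOn U G) {z : Cn n} (hz : z ∈ U) :
    ∃ C : ℝ, 0 < C ∧ ∀ᶠ w in 𝓝 z, ∀ v, ‖v‖ ≤ C * Real.sqrt (riem (G w) v v) := by
  have hcont : ∀ w ∈ U, ∀ v : Cn n, ContinuousAt (fun p : Cn n × Cn n => riem (G p.1) p.2 p.2) (w, v) := by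
    intro w hw v
    have h1 : ∀ i j, ContinuousAt (fun p : Cn n × Cn n => G p.1 i j) (w, v) := fun i j =>
      ContinuousAt.comp (g := fun z => G z i j) (f := fun p : Cn n × Cn n => p.1)
        (x := (w, v)) ((hG.smooth i j).continuousOn.continuousAt (hU.mem_nhds hw)) continuousAt_fst
    have h2 : ∀ i, ContinuousAt (fun p : Cn n × Cn n => p.2 i) (w, v) := fun i => by fun_prop
    refine Complex.continuous_re.continuousAt.comp ?_
    refine tendsto_finsetSum _ fun i _ => tendsto_finsetSum _ fun j _ => ?_
    exact ((h1 i j).mul (h2 i)).mul (Complex.continuous_conj.continuousAt.comp (h2 j))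
  have hS : IsCompact (Metric.sphere (0 : Cn n) 1) := isCompact_sphere _ _
  obtain ⟨ε, hε, hlow⟩ : ∃ ε : ℝ, 0 < ε ∧ ∀ v ∈ Metric.sphere (0 : Cn n) 1, ε ≤ riem (G z) v v := by
    refine hS.exists_forall_le' (f := fun v => riem (G z) v v) (a := 0) ?_ fun v hv => ?_
    · intro v _
      exact ((hcont z hz v).comp (f := fun v : Cn n => (z, v)) (by fun_prop)).continuousWithinAt
    · exact riem_self_pos (hG.posDef z hz) (ne_zero_of_mem_unit_sphere ⟨v, hv⟩)
  have hev : ∀ᶠ w in 𝓝 z, ∀ v ∈ Metric.sphere (0 : Cn n) 1, ε / 2 < riem (G w) v v := by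
    -- Compactness of the unit sphere makes the lower bound uniform in the direction; homogeneity
    -- then gives it for all vectors.
    refine hS.eventually_forall_of_forall_eventually fun v hv => ?_
    exact (hcont z hz v).eventually (lt_mem_nhds (by linarith [hlow v hv]))
  refine ⟨(Real.sqrt (ε / 2))⁻¹, by positivity, hev.mono fun w hw v => ?_⟩
  by_cases hv : v = 0
  · simp [hv]; positivity
  have hn : 0 < ‖v‖ := norm_pos_iff.mpr hv
  have h1 := hw (((‖v‖⁻¹ : ℝ) : ℂ) • v) (by
    simp [norm_smul, hn.ne'])
  have h2 : riem (G w) (((‖v‖⁻¹ : ℝ) : ℂ) • v) (((‖v‖⁻¹ : ℝ) : ℂ) • v) = (‖v‖⁻¹) ^ 2 * riem (G w) v v := by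
    rw [riem, herm_smul_left, herm_smul_right, Complex.conj_ofReal, ← mul_assoc, ← Complex.ofReal_mul,
      Complex.re_ofReal_mul, riem, sq]
  rw [h2] at h1
  have h3 : ‖v‖ ^ 2 * (ε / 2) ≤ riem (G w) v v := by
    have := mul_le_mul_of_nonneg_left h1.le (sq_nonneg ‖v‖)
    rwa [← mul_assoc, ← mul_pow, mul_inv_cancel₀ hn.ne', one_pow, one_mul] at this
  have h4 := Real.sqrt_le_sqrt h3
  rw [Real.sqrt_mul (sq_nonneg _), Real.sqrt_sq hn.le] at h4
  rw [inv_mul_eq_div, le_div_iff₀ (by positivity)]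
  exact h4

/-- A continuous form has locally bounded comass. -/
theorem exists_eventually_comassLE {U : Set (Cn n)} (hU : IsOpen U)
    {G : Cn n → Matrix (Fin n) (Fin n) ℂ} (hG : IsMetricOn U G) {β : Cn n → CForm n k}
    (hβ : ContinuousOn β U) {z : Cn n} (hz : z ∈ U) :
    ∃ K : ℝ, 0 ≤ K ∧ ∀ᶠ w in 𝓝 z, ComassLE (G w) K (β w) := by
  obtain ⟨C, hC, hev⟩ := hG.eventually_le_riem hU hz
  have hb : ∀ᶠ w in 𝓝 z, ‖β w‖ < ‖β z‖ + 1 :=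
    (hβ.continuousAt (hU.mem_nhds hz)).norm.eventually (gt_mem_nhds (lt_add_one _))
  refine ⟨(‖β z‖ + 1) * C ^ k, by positivity, ?_⟩
  filter_upwards [hev, hb] with w hw hbw v
  calc ‖β w v‖ ≤ ‖β w‖ * ∏ i, ‖v i‖ := (β w).le_opNorm v
    _ ≤ (‖β z‖ + 1) * ∏ i, (C * Real.sqrt (riem (G w) (v i) (v i))) :=
        mul_le_mul hbw.le (Finset.prod_le_prod (fun _ _ => norm_nonneg _) fun i _ => hw (v i))
          (Finset.prod_nonneg fun _ _ => norm_nonneg _) (by positivity)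
    _ = _ := by
        rw [Finset.prod_mul_distrib, Finset.prod_const, Finset.card_univ, Fintype.card_fin, mul_assoc]

/-! ### Gram matrices of sesquilinear forms -/

section Sesq

variable {ι : Type*} [Fintype ι] [DecidableEq ι]
  (B : EuclideanSpace ℂ ι →ₗ⋆[ℂ] EuclideanSpace ℂ ι →ₗ[ℂ] ℂ)

/-- The global forms are conjugate linear in the first slot and the matrices linear in the first
index, hence the exchange of `v` and `w`. -/
theorem sum_gram_mul (v w : EuclideanSpace ℂ ι) :
    ∑ j, ∑ k, B (EuclideanSpace.single k 1) (EuclideanSpace.single j 1) * v j * conj (w k) = B w v := by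
  have h : ∀ x : EuclideanSpace ℂ ι, x = ∑ j, x j • EuclideanSpace.single j (1 : ℂ) := fun x => by
    ext i
    simp [Finset.sum_apply, Pi.single_apply]
  conv_rhs => rw [h v, h w]
  simp only [map_sum, LinearMap.sum_apply, map_smul, LinearMap.map_smulₛₗ, LinearMap.smul_apply,
    smul_eq_mul]
  refine Finset.sum_congr rfl fun j _ => ?_
  rw [Finset.mul_sum]
  exact Finset.sum_congr rfl fun k _ => by ring

theorem gram_posDef (hs : ∀ v w, conj (B v w) = B w v) (hp : ∀ v, v ≠ 0 → 0 < (B v v).re) :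
    Matrix.PosDef (fun j k => B (EuclideanSpace.single k 1) (EuclideanSpace.single j 1) :
      Matrix ι ι ℂ) := by
  refine Matrix.PosDef.of_dotProduct_mulVec_pos ?_ fun {x} hx => ?_
  · ext j k
    exact hs _ _
  · have h1 := sum_gram_mul B (WithLp.toLp 2 (star x)) (WithLp.toLp 2 (star x))
    have h2 : WithLp.toLp 2 (star x) ≠ 0 := by
      intro h0
      apply hx
      have := congrArg WithLp.ofLp h0
      simpa using this
    have h3 : star x ⬝ᵥ Matrix.mulVec (fun j k => B (EuclideanSpace.single k 1)
        (EuclideanSpace.single j 1) : Matrix ι ι ℂ) x =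
        B (WithLp.toLp 2 (star x)) (WithLp.toLp 2 (star x)) := by
      rw [← h1]
      simp only [dotProduct, Matrix.mulVec, Finset.mul_sum]
      refine Finset.sum_congr rfl fun j _ => Finset.sum_congr rfl fun k _ => ?_
      simp
      ring
    rw [h3, Complex.pos_iff]
    refine ⟨hp _ h2, ?_⟩
    exact (Complex.conj_eq_iff_im.mp (hs _ _)).symm

end Sesq

end DbarForms

end

section

namespace DbarForms

open scoped ComplexOrder MatrixOrder

variable {n r k l m : ℕ}

/-! ### Metrics in charts -/

/-- The pullback of a sesquilinear form by a linear map. -/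
noncomputable def sesqComp {V W : Type*} [AddCommGroup V] [Module ℂ V] [AddCommGroup W] [Module ℂ W]
    (B : V →ₗ⋆[ℂ] V →ₗ[ℂ] ℂ) (A : W →ₗ[ℂ] V) : W →ₗ⋆[ℂ] W →ₗ[ℂ] ℂ :=
  LinearMap.mk₂'ₛₗ (starRingEnd ℂ) (RingHom.id ℂ) (fun v w => B (A v) (A w))
    (fun _ _ _ => by simp) (fun _ _ _ => by simp) (fun _ _ _ => by simp) (fun _ _ _ => by simp)

variable {X : Type*} [TopologicalSpace X]

/-- The coordinate change from `φ` to `φ'`. -/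
noncomputable def transition (φ φ' : OpenPartialHomeomorph X (Cn n)) (z : Cn n) : Cn n := φ' (φ.symm z)

theorem eventually_mem_overlap {φ φ' : OpenPartialHomeomorph X (Cn n)} {z : Cn n} (hz : z ∈ φ.target) (hz' : φ.symm z ∈ φ'.source) :
    ∀ᶠ w in 𝓝 z, w ∈ φ.target ∧ φ.symm w ∈ φ'.source :=
  Filter.Eventually.and (φ.open_target.mem_nhds hz)
    ((φ.continuousAt_symm hz).eventually (φ'.open_source.mem_nhds hz'))

variable [ChartedSpace (Cn n) X]

theorem herm_gram (g : HermitianMetric n X) (φ : OpenPartialHomeomorph X (Cn n)) (z v w : Cn n) :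
    herm (g.gram φ z) v w = g.toFun (φ.symm z) (chartFrame φ z w) (chartFrame φ z v) :=
  sum_gram_mul (sesqComp (g.toFun (φ.symm z)) (chartFrame φ z)) v w

section Manifold

variable [IsManifold 𝓘(ℂ, Cn n) ω X] {φ φ' : OpenPartialHomeomorph X (Cn n)}

theorem mdifferentiable_of_atlas (hφ : φ ∈ atlas (Cn n) X) :
    φ.MDifferentiable 𝓘(ℂ, Cn n) 𝓘(ℂ, Cn n) := by
  have : IsManifold 𝓘(ℂ, Cn n) 1 X := IsManifold.of_le (n := ω) le_top
  exact mdifferentiable_of_mem_atlas hφ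

theorem chartFrame_injective (hφ : φ ∈ atlas (Cn n) X) {z : Cn n} (hz : z ∈ φ.target) :
    Function.Injective (chartFrame φ z) := by
  have h := (mdifferentiable_of_atlas hφ).comp_symm_deriv hz
  intro v w hvw
  have h1 := DFunLike.congr_fun h v
  have h2 := DFunLike.congr_fun h w
  have h3 : (mfderiv 𝓘(ℂ, Cn n) 𝓘(ℂ, Cn n) φ.symm z) v = (mfderiv 𝓘(ℂ, Cn n) 𝓘(ℂ, Cn n) φ.symm z) w := hvw
  exact h1.symm.trans ((congrArg (mfderiv 𝓘(ℂ, Cn n) 𝓘(ℂ, Cn n) φ (φ.symm z)) h3).trans h2)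

theorem isMetricOn_gram (g : HermitianMetric n X) (hφ : φ ∈ atlas (Cn n) X) :
    IsMetricOn φ.target (g.gram φ) where
  smooth _ _ := g.smooth φ hφ _ _
  posDef z hz := gram_posDef (sesqComp (g.toFun (φ.symm z)) (chartFrame φ z))
    (fun _ _ => g.conj_symm _ _ _) fun v hv => g.pos _ _ fun h0 => hv <| by
      apply chartFrame_injective hφ hz
      rw [h0, map_zero]

variable {z : Cn n}

theorem contDiffAt_transition (hφ : φ ∈ atlas (Cn n) X) (hφ' : φ' ∈ atlas (Cn n) X)
    (hz : z ∈ φ.target) (hz' : φ.symm z ∈ φ'.source) : ContDiffAt ℂ ω (transition φ φ') z := by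
  have h := (HasGroupoid.compatible hφ hφ' : φ.symm.trans φ' ∈ contDiffGroupoid ω 𝓘(ℂ, Cn n))
  rw [contDiffGroupoid, mem_groupoid_of_pregroupoid] at h
  have h2 : ContDiffOn ℂ ω (transition φ φ') (φ.symm.trans φ').source := by
    have := h.1
    simp only [contDiffPregroupoid] at this
    have h3 : ContDiffOn ℂ ω (fun w => φ' (φ.symm w)) (φ.symm.trans φ').source := by
      simpa [Function.comp_def] using this
    exact h3
  refine h2.contDiffAt ((φ.symm.trans φ').open_source.mem_nhds ?_)
  simpa using ⟨hz, hz'⟩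

theorem fderiv_transition (hφ : φ ∈ atlas (Cn n) X) (hφ' : φ' ∈ atlas (Cn n) X)
    (hz : z ∈ φ.target) (hz' : φ.symm z ∈ φ'.source) :
    fderiv ℝ (transition φ φ') z = (fderiv ℂ (transition φ φ') z).restrictScalars ℝ :=
  (((contDiffAt_transition hφ hφ' hz hz').differentiableAt (by simp)).hasFDerivAt.restrictScalars ℝ).fderiv

/-- Both charts describe the same metric, and the chain rule relates their coordinate frames.
Coordinate changes are thus isometries for the Gram matrices. -/
theorem gram_transition (g : HermitianMetric n X) (hφ : φ ∈ atlas (Cn n) X)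
    (hφ' : φ' ∈ atlas (Cn n) X) (hz : z ∈ φ.target) (hz' : φ.symm z ∈ φ'.source) (v w : Cn n) :
    herm (g.gram φ z) v w = herm (g.gram φ' (transition φ φ' z))
      (fderiv ℝ (transition φ φ') z v) (fderiv ℝ (transition φ φ') z w) := by
  have hx : φ'.symm (transition φ φ' z) = φ.symm z := φ'.left_inv hz'
  have hd : ∀ v : Cn n, (mfderiv 𝓘(ℂ, Cn n) 𝓘(ℂ, Cn n) φ.symm z : Cn n →L[ℂ] Cn n) v =
      (mfderiv 𝓘(ℂ, Cn n) 𝓘(ℂ, Cn n) φ'.symm (transition φ φ' z) : Cn n →L[ℂ] Cn n)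
        (fderiv ℂ (transition φ φ') z v) := by
    intro v
    have hev : φ.symm =ᶠ[𝓝 z] φ'.symm ∘ transition φ φ' :=
      (eventually_mem_overlap hz hz').mono fun w hw => (φ'.left_inv hw.2).symm
    have h1 := hev.mfderiv_eq (I := 𝓘(ℂ, Cn n)) (I' := 𝓘(ℂ, Cn n))
    have h2 := mfderiv_comp (I := 𝓘(ℂ, Cn n)) (I' := 𝓘(ℂ, Cn n)) (I'' := 𝓘(ℂ, Cn n)) z
      (g := φ'.symm) (f := transition φ φ')
      ((mdifferentiable_of_atlas hφ').mdifferentiableAt_symm (φ'.map_source hz'))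
      ((contDiffAt_transition hφ hφ' hz hz').differentiableAt (by simp)).mdifferentiableAt
    rw [mfderiv_eq_fderiv] at h2
    exact DFunLike.congr_fun (h1.trans h2) v
  have key : ∀ (x y : X), x = y → ∀ a b : Cn n, g.toFun x a b = g.toFun y a b := by
    rintro x _ rfl a b
    rfl
  rw [herm_gram, herm_gram, fderiv_transition hφ hφ' hz hz']
  refine Eq.trans ?_ (key _ _ hx _ _).symm
  have e1 := hd v
  have e2 := hd w
  exact congrArg₂ (fun a b : Cn n => g.toFun (φ.symm z) a b) e2 e1

end Manifold

end DbarForms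

end

section

namespace DbarForms

open scoped ComplexOrder MatrixOrder

variable {n r k l m : ℕ}

/-! ### The torsion of the metric -/

variable {X : Type*} [TopologicalSpace X] [ChartedSpace (Cn n) X]
  {φ φ' : OpenPartialHomeomorph X (Cn n)} {z : Cn n}

/-- The forms `∂̄ω_{q-1}`, `∂̄ω_q` and `∂∂̄ω_{q-1}` have comass at most `K` at the point `z` of the
chart `φ`. -/
def TorsionLE (g : HermitianMetric n X) (q : ℕ) (K : ℝ) (φ : OpenPartialHomeomorph X (Cn n))
    (z : Cn n) : Prop :=
  ComassLE (g.gram φ z) K (dbar (fun w => omegaPow (g.gram φ w) (q - 1)) z) ∧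
  ComassLE (g.gram φ z) K (dbar (fun w => omegaPow (g.gram φ w) q) z) ∧
  ComassLE (g.gram φ z) K (del (dbar fun w => omegaPow (g.gram φ w) (q - 1)) z)

theorem torsionLE_zero {g : HermitianMetric n X} {q : ℕ} (h1 : g.DbarOmegaPowEqZero (q - 1))
    (h2 : g.DbarOmegaPowEqZero q) (hφ : φ ∈ atlas (Cn n) X) (hz : z ∈ φ.target) :
    TorsionLE g q 0 φ z := by
  have h3 : del (dbar fun w => omegaPow (g.gram φ w) (q - 1)) z = 0 := by
    rw [del_congr (b := fun _ => 0)
      (Filter.Eventually.mono (φ.open_target.mem_nhds hz) fun w hw => h1 φ hφ w hw), del_zero]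
  rw [TorsionLE, h1 φ hφ z hz, h2 φ hφ z hz, h3]
  exact ⟨comassLE_zero _, comassLE_zero _, comassLE_zero _⟩

variable [IsManifold 𝓘(ℂ, Cn n) ω X]

theorem fderiv_transition_I (hφ : φ ∈ atlas (Cn n) X) (hφ' : φ' ∈ atlas (Cn n) X)
    (hz : z ∈ φ.target) (hz' : φ.symm z ∈ φ'.source) (v : Cn n) :
    fderiv ℝ (transition φ φ') z (Complex.I • v) = Complex.I • fderiv ℝ (transition φ φ') z v := by
  rw [fderiv_transition hφ hφ' hz hz']
  exact map_smul (fderiv ℂ (transition φ φ') z) Complex.I v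

theorem contDiffAt_real_transition (hφ : φ ∈ atlas (Cn n) X) (hφ' : φ' ∈ atlas (Cn n) X)
    (hz : z ∈ φ.target) (hz' : φ.symm z ∈ φ'.source) : ContDiffAt ℝ ∞ (transition φ φ') z :=
  ((contDiffAt_transition hφ hφ' hz hz').restrict_scalars ℝ).of_le le_top

theorem differentiableAt_omegaPow_gram (g : HermitianMetric n X) (hφ : φ ∈ atlas (Cn n) X)
    (hz : z ∈ φ.target) (s : ℕ) : DifferentiableAt ℝ (fun w => omegaPow (g.gram φ w) s) z :=
  differentiableAt_of_contDiffOn φ.open_target (contDiffOn_omegaPow (isMetricOn_gram g hφ) s) hz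

theorem contDiffOn_dbar_omegaPow_gram (g : HermitianMetric n X) (hφ : φ ∈ atlas (Cn n) X) (s : ℕ) :
    ContDiffOn ℝ ∞ (dbar fun w => omegaPow (g.gram φ w) s) φ.target :=
  contDiffOn_dbar φ.open_target (contDiffOn_omegaPow (isMetricOn_gram g hφ) s)

theorem hasWeight_dbar_omegaPow_gram (g : HermitianMetric n X) (hφ : φ ∈ atlas (Cn n) X)
    (hz : z ∈ φ.target) (s : ℕ) : HasWeight (0 - 1) (dbar (fun w => omegaPow (g.gram φ w) s) z) :=
  HasWeight.dbar (differentiableAt_omegaPow_gram g hφ hz s)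
    (Filter.Eventually.of_forall fun _ => hasWeight_omegaPow s)

theorem riem_transition (g : HermitianMetric n X) (hφ : φ ∈ atlas (Cn n) X) (hφ' : φ' ∈ atlas (Cn n) X)
    (hz : z ∈ φ.target) (hz' : φ.symm z ∈ φ'.source)
    (v w : Cn n) : riem (g.gram φ z) v w = riem (g.gram φ' (transition φ φ' z))
    (fderiv ℝ (transition φ φ') z v) (fderiv ℝ (transition φ φ') z w) :=
  congrArg Complex.re (gram_transition g hφ hφ' hz hz' v w)

theorem omegaPow_transition (g : HermitianMetric n X) (hφ : φ ∈ atlas (Cn n) X) (hφ' : φ' ∈ atlas (Cn n) X)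
    (hz : z ∈ φ.target) (hz' : φ.symm z ∈ φ'.source)
    (s : ℕ) : omegaPow (g.gram φ z) s =
    pull (fderiv ℝ (transition φ φ') z) (omegaPow (g.gram φ' (transition φ φ' z)) s) :=
  omegaPow_eq_pull ((isMetricOn_gram g hφ).posDef z hz)
    ((isMetricOn_gram g hφ').posDef _ (φ'.map_source hz')) (fderiv_transition_I hφ hφ' hz hz')
    (riem_transition g hφ hφ' hz hz') s

theorem dbar_omegaPow_transition (g : HermitianMetric n X) (hφ : φ ∈ atlas (Cn n) X) (hφ' : φ' ∈ atlas (Cn n) X)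
    (hz : z ∈ φ.target) (hz' : φ.symm z ∈ φ'.source)
    (s : ℕ) : dbar (fun w => omegaPow (g.gram φ w) s) z =
    pull (fderiv ℝ (transition φ φ') z)
      (dbar (fun w => omegaPow (g.gram φ' w) s) (transition φ φ' z)) :=
  dbar_of_eventually_pull (w := 0) (differentiableAt_omegaPow_gram g hφ' (φ'.map_source hz') s)
    (differentiableAt_omegaPow_gram g hφ hz s) (contDiffAt_real_transition hφ hφ' hz hz')
    (fderiv_transition_I hφ hφ' hz hz') (Filter.Eventually.of_forall fun _ => hasWeight_omegaPow s)
    (Filter.Eventually.of_forall fun _ => hasWeight_omegaPow s)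
    ((eventually_mem_overlap hz hz').mono fun _ hw => omegaPow_transition g hφ hφ' hw.1 hw.2 s)

theorem del_dbar_omegaPow_transition (g : HermitianMetric n X) (hφ : φ ∈ atlas (Cn n) X) (hφ' : φ' ∈ atlas (Cn n) X)
    (hz : z ∈ φ.target) (hz' : φ.symm z ∈ φ'.source)
    (s : ℕ) : del (dbar fun w => omegaPow (g.gram φ w) s) z =
    pull (fderiv ℝ (transition φ φ') z)
      (del (dbar fun w => omegaPow (g.gram φ' w) s) (transition φ φ' z)) :=
  del_of_eventually_pull (w := 0 - 1)
    (differentiableAt_of_contDiffOn φ'.open_target (contDiffOn_dbar_omegaPow_gram g hφ' s)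
      (φ'.map_source hz'))
    (differentiableAt_of_contDiffOn φ.open_target (contDiffOn_dbar_omegaPow_gram g hφ s) hz)
    (contDiffAt_real_transition hφ hφ' hz hz') (fderiv_transition_I hφ hφ' hz hz')
    (Filter.Eventually.mono (φ'.open_target.mem_nhds (φ'.map_source hz'))
      fun _ hw => hasWeight_dbar_omegaPow_gram g hφ' hw s)
    (Filter.Eventually.mono (φ.open_target.mem_nhds hz)
      fun _ hw => hasWeight_dbar_omegaPow_gram g hφ hw s)
    ((eventually_mem_overlap hz hz').mono fun _ hw => dbar_omegaPow_transition g hφ hφ' hw.1 hw.2 s)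

/-- The three torsion forms are natural under holomorphic coordinate changes, and comass is
invariant under isometries. -/
theorem TorsionLE.of_transition {g : HermitianMetric n X} {q : ℕ} {K : ℝ}
    (hφ : φ ∈ atlas (Cn n) X) (hφ' : φ' ∈ atlas (Cn n) X) (hz : z ∈ φ.target)
    (hz' : φ.symm z ∈ φ'.source) (h : TorsionLE g q K φ' (transition φ φ' z)) :
    TorsionLE g q K φ z := by
  have hr := riem_transition g hφ hφ' hz hz'
  refine ⟨?_, ?_, ?_⟩
  · rw [dbar_omegaPow_transition g hφ hφ' hz hz']
    exact h.1.pull hr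
  · rw [dbar_omegaPow_transition g hφ hφ' hz hz']
    exact h.2.1.pull hr
  · rw [del_dbar_omegaPow_transition g hφ hφ' hz hz']
    exact h.2.2.pull hr

/-- A bound near each point in a single chart passes to every chart of the atlas, which may be
infinite; compactness then gives one bound for all points. -/
theorem exists_torsionLE [CompactSpace X] (g : HermitianMetric n X) (q : ℕ) :
    ∃ K : ℝ, 0 ≤ K ∧ ∀ φ ∈ atlas (Cn n) X, ∀ z ∈ φ.target, TorsionLE g q K φ z := by
  suffices h : ∃ K : ℝ, 0 ≤ K ∧ ∀ x ∈ (Set.univ : Set X), ∀ φ ∈ atlas (Cn n) X, x ∈ φ.source →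
      TorsionLE g q K φ (φ x) by
    obtain ⟨K, hK, h⟩ := h
    refine ⟨K, hK, fun φ hφ z hz => ?_⟩
    have := h (φ.symm z) trivial φ hφ (φ.map_target hz)
    rwa [φ.right_inv hz] at this
  refine isCompact_univ.induction_on (p := fun S : Set X => ∃ K : ℝ, 0 ≤ K ∧ ∀ x ∈ S,
    ∀ φ ∈ atlas (Cn n) X, x ∈ φ.source → TorsionLE g q K φ (φ x)) ?_ ?_ ?_ ?_
  · exact ⟨0, le_rfl, fun x hx => absurd hx (Set.notMem_empty x)⟩
  · rintro S T hST ⟨K, hK, h⟩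
    exact ⟨K, hK, fun x hx => h x (hST hx)⟩
  · rintro S T ⟨K, hK, h⟩ ⟨K', hK', h'⟩
    refine ⟨max K K', le_max_of_le_left hK, fun x hx φ hφ hxφ => ?_⟩
    rcases hx with hx | hx
    · exact (h x hx φ hφ hxφ).imp (·.mono (le_max_left _ _))
        (And.imp (·.mono (le_max_left _ _)) (·.mono (le_max_left _ _)))
    · exact (h' x hx φ hφ hxφ).imp (·.mono (le_max_right _ _))
        (And.imp (·.mono (le_max_right _ _)) (·.mono (le_max_right _ _)))
  · intro x _
    let ψ := chartAt (Cn n) x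
    have hψ : ψ ∈ atlas (Cn n) X := chart_mem_atlas _ x
    have hx : x ∈ ψ.source := mem_chart_source _ x
    have hm := isMetricOn_gram g hψ
    have hz := ψ.map_source hx
    have hc := fun s => contDiffOn_dbar_omegaPow_gram g hψ s
    obtain ⟨K1, hK1, h1⟩ := exists_eventually_comassLE ψ.open_target hm (hc (q - 1)).continuousOn hz
    obtain ⟨K2, hK2, h2⟩ := exists_eventually_comassLE ψ.open_target hm (hc q).continuousOn hz
    obtain ⟨K3, hK3, h3⟩ := exists_eventually_comassLE ψ.open_target hm
      (contDiffOn_del ψ.open_target (hc (q - 1))).continuousOn hz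
    have hev : ∀ᶠ w in 𝓝 (ψ x), TorsionLE g q (max K1 (max K2 K3)) ψ w := by
      filter_upwards [h1, h2, h3] with w h1 h2 h3
      exact ⟨h1.mono (le_max_left _ _), h2.mono ((le_max_left _ _).trans (le_max_right _ _)),
        h3.mono ((le_max_right _ _).trans (le_max_right _ _))⟩
    have hev' := (ψ.continuousAt hx).eventually hev
    refine ⟨{y | y ∈ ψ.source ∧ TorsionLE g q (max K1 (max K2 K3)) ψ (ψ y)},
      mem_nhdsWithin_of_mem_nhds (Filter.Eventually.and (ψ.open_source.mem_nhds hx) hev'),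
      max K1 (max K2 K3), le_max_of_le_left hK1, fun y hy φ hφ hyφ => ?_⟩
    have hy' : φ.symm (φ y) = y := φ.left_inv hyφ
    refine TorsionLE.of_transition hφ hψ (φ.map_source hyφ) (by rw [hy']; exact hy.1) ?_
    rw [transition, hy']
    exact hy.2

/-- As ω has pure weight, dω = 0 forces ∂̄ω = 0, and the Leibniz rule passes this to every ω_s. -/
theorem HermitianMetric.IsKahler.dbarOmegaPowEqZero {g : HermitianMetric n X} (hg : g.IsKahler)
    (s : ℕ) : g.DbarOmegaPowEqZero s := by
  intro φ hφ z hz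
  have hd : DifferentiableAt ℝ (fun w => omega (g.gram φ w)) z :=
    differentiableAt_of_contDiffOn φ.open_target (contDiffOn_omega (isMetricOn_gram g hφ)) hz
  have h0 : dbar (fun w => omega (g.gram φ w)) z = 0 := by
    rw [dbar_eq_extDeriv (w := 0) hd (Filter.Eventually.of_forall fun _ => hasWeight_omega),
      hg φ hφ z hz]
    ext v
    simp
  induction s with
  | zero =>
    rw [← emb_inj, emb_dbar]
    simp [omegaPow, pdb]
  | succ s ih =>
    have hds := differentiableAt_omegaPow_gram g hφ hz s
    have hw : DifferentiableAt ℝ (fun w => wedge (by omega : 2 * s + 2 = 2 * (s + 1))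
        (omegaPow (g.gram φ w) s) (omega (g.gram φ w))) z :=
      differentiableAt_of_contDiffOn φ.open_target
        (contDiffOn_wedge _ (contDiffOn_omegaPow (isMetricOn_gram g hφ) s)
          (contDiffOn_omega (isMetricOn_gram g hφ))) hz
    simp only [omegaPow]
    rw [dbar_const_smul _ hw, ← emb_inj, map_smul, emb_dbar_wedge _ hds hd, ih, h0]
    simp

end DbarForms

end

section

namespace DbarForms

open scoped ComplexOrder MatrixOrder

variable {n r k l m : ℕ}

/-! ### Bundle-valued forms in local frames -/

theorem isOpen_domainOf {X : Type*} [TopologicalSpace X]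
    {E L : X → Type*}
    [TopologicalSpace (Bundle.TotalSpace (Cn r) E)] [TopologicalSpace (Bundle.TotalSpace ℂ L)]
    (φ : OpenPartialHomeomorph X (Cn n))
    (e : Bundle.Trivialization (Cn r) (Bundle.TotalSpace.proj : Bundle.TotalSpace (Cn r) E → X))
    (e' : Bundle.Trivialization ℂ (Bundle.TotalSpace.proj : Bundle.TotalSpace ℂ L → X)) :
    IsOpen (domainOf φ e e') :=
  φ.isOpen_inter_preimage_symm (e.open_baseSet.inter e'.open_baseSet)

theorem chartFrame_smul {X : Type*} [TopologicalSpace X]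
    [ChartedSpace (Cn n) X] (φ : OpenPartialHomeomorph X (Cn n)) (z : Cn n) (ζ : ℂ) (v : Cn n) :
    chartFrame φ z (ζ • v) = ζ • chartFrame φ z v := map_smul _ _ _

section Bundle

variable {X : Type*} [TopologicalSpace X] [ChartedSpace (Cn n) X] {E L : X → Type*}
  [∀ x, AddCommGroup (E x)] [∀ x, Module ℂ (E x)] [∀ x, TopologicalSpace (E x)]
  [TopologicalSpace (Bundle.TotalSpace (Cn r) E)] [FiberBundle (Cn r) E] [VectorBundle ℂ (Cn r) E]
  [∀ x, AddCommGroup (L x)] [∀ x, Module ℂ (L x)] [∀ x, TopologicalSpace (L x)]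
  [TopologicalSpace (Bundle.TotalSpace ℂ L)] [FiberBundle ℂ L] [VectorBundle ℂ ℂ L]
  {φ : OpenPartialHomeomorph X (Cn n)}

theorem symmₗ_ne_zero {F : Type*} [NormedAddCommGroup F] [NormedSpace ℂ F] {V : X → Type*}
    [∀ x, AddCommGroup (V x)] [∀ x, Module ℂ (V x)] [∀ x, TopologicalSpace (V x)]
    [TopologicalSpace (Bundle.TotalSpace F V)] [FiberBundle F V] [VectorBundle ℂ F V]
    (e : Bundle.Trivialization F (Bundle.TotalSpace.proj : Bundle.TotalSpace F V → X))
    [MemTrivializationAtlas e] {x : X} (hx : x ∈ e.baseSet) {v : F} (hv : v ≠ 0) :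
    e.symmₗ ℂ x v ≠ 0 := by
  intro h
  apply hv
  rw [← e.linearMapAt_symmₗ (R := ℂ) hx v, h, map_zero]

/-- Positivity holds because the factor contributed by L is a positive real number. -/
theorem isMetricOn_tensorGram (hE : BundleMetric (n := n) (Cn r) E)
    (hL : BundleMetric (n := n) ℂ L) (hφ : φ ∈ atlas (Cn n) X)
    (e : Bundle.Trivialization (Cn r) (Bundle.TotalSpace.proj : Bundle.TotalSpace (Cn r) E → X))
    [MemTrivializationAtlas e]
    (e' : Bundle.Trivialization ℂ (Bundle.TotalSpace.proj : Bundle.TotalSpace ℂ L → X))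
    [MemTrivializationAtlas e'] :
    IsMetricOn (domainOf φ e e') (tensorGram hE hL φ e e') where
  smooth α β :=
    ((hE.smooth φ hφ e _ _).mono fun _ hz => ⟨hz.1, hz.2.1⟩).mul
      ((hL.smooth φ hφ e' _ _).mono fun _ hz => ⟨hz.1, hz.2.2⟩)
  posDef z hz := by
    set t := hL.toFun (φ.symm z) (e'.symmₗ ℂ (φ.symm z) 1) (e'.symmₗ ℂ (φ.symm z) 1) with ht
    have ht1 : 0 < t.re := hL.pos _ _ (symmₗ_ne_zero e' hz.2.2 one_ne_zero)
    have ht2 : conj t = t := hL.conj_symm _ _ _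
    have ht3 : t.im = 0 := Complex.conj_eq_iff_im.mp ht2
    let B := t • sesqComp (hE.toFun (φ.symm z)) (e.symmₗ ℂ (φ.symm z))
    have hB : ∀ v w, B v w = t * hE.toFun (φ.symm z) (e.symmₗ ℂ (φ.symm z) v)
        (e.symmₗ ℂ (φ.symm z) w) := fun _ _ => rfl
    have h := gram_posDef B (fun v w => by rw [hB, hB, map_mul, ht2, hE.conj_symm])
      (fun v hv => by
        rw [hB, Complex.mul_re, ht3, zero_mul, sub_zero]
        exact mul_pos ht1 (hE.pos _ _ (symmₗ_ne_zero e hz.2.1 hv)))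
    have h2 : tensorGram hE hL φ e e' z =
        fun j k => B (EuclideanSpace.single k 1) (EuclideanSpace.single j 1) := by
      ext α β
      rw [hB, mul_comm]
      rfl
    rw [h2]
    exact h

/-- On unit numbers conj ζ = ζ⁻¹, so ζ^p (conj ζ)^q = ζ^{p-q}; the frame of the chart is complex
linear. -/
theorem hasWeight_localForm {p q : ℕ} {u : BundleForm n (p + q) E L}
    (hu : BundleForm.IsType (p := p) (q := q) u) (φ : OpenPartialHomeomorph X (Cn n))
    (e : Bundle.Trivialization (Cn r) (Bundle.TotalSpace.proj : Bundle.TotalSpace (Cn r) E → X))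
    [MemTrivializationAtlas e]
    (e' : Bundle.Trivialization ℂ (Bundle.TotalSpace.proj : Bundle.TotalSpace ℂ L → X))
    [MemTrivializationAtlas e'] (α : Fin r) (z : Cn n) :
    HasWeight ((p : ℤ) - q) (localForm φ e e' u α z) := by
  rw [hasWeight_iff]
  intro ζ hζ v
  have hζ0 : ζ ≠ 0 := fun h => by simp [h] at hζ
  have h1 : conj ζ = ζ⁻¹ := (Complex.inv_eq_conj hζ).symm
  change tensorCoord e e' (φ.symm z) α (u (φ.symm z) fun i => chartFrame φ z (ζ • v i)) =
    ζ ^ ((p : ℤ) - q) * tensorCoord e e' (φ.symm z) α (u (φ.symm z) fun i => chartFrame φ z (v i))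
  simp only [chartFrame_smul]
  rw [hu, map_smul, smul_eq_mul, h1, zpow_sub₀ hζ0, inv_pow, div_eq_mul_inv, zpow_natCast, zpow_natCast]

end Bundle

end DbarForms

end

/-! ### The global theorem: one torsion bound for all charts and bundles. -/

theorem mainTheorem7 (n q : ℕ) (h1 : 1 ≤ q) (hq : q ≤ n) {X : Type*} [TopologicalSpace X]
    [T2Space X] [CompactSpace X] [ChartedSpace (Cn n) X]
    [IsManifold 𝓘(ℂ, Cn n) ω X] (g : HermitianMetric n X) :
    ∃ c : ℝ, 0 ≤ c ∧
      (g.DbarOmegaPowEqZero (q - 1) → g.DbarOmegaPowEqZero q → c = 0) ∧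
      (g.IsKahler → c = 0) ∧
      ∀ (r : ℕ) (E L : X → Type*)
        [∀ x, AddCommGroup (E x)] [∀ x, Module ℂ (E x)] [∀ x, TopologicalSpace (E x)]
        [TopologicalSpace (Bundle.TotalSpace (Cn r) E)]
        [FiberBundle (Cn r) E] [VectorBundle ℂ (Cn r) E]
        [ContMDiffVectorBundle ω (Cn r) E 𝓘(ℂ, Cn n)]
        [∀ x, AddCommGroup (L x)] [∀ x, Module ℂ (L x)] [∀ x, TopologicalSpace (L x)]
        [TopologicalSpace (Bundle.TotalSpace ℂ L)]
        [FiberBundle ℂ L] [VectorBundle ℂ ℂ L]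
        [ContMDiffVectorBundle ω ℂ L 𝓘(ℂ, Cn n)]
        (hE : BundleMetric (n := n) (Cn r) E)
        (hL : BundleMetric (n := n) ℂ L)
        (u : BundleForm n (n + q) E L),
        BundleForm.IsSmooth (r := r) u → BundleForm.IsType (p := n) (q := q) u →
        ∀ φ ∈ atlas (Cn n) X,
        ∀ (e : Bundle.Trivialization (Cn r) (Bundle.TotalSpace.proj :
            Bundle.TotalSpace (Cn r) E → X)) [MemTrivializationAtlas e]
          (e' : Bundle.Trivialization ℂ (Bundle.TotalSpace.proj : Bundle.TotalSpace ℂ L → X))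
          [MemTrivializationAtlas e'],
        ∀ z ∈ domainOf φ e e',
          (BundleForm.DbarClosed (r := r) u →
            TopGE (g.gram φ z)
                (ddbarTOmega (g.gram φ) (tensorGram hE hL φ e e') h1 hq (localForm φ e e' u) z)
                (siuLowerBound (g.gram φ) (tensorGram hE hL φ e e') h1 hq c
                  (localForm φ e e' u) z) ∧
              TopGE (g.gram φ z)
                (ddbarTWedgeOmega (g.gram φ) (tensorGram hE hL φ e e') h1 hq
                  (localForm φ e e' u) z)
                (siuLowerBound (g.gram φ) (tensorGram hE hL φ e e') h1 hq c
                  (localForm φ e e' u) z)) ∧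
          (g.IsKahler →
            ddbarTOmega (g.gram φ) (tensorGram hE hL φ e e') h1 hq (localForm φ e e' u) z =
                bochnerTerm (g.gram φ) (tensorGram hE hL φ e e') h1 hq (localForm φ e e' u) z ∧
              ddbarTWedgeOmega (g.gram φ) (tensorGram hE hL φ e e') h1 hq
                  (localForm φ e e' u) z =
                bochnerTerm (g.gram φ) (tensorGram hE hL φ e e') h1 hq
                  (localForm φ e e' u) z) := by
  obtain ⟨K, hK, hT, hK0⟩ : ∃ K : ℝ, 0 ≤ K ∧
      (∀ φ ∈ atlas (Cn n) X, ∀ z ∈ φ.target, TorsionLE g q K φ z) ∧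
      (g.DbarOmegaPowEqZero (q - 1) → g.DbarOmegaPowEqZero q → K = 0) := by
    -- The bound must be chosen as exactly 0 when ∂̄ω_{q-1} and ∂̄ω_q vanish, since the compactness
    -- argument only yields some bound.
    by_cases h : g.DbarOmegaPowEqZero (q - 1) ∧ g.DbarOmegaPowEqZero q
    · exact ⟨0, le_rfl, fun φ hφ z hz => torsionLE_zero h.1 h.2 hφ hz, fun _ _ => rfl⟩
    · obtain ⟨K, hK, hT⟩ := exists_torsionLE g q
      exact ⟨K, hK, hT, fun h1 h2 => absurd ⟨h1, h2⟩ h⟩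
  have hc0 : g.DbarOmegaPowEqZero (q - 1) → g.DbarOmegaPowEqZero q →
      comassConst n * K + 6 * (comassConst n * K) ^ 2 = 0 := fun h1 h2 => by simp [hK0 h1 h2]
  refine ⟨comassConst n * K + 6 * (comassConst n * K) ^ 2, ?_, hc0,
    fun hg => hc0 (hg.dbarOmegaPowEqZero _) (hg.dbarOmegaPowEqZero _), ?_⟩
  · have := mul_nonneg (show 0 ≤ comassConst n by rw [comassConst]; positivity) hK
    positivity
  intro r E L _ _ _ _ _ _ _ _ _ _ _ _ _ _ hE hL u hu htype φ hφ e _ e' _ z hz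
  have hU := isOpen_domainOf φ e e'
  have hsub : domainOf φ e e' ⊆ φ.target := Set.inter_subset_left
  have hG' := isMetricOn_gram g hφ
  have hG : IsMetricOn (domainOf φ e e') (g.gram φ) :=
    ⟨fun i j => (hG'.smooth i j).mono hsub, fun w hw => hG'.posDef w (hsub hw)⟩
  have hH := isMetricOn_tensorGram hE hL hφ e e'
  have hw : ∀ α, ∀ w ∈ domainOf φ e e', HasWeight (n - q : ℕ) (localForm φ e e' u α w) := by
    intro α w _
    rw [Nat.cast_sub hq]
    exact hasWeight_localForm htype φ e e' α w
  have hs := fun α => hu φ hφ e e' α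
  refine ⟨fun hcl => ?_, fun hg => ?_⟩
  · obtain ⟨t1, t2, t3⟩ := hT φ hφ z (hsub hz)
    exact chart_estimate h1 hq hU hG hH hs hw (fun α w hw => hcl φ hφ e e' α w hw) hz hK t1 t2 t3
  · exact chart_identity h1 hq hU hG hH hs hw
      (fun s w hw => hg.dbarOmegaPowEqZero s φ hφ w (hsub hw)) hz
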